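/- Let $L>0$ and let $\alpha\in\mathbb{C}$ with $\alpha\neq\pm2$. For $a\in(0,L)$ let $H_\alpha=H_{\alpha,a}$ be the operator in $L^2((0,L))\oplus H^1((0,L))$ given by $H_\alpha(v,w)=(w'',v)$ (with $w''$ taken on $(0,a)\cup(a,L)$), whose domain consists of all pairs $(v,w)$ with $v\in H^1_0((0,L))$, $w\in H^1_0((0,L))\cap H^2((0,a))\cap H^2((a,L))$ and $w'(a^+)-w'(a^-)=\alpha\, v(a)$. Let $(\lambda_j)_{j\ge1}$ be its eigenvalues, repeated according to algebraic multiplicity. For a branch of the logarithm whose cut contains no eigenvalue, let $\zeta(s)=\sum_j \lambda_j^{-s}$, $\lambda_j^{-s}=\mathrm{e}^{-s\log\lambda_j}$, for $\operatorname{Re}s>1$, extended meromorphically to $\mathbb{C}$, and put $\det(H_\alpha)=\exp(-\zeta'(0))$. Two branches are considered: (i) the cut is $\mathrm{e}^{i(\pi+\varepsilon)}(0,\infty)$ and the arguments are taken in $(-\pi+\varepsilon,\pi+\varepsilon)$, where $\varepsilon\in(0,\frac{\pi}{2})$ is such that no eigenvalue of $H_\alpha$ has an argument in $(\pi,\pi+\varepsilon]$;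 (ii) the cut is $\mathrm{e}^{-i\varepsilon}(0,\infty)$ and the arguments are taken in $(-\varepsilon,2\pi-\varepsilon)$, where $\varepsilon\in(0,\frac{\pi}{2})$ is such that no eigenvalue of $H_\alpha$ has an argument in $[-\varepsilon,0)$. Then, in each of the cases (i) and (ii), for every $a\in(0,L/2]$ such an $\varepsilon$ exists, and for every such $\varepsilon$ the spectral determinant is well defined (the eigenvalues are non-zero, the series converges absolutely for $\operatorname{Re}s>1$, and its meromorphic continuation exists and is regular at $0$). Moreover, for every choice $a\mapsto\varepsilon(a)$ of such numbers, the spectral determinant of $H_{\alpha,a}$ with respect to the cut given by $\varepsilon(a)$ is a continuous function of $a\in(0,L/2]$. -/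

import Mathlib

open MeasureTheory Set

/-! ## Sobolev functions on an interval -/

/-- `F` represents an element of the Sobolev space `H¹((c, d))` whose derivative is `g`:
`g` is square integrable on `(c, d)` and `F` is the absolutely continuous function on `[c, d]`
with derivative `g`, i.e. `F x = F c + ∫_c^x g`. The values of `F` on `[c, d]`, end points
included, are then the values (traces) of the Sobolev function. -/
def IsH1 (c d : ℝ) (F g : ℝ → ℂ) : Prop :=
  MemLp g 2 (volume.restrict (Ioo c d)) ∧
    ∀ x ∈ Icc c d, F x = F c + ∫ t in c..x, g t

/-- `F` represents an element of `H¹₀((c, d))` with derivative `g`. -/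
def IsH10 (c d : ℝ) (F g : ℝ → ℂ) : Prop :=
  IsH1 c d F g ∧ F c = 0 ∧ F d = 0

/-- `F` represents an element of `H²((c, d))` with first derivative `G` and second
derivative `h`; the values of `G` on `[c, d]` are the traces of `F'`. -/
def IsH2 (c d : ℝ) (F G h : ℝ → ℂ) : Prop :=
  IsH1 c d F G ∧ IsH1 c d G h

theorem IsH1.integrableOn {c d : ℝ} {F g : ℝ → ℂ} (h : IsH1 c d F g) :
    IntegrableOn g (Ioo c d) :=
  h.1.integrable (by norm_num)

theorem IsH1.intervalIntegrable {c d : ℝ} {F g : ℝ → ℂ} (h : IsH1 c d F g) {x : ℝ}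
    (hx : x ∈ Icc c d) : IntervalIntegrable g volume c x := by
  rw [intervalIntegrable_iff_integrableOn_Ioo_of_le hx.1]
  exact h.integrableOn.mono_set (Ioo_subset_Ioo_right hx.2)

theorem isH1_zero (c d : ℝ) : IsH1 c d 0 0 :=
  ⟨MemLp.zero, fun x _ => by simp⟩

theorem IsH1.add {c d : ℝ} {F g F' g' : ℝ → ℂ} (h : IsH1 c d F g) (h' : IsH1 c d F' g') :
    IsH1 c d (F + F') (g + g') := by
  refine ⟨h.1.add h'.1, fun x hx => ?_⟩
  have e : ∫ t in c..x, (g + g') t = (∫ t in c..x, g t) + ∫ t in c..x, g' t :=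
    intervalIntegral.integral_add (h.intervalIntegrable hx) (h'.intervalIntegrable hx)
  rw [e, Pi.add_apply, Pi.add_apply, h.2 x hx, h'.2 x hx]
  ring

theorem IsH1.smul {c d : ℝ} {F g : ℝ → ℂ} (z : ℂ) (h : IsH1 c d F g) :
    IsH1 c d (z • F) (z • g) := by
  refine ⟨h.1.const_smul z, fun x hx => ?_⟩
  have e : ∫ t in c..x, (z • g) t = z • ∫ t in c..x, g t :=
    intervalIntegral.integral_smul z g
  rw [e, Pi.smul_apply, Pi.smul_apply, h.2 x hx, smul_add]

/-- The derivative of an `H¹` function that vanishes almost everywhere is zero. -/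
theorem IsH1.eq_zero {c d : ℝ} {F g : ℝ → ℂ} (h : IsH1 c d F g)
    (hF : F =ᵐ[volume.restrict (Ioo c d)] 0) : g =ᵐ[volume.restrict (Ioo c d)] 0 := by
  rcases le_or_gt d c with hcd | hcd
  · rw [Ioo_eq_empty_of_le hcd, Measure.restrict_empty, ae_zero]
    exact Filter.eventually_bot
  have hi : IntervalIntegrable g volume c d := h.intervalIntegrable ⟨hcd.le, le_rfl⟩
  have hcont : ContinuousOn F (Ioo c d) := by
    have h1 : ContinuousOn (fun x => F c + ∫ t in c..x, g t) (Icc c d) := by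
      refine continuousOn_const.add ?_
      have := intervalIntegral.continuousOn_primitive_interval (μ := volume) (f := g)
        (a := c) (b := d) (by
          rw [uIcc_of_le hcd.le, integrableOn_Icc_iff_integrableOn_Ioo]
          exact h.integrableOn)
      rwa [uIcc_of_le hcd.le] at this
    exact (h1.congr h.2).mono Ioo_subset_Icc_self
  have hzero : EqOn F 0 (Ioo c d) :=
    Measure.eqOn_open_of_ae_eq hF isOpen_Ioo hcont continuousOn_const
  have hd := hi.ae_hasDerivAt_integral
  rw [Filter.EventuallyEq, ae_restrict_iff' measurableSet_Ioo]
  filter_upwards [hd] with x hx hxI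
  have hx' := hx (by rw [uIcc_of_le hcd.le]; exact Ioo_subset_Icc_self hxI) c
    (by rw [uIcc_of_le hcd.le]; exact ⟨le_rfl, hcd.le⟩)
  have hconst : (fun u => ∫ t in c..u, g t) =ᶠ[nhds x] fun _ => -F c := by
    filter_upwards [isOpen_Ioo.mem_nhds hxI] with u hu
    have e1 := h.2 u (Ioo_subset_Icc_self hu)
    rw [hzero hu] at e1
    simp only [Pi.zero_apply] at e1
    linear_combination -e1
  have := hx'.unique ((hasDerivAt_const x (-F c)).congr_of_eventuallyEq hconst)
  simpa using this

/-! ## The damped wave operator -/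

/-- The complex space `L²((0, L))`. -/
abbrev L2Space (L : ℝ) : Type := Lp ℂ 2 (volume.restrict (Ioo (0 : ℝ) L))

/-- The Sobolev space `H¹((0, L))` as a subspace of `L²((0, L))`. -/
noncomputable def H1Space (L : ℝ) : Submodule ℂ (L2Space L) where
  carrier := {w | ∃ W W' : ℝ → ℂ, w =ᵐ[volume.restrict (Ioo 0 L)] W ∧ IsH1 0 L W W'}
  add_mem' := by
    rintro w₁ w₂ ⟨W, W', h, hW⟩ ⟨X, X', k, hX⟩
    exact ⟨W + X, W' + X', (Lp.coeFn_add w₁ w₂).trans (h.add k), hW.add hX⟩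
  zero_mem' := ⟨0, 0, Lp.coeFn_zero _ _ _, isH1_zero 0 L⟩
  smul_mem' := by
    rintro z w ⟨W, W', h, hW⟩
    exact ⟨z • W, z • W', (Lp.coeFn_smul z w).trans (h.const_smul z), hW.smul z⟩

/-- The space `L²((0, L)) ⊕ H¹((0, L))` of pairs `(v, w)`. Eigenvalues, generalized eigenspaces
and the spectral determinant of an operator only involve its vector space structure. -/
abbrev EnergySpace (L : ℝ) : Type := L2Space L × H1Space L

/-- The graph of the damped wave operator with damping `α δ_a`: the pairs `((v, w), (f, k))`
such that `v ∈ H¹₀((0, L))`, `w ∈ H¹₀((0, L)) ∩ H²((0, a)) ∩ H²((a, L))`,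
`w'(a⁺) - w'(a⁻) = α v(a)`, `f = w''` on `(0, a) ∪ (a, L)`, and `k = v`.
Here `P` is `w'` on `[0, a]` and `Q` is `w'` on `[a, L]`. -/
noncomputable def dampedWaveGraph (L a : ℝ) (α : ℂ) :
    Submodule ℂ (EnergySpace L × EnergySpace L) where
  carrier := {p | ∃ V V' W W' P Q W'' : ℝ → ℂ,
    p.1.1 =ᵐ[volume.restrict (Ioo 0 L)] V ∧
    (p.1.2 : L2Space L) =ᵐ[volume.restrict (Ioo 0 L)] W ∧
    p.2.1 =ᵐ[volume.restrict (Ioo 0 L)] W'' ∧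
    (p.2.2 : L2Space L) = p.1.1 ∧
    IsH10 0 L V V' ∧ IsH10 0 L W W' ∧
    IsH2 0 a W P W'' ∧ IsH2 a L W Q W'' ∧
    Q a - P a = α * V a}
  add_mem' := by
    rintro p q ⟨V, V', W, W', P, Q, Z, h1, h2, h3, h4, ⟨h5, h5a, h5b⟩, ⟨h6, h6a, h6b⟩, h7, h8, h9⟩
      ⟨Va, Va', Wa, Wa', Pa, Qa, Za, k1, k2, k3, k4, ⟨k5, k5a, k5b⟩, ⟨k6, k6a, k6b⟩, k7, k8, k9⟩
    refine ⟨V + Va, V' + Va', W + Wa, W' + Wa', P + Pa, Q + Qa, Z + Za,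
      (Lp.coeFn_add _ _).trans (h1.add k1), (Lp.coeFn_add _ _).trans (h2.add k2),
      (Lp.coeFn_add _ _).trans (h3.add k3), ?_,
      ⟨h5.add k5, by simp [h5a, k5a], by simp [h5b, k5b]⟩,
      ⟨h6.add k6, by simp [h6a, k6a], by simp [h6b, k6b]⟩,
      ⟨h7.1.add k7.1, h7.2.add k7.2⟩, ⟨h8.1.add k8.1, h8.2.add k8.2⟩, ?_⟩
    · simp [h4, k4]
    · simp only [Pi.add_apply]
      linear_combination h9 + k9
  zero_mem' := by
    refine ⟨0, 0, 0, 0, 0, 0, 0, Lp.coeFn_zero _ _ _, Lp.coeFn_zero _ _ _, Lp.coeFn_zero _ _ _,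
      rfl, ⟨isH1_zero _ _, rfl, rfl⟩, ⟨isH1_zero _ _, rfl, rfl⟩,
      ⟨isH1_zero _ _, isH1_zero _ _⟩, ⟨isH1_zero _ _, isH1_zero _ _⟩, by simp⟩
  smul_mem' := by
    rintro z p ⟨V, V', W, W', P, Q, Z, h1, h2, h3, h4, ⟨h5, h5a, h5b⟩, ⟨h6, h6a, h6b⟩, h7, h8, h9⟩
    refine ⟨z • V, z • V', z • W, z • W', z • P, z • Q, z • Z,
      (Lp.coeFn_smul _ _).trans (h1.const_smul z), (Lp.coeFn_smul _ _).trans (h2.const_smul z),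
      (Lp.coeFn_smul _ _).trans (h3.const_smul z), ?_,
      ⟨h5.smul z, by simp [h5a], by simp [h5b]⟩,
      ⟨h6.smul z, by simp [h6a], by simp [h6b]⟩,
      ⟨h7.1.smul z, h7.2.smul z⟩, ⟨h8.1.smul z, h8.2.smul z⟩, ?_⟩
    · simp [h4]
    · simp only [Pi.smul_apply, smul_eq_mul]
      linear_combination z * h9

/-- The graph is single-valued. -/
theorem dampedWaveGraph_singleValued {L a : ℝ} (ha : a ∈ Ioo 0 L) (α : ℂ)
    (p : EnergySpace L × EnergySpace L) (hp : p ∈ dampedWaveGraph L a α) (h0 : p.1 = 0) :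
    p.2 = 0 := by
  obtain ⟨V, V', W, W', P, Q, Z, -, h2, h3, h4, -, -, h7, h8, -⟩ := hp
  have hW : W =ᵐ[volume.restrict (Ioo 0 L)] 0 := by
    rw [h0] at h2
    exact h2.symm.trans (Lp.coeFn_zero _ _ _)
  have s1 : Ioo 0 a ⊆ Ioo 0 L := Ioo_subset_Ioo_right ha.2.le
  have s2 : Ioo a L ⊆ Ioo 0 L := Ioo_subset_Ioo_left ha.1.le
  have e1 : Z =ᵐ[volume.restrict (Ioo 0 a)] 0 :=
    h7.2.eq_zero (h7.1.eq_zero (ae_restrict_of_ae_restrict_of_subset s1 hW))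
  have e2 : Z =ᵐ[volume.restrict (Ioo a L)] 0 :=
    h8.2.eq_zero (h8.1.eq_zero (ae_restrict_of_ae_restrict_of_subset s2 hW))
  have e3 : Z =ᵐ[volume.restrict (Ioo 0 L)] 0 := by
    rw [Filter.EventuallyEq, ae_restrict_iff' measurableSet_Ioo] at e1 e2 ⊢
    filter_upwards [e1, e2, Measure.ae_ne volume a] with x x1 x2 hne hx
    rcases lt_or_gt_of_ne hne with hlt | hgt
    · exact x1 ⟨hx.1, hlt⟩
    · exact x2 ⟨hgt, hx.2⟩
  refine Prod.ext ?_ ?_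
  · exact Lp.ext ((h3.trans e3).trans (Lp.coeFn_zero _ _ _).symm)
  · rw [h0] at h4
    exact Subtype.ext h4

/-- The damped wave operator `H_α`, `(v, w) ↦ (w'', v)`, with damping `α δ_a`. -/
noncomputable def dampedWaveOp (L a : ℝ) (α : ℂ) : EnergySpace L →ₗ.[ℂ] EnergySpace L :=
  (dampedWaveGraph L a α).toLinearPMap

theorem dampedWaveOp_graph {L a : ℝ} (ha : a ∈ Ioo 0 L) (α : ℂ) :
    (dampedWaveOp L a α).graph = dampedWaveGraph L a α :=
  Submodule.toLinearPMap_graph_eq _ (dampedWaveGraph_singleValued ha α)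

/-! ## Eigenvalues and algebraic multiplicities of an operator with a domain -/

/-- `z` is an eigenvalue of the (possibly unbounded) operator `T`. -/
def IsEigenvalue {E : Type*} [AddCommGroup E] [Module ℂ E] (T : E →ₗ.[ℂ] E) (z : ℂ) : Prop :=
  ∃ x : T.domain, x ≠ 0 ∧ T x = z • (x : E)

/-- The kernel of `(T - z)ⁿ` on its natural domain: `x` lies in the kernel of `(T - z)ⁿ⁺¹` if
and only if `x ∈ D(T)` and `(T - z) x` lies in the kernel of `(T - z)ⁿ`. -/
noncomputable def kerPow {E : Type*} [AddCommGroup E] [Module ℂ E] (T : E →ₗ.[ℂ] E) (z : ℂ) :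
    ℕ → Submodule ℂ E
  | 0 => ⊥
  | n + 1 => ((kerPow T z n).comap (T.toFun - z • T.domain.subtype)).map T.domain.subtype

/-- The algebraic multiplicity of `z`: the dimension of the generalized eigenspace
`⋃ₙ ker (T - z)ⁿ` (it is `0` if `z` is not an eigenvalue). -/
noncomputable def algMultiplicity {E : Type*} [AddCommGroup E] [Module ℂ E]
    (T : E →ₗ.[ℂ] E) (z : ℂ) : ℕ∞ :=
  Cardinal.toENat (Module.rank ℂ (⨆ n, kerPow T z n : Submodule ℂ E))

/-- `ev` is an enumeration of the eigenvalues of `T`, each repeated according to its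
algebraic multiplicity. -/
def IsEigenvalueSequence {E : Type*} [AddCommGroup E] [Module ℂ E]
    (T : E →ₗ.[ℂ] E) (ev : ℕ → ℂ) : Prop :=
  ∀ z : ℂ, {j | ev j = z}.encard = algMultiplicity T z

/-! ## The spectral determinant -/

/-- The branch of the complex logarithm whose cut is the ray `e^{iθ} (0, ∞)`, with imaginary
part in `(θ - 2π, θ]`. -/
noncomputable def logCut (θ : ℝ) (z : ℂ) : ℂ :=
  (Real.log ‖z‖ : ℂ) + ((toIocMod Real.two_pi_pos (θ - 2 * Real.pi) z.arg : ℝ) : ℂ) * Complex.I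

/-- `Z` is the spectral zeta function of `T` for the branch `logCut θ` of the logarithm: it is
given by the absolutely convergent sum `∑ⱼ λⱼ^{-s} = ∑ⱼ e^{-s log λⱼ}` over all eigenvalues for
`Re s > 1`, and is meromorphic on the complex plane. -/
def IsSpectralZeta {E : Type*} [AddCommGroup E] [Module ℂ E]
    (T : E →ₗ.[ℂ] E) (θ : ℝ) (Z : ℂ → ℂ) : Prop :=
  Meromorphic Z ∧ ∃ ev : ℕ → ℂ, IsEigenvalueSequence T ev ∧ (∀ j, ev j ≠ 0) ∧
    ∀ s : ℂ, 1 < s.re → HasSum (fun j => Complex.exp (-s * logCut θ (ev j))) (Z s)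

/-- `D` is the spectral determinant `exp (-ζ'(0))` of `T`, where the spectral zeta function `ζ`
is regular at `0`. -/
def HasSpectralDet {E : Type*} [AddCommGroup E] [Module ℂ E]
    (T : E →ₗ.[ℂ] E) (θ : ℝ) (D : ℂ) : Prop :=
  ∃ Z : ℂ → ℂ, IsSpectralZeta T θ Z ∧ AnalyticAt ℂ Z 0 ∧ D = Complex.exp (-deriv Z 0)

/-- The spectral determinant of `T` for the branch `logCut θ` of the logarithm. -/
noncomputable def spectralDet {E : Type*} [AddCommGroup E] [Module ℂ E]
    (T : E →ₗ.[ℂ] E) (θ : ℝ) : ℂ :=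
  Classical.epsilon (HasSpectralDet T θ)

/-- The cut `e^{i(π+ε)} (0, ∞)` lies just below the negative real axis: `0 < ε < π/2` and no
eigenvalue of `T` has an argument in `(π, π + ε]`. -/
def IsCutBelowNegAxis {E : Type*} [AddCommGroup E] [Module ℂ E]
    (T : E →ₗ.[ℂ] E) (ε : ℝ) : Prop :=
  ε ∈ Ioo 0 (Real.pi / 2) ∧ ∀ φ ∈ Ioc Real.pi (Real.pi + ε), ∀ r : ℝ, 0 < r →
    ¬ IsEigenvalue T (r * Complex.exp (φ * Complex.I))

/-- The cut `e^{-iε} (0, ∞)` lies just below the positive real axis: `0 < ε < π/2` and no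
eigenvalue of `T` has an argument in `[-ε, 0)`. -/
def IsCutBelowPosAxis {E : Type*} [AddCommGroup E] [Module ℂ E]
    (T : E →ₗ.[ℂ] E) (ε : ℝ) : Prop :=
  ε ∈ Ioo 0 (Real.pi / 2) ∧ ∀ φ ∈ Ico (-ε) 0, ∀ r : ℝ, 0 < r →
    ¬ IsEigenvalue T (r * Complex.exp (φ * Complex.I))

/-!
The spectral determinant of `H_α` is computed explicitly, and turns out not to depend on `a`: it is
`4 L / (2 - α)` for a cut in the left half-plane and `-4 L / (2 + α)` for a cut in the right one.

A vector `(v, w)` in the kernel of `H_α - ζ` satisfies `v = ζ w` and `w'' = ζ² w` off `a`, so it is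
a multiple of the solution `shooting a α ζ` started at `0` with slope `1`, and `ζ` is an eigenvalue
if and only if the entire function `G(ζ) = dampedCharFun L a α ζ`, the value of this solution at
`L`, vanishes; here `ζ G(ζ) = sinh(ζ L) + α sinh(ζ a) sinh(ζ (L - a))`. The Taylor coefficients in
`ζ` of the family of solutions form the only Jordan chain at an eigenvalue, and the chain stops at
the order of the zero, so algebraic multiplicities are orders of zeros of `G`
(`algMultiplicity_dampedWaveOp`).

The remaining part concerns the zeros `λ` of an entire function `G` of exponential type. Dividing
out the zeros in large discs and estimating the cofactor by Borel–Carathéodory gives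
`∑ 1 / (z - λ)² = -(log G)''(z)` (`EnumeratesZeros.hasSum_deriv_logDeriv`). On a ray `z = t u`
without zeros, multiply this by `u²` and take Mellin transforms in `t`: at the point `2 - s` the
left-hand side becomes `Γ(s) Γ(2 - s) ∑ (-λ / u)^{-s}`. If `z G(z) = e^{κ z} E(z)`, where `E` tends to
a constant `K ≠ 0` exponentially fast along the ray (`RayAsymptotics`), then the right-hand side is
`-1 / t²` up to an exponentially small error. This continues the zeta function to an entire
function, and an integration by parts in the Mellin integral at `s = 0` gives `det = -G(0) / K`
(`RayAsymptotics.exp_mellin_two`, `hasSpectralDet_iff`).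

For `H_α` one has `G(0) = L`, and `K = (α + 2 σ) / 4`, where `σ = ± 1` is the sign of the real part
of the direction of the cut (`hasSpectralDet_dampedWaveOp_iff`). As `α ≠ ± 2`, neither constant
vanishes; the eigenvalues then lie in a vertical strip, which yields admissible cuts.
-/

open Filter Topology

/-! ### Zeros of entire functions -/

/-- An entire function of order `n` at `w` is `(z - w) ^ n` times an entire function that does not
vanish at `w`. -/
theorem exists_differentiable_eq_pow_mul {w : ℂ} (n : ℕ) :
    ∀ {G : ℂ → ℂ}, Differentiable ℂ G → analyticOrderAt G w = n →
      ∃ g : ℂ → ℂ, Differentiable ℂ g ∧ (∀ z, G z = (z - w) ^ n * g z) ∧ g w ≠ 0 := by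
  induction n with
  | zero =>
    intro G hG h
    refine ⟨G, hG, fun z => by simp, ?_⟩
    exact (hG.analyticAt w).analyticOrderAt_eq_zero.1 (by simpa using h)
  | succ n ih =>
    intro G hG h
    have h0 : G w = 0 := by
      by_contra h0
      rw [(hG.analyticAt w).analyticOrderAt_eq_zero.2 h0] at h
      exact absurd h.symm (by simp)
    have hd : Differentiable ℂ (dslope G w) := by
      rw [← differentiableOn_univ] at hG ⊢
      exact (Complex.differentiableOn_dslope Filter.univ_mem).2 hG
    have he : G = (fun z => z - w) * dslope G w := by
      funext z
      simpa [h0] using (sub_smul_dslope G w z).symm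
    have ho : analyticOrderAt (dslope G w) w = n := by
      rw [he, analyticOrderAt_mul (by fun_prop) (hd.analyticAt w)] at h
      have h1 : analyticOrderAt (fun z : ℂ => z - w) w = 1 := analyticOrderAt_id_sub_const_self
      rw [h1, Nat.cast_add, Nat.cast_one, add_comm] at h
      exact (ENat.add_left_injective_of_ne_top (n := 1) (by simp)) h
    obtain ⟨g, hg, hgz, hgw⟩ := ih hd ho
    refine ⟨g, hg, fun z => ?_, hgw⟩
    have := congrFun he z
    simp only [Pi.mul_apply] at this
    rw [this, hgz z, pow_succ']
    ring

/-- All zeros of an entire function that lie in a given finite set can be divided out. -/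
theorem exists_differentiable_eq_prod_mul {G : ℂ → ℂ} (hG : Differentiable ℂ G)
    (hfin : ∀ z, analyticOrderAt G z ≠ ⊤) (S : Finset ℂ) :
    ∃ g : ℂ → ℂ, Differentiable ℂ g ∧
      (∀ z, G z = (∏ w ∈ S, (z - w) ^ analyticOrderNatAt G w) * g z) ∧ ∀ w ∈ S, g w ≠ 0 := by
  classical
  induction S using Finset.induction_on with
  | empty => exact ⟨G, hG, fun z => by simp, by simp⟩
  | insert w S hw ih =>
    obtain ⟨g, hg, hgz, hgS⟩ := ih
    have hP : Differentiable ℂ fun z => ∏ w ∈ S, (z - w) ^ analyticOrderNatAt G w := by fun_prop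
    have ho : analyticOrderAt g w = analyticOrderNatAt G w := by
      rw [Nat.cast_analyticOrderNatAt (hfin w)]
      have he : G = (fun z => ∏ w ∈ S, (z - w) ^ analyticOrderNatAt G w) * g := funext hgz
      conv_rhs => rw [he]
      rw [analyticOrderAt_mul (hP.analyticAt w) (hg.analyticAt w),
        (hP.analyticAt w).analyticOrderAt_eq_zero.2, zero_add]
      refine Finset.prod_ne_zero_iff.2 fun v hv => pow_ne_zero _ (sub_ne_zero.2 ?_)
      rintro rfl
      exact hw hv
    obtain ⟨k, hk, hkz, hkw⟩ := exists_differentiable_eq_pow_mul _ hg ho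
    refine ⟨k, hk, fun z => ?_, fun v hv => ?_⟩
    · rw [Finset.prod_insert hw, hgz z, hkz z]
      ring
    · rcases Finset.mem_insert.1 hv with rfl | hv
      · exact hkw
      · have := hgS v hv
        rw [hkz v] at this
        exact right_ne_zero_of_mul this

theorem Differentiable.analyticOrderAt_ne_top {G : ℂ → ℂ} (hG : Differentiable ℂ G) (h0 : G 0 ≠ 0)
    (z : ℂ) : analyticOrderAt G z ≠ ⊤ := by
  rw [ne_eq, AnalyticOnNhd.analyticOrderAt_eq_top_iff_eq_zero z fun w => hG.analyticAt w]
  rintro rfl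
  exact h0 rfl

theorem Differentiable.finite_zeros_norm_le {G : ℂ → ℂ} (hG : Differentiable ℂ G) (h0 : G 0 ≠ 0)
    (R : ℝ) : {z | ‖z‖ ≤ R ∧ G z = 0}.Finite := by
  have h1 := AnalyticOnNhd.preimage_zero_mem_codiscrete (f := G) (fun z _ => hG.analyticAt z) h0
  have h2 := Filter.codiscreteWithin_mono (subset_univ (Metric.closedBall (0 : ℂ) R)) h1
  refine (IsCompact.finite_sdiff_of_mem_codiscreteWithin (isCompact_closedBall (0 : ℂ) R) h2).subset ?_
  rintro z ⟨hz, hz'⟩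
  exact ⟨by simpa using hz, by simpa using hz'⟩

/-- The family `lam` enumerates the zeros of `G`, each repeated according to its multiplicity. -/
def EnumeratesZeros {J : Type*} (G : ℂ → ℂ) (lam : J → ℂ) : Prop :=
  ∀ z, {j | lam j = z}.encard = analyticOrderAt G z

namespace EnumeratesZeros

variable {J : Type*} {G : ℂ → ℂ} {lam : J → ℂ}

theorem apply_eq_zero_iff (h : EnumeratesZeros G lam) (hG : Differentiable ℂ G) {z : ℂ} :
    G z = 0 ↔ ∃ j, lam j = z := by
  rw [← not_iff_not, ← ne_eq, ← (hG.analyticAt z).analyticOrderAt_eq_zero, ← h z, encard_eq_zero,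
    eq_empty_iff_forall_notMem, not_exists]
  rfl

theorem ne_zero (h : EnumeratesZeros G lam) (hG : Differentiable ℂ G) (h0 : G 0 ≠ 0) (j : J) :
    lam j ≠ 0 := fun hj => h0 ((h.apply_eq_zero_iff hG).2 ⟨j, hj⟩)

theorem finite_fiber (h : EnumeratesZeros G lam) (hG : Differentiable ℂ G) (h0 : G 0 ≠ 0) (z : ℂ) :
    {j | lam j = z}.Finite := by
  rw [← encard_lt_top_iff, h z]
  exact lt_top_iff_ne_top.2 (hG.analyticOrderAt_ne_top h0 z)

theorem finite_norm_le (h : EnumeratesZeros G lam) (hG : Differentiable ℂ G) (h0 : G 0 ≠ 0)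
    (R : ℝ) : {j | ‖lam j‖ ≤ R}.Finite := by
  refine ((hG.finite_zeros_norm_le h0 R).preimage' (f := lam) fun z _ =>
    h.finite_fiber hG h0 z).subset fun j hj => ?_
  exact ⟨hj, (h.apply_eq_zero_iff hG).2 ⟨j, rfl⟩⟩

theorem exists_eq_prod_mul (h : EnumeratesZeros G lam) (hG : Differentiable ℂ G) (h0 : G 0 ≠ 0)
    {R : ℝ} {s : Finset J} (hs : ∀ j, j ∈ s ↔ ‖lam j‖ ≤ R) :
    ∃ g : ℂ → ℂ, Differentiable ℂ g ∧ (∀ z, G z = (∏ j ∈ s, (1 - z / lam j)) * g z) ∧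
      ∀ z, ‖z‖ ≤ R → g z ≠ 0 := by
  classical
  obtain ⟨g, hg, hgz, hgS⟩ :=
    exists_differentiable_eq_prod_mul hG (hG.analyticOrderAt_ne_top h0) (s.image lam)
  have hcard : ∀ w ∈ s.image lam, {j ∈ s | lam j = w}.card = analyticOrderNatAt G w := by
    intro w hw
    have hset : ({j ∈ s | lam j = w} : Set J) = {j | lam j = w} := by
      ext j
      simp only [mem_ofPred_eq, and_iff_right_iff_imp]
      rintro rfl
      obtain ⟨i, hi, hij⟩ := Finset.mem_image.1 hw
      rw [hs, ← hij]
      exact (hs i).1 hi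
    have := h w
    rw [← hset, ← Nat.cast_analyticOrderNatAt (hG.analyticOrderAt_ne_top h0 w)] at this
    rw [← Nat.cast_inj (R := ℕ∞), ← this, ← encard_coe_eq_coe_finsetCard]
    simp
  have hprod : ∀ z, ∏ w ∈ s.image lam, (z - w) ^ analyticOrderNatAt G w =
      (∏ j ∈ s, (1 - z / lam j)) * ∏ j ∈ s, (-lam j) := by
    intro z
    rw [← Finset.prod_mul_distrib,
      Finset.prod_congr rfl fun w hw => congrArg ((z - w) ^ ·) (hcard w hw).symm,
      ← Finset.prod_comp (fun w => z - w) lam]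
    refine Finset.prod_congr rfl fun j _ => ?_
    have := h.ne_zero hG h0 j
    field_simp
    ring
  refine ⟨fun z => (∏ j ∈ s, (-lam j)) * g z, by fun_prop, fun z => ?_, fun z hz => ?_⟩
  · rw [hgz z, hprod z]
    ring
  · refine mul_ne_zero (Finset.prod_ne_zero_iff.2 fun j _ => neg_ne_zero.2 (h.ne_zero hG h0 j)) ?_
    by_cases hGz : G z = 0
    · obtain ⟨j, rfl⟩ := (h.apply_eq_zero_iff hG).1 hGz
      exact hgS _ (Finset.mem_image_of_mem _ ((hs j).2 hz))
    · rw [hgz z] at hGz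
      exact right_ne_zero_of_mul hGz

/-- The maximum principle bounds the cofactor of the zeros in the disc of radius `R`: on the
circle of radius `4 R` each factor `1 - z / lam j` has modulus at least `3`. -/
theorem norm_cofactor_le {A B R : ℝ} (hbd : ∀ z, ‖G z‖ ≤ A * Real.exp (B * ‖z‖)) (hR : 0 < R)
    {s : Finset J} (hs : ∀ j ∈ s, ‖lam j‖ ≤ R ∧ lam j ≠ 0) {g : ℂ → ℂ} (hg : Differentiable ℂ g)
    (hGg : ∀ z, G z = (∏ j ∈ s, (1 - z / lam j)) * g z) {z : ℂ} (hz : ‖z‖ ≤ 4 * R) :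
    3 ^ s.card * ‖g z‖ ≤ A * Real.exp (4 * B * R) := by
  have key : ‖g z‖ ≤ A * Real.exp (4 * B * R) / 3 ^ s.card := by
    refine Complex.norm_le_of_forall_mem_frontier_norm_le (U := Metric.ball 0 (4 * R))
      Metric.isBounded_ball hg.diffContOnCl (fun w hw => ?_) (by
        rw [closure_ball _ (by positivity)]; simpa using hz)
    rw [frontier_ball _ (by positivity), mem_sphere_zero_iff_norm] at hw
    rw [le_div_iff₀ (by positivity), mul_comm]
    have h1 : (3 : ℝ) ^ s.card ≤ ‖∏ j ∈ s, (1 - w / lam j)‖ := by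
      rw [norm_prod, ← Finset.prod_const]
      refine Finset.prod_le_prod (fun _ _ => by norm_num) fun j hj => ?_
      obtain ⟨hj1, hj2⟩ := hs j hj
      have h2 : (4 : ℝ) ≤ ‖w / lam j‖ := by
        rw [norm_div, hw, le_div_iff₀ (norm_pos_iff.2 hj2)]
        linarith
      have h3 := norm_sub_norm_le (w / lam j) 1
      rw [norm_sub_rev, norm_one] at h3
      linarith
    calc 3 ^ s.card * ‖g w‖ ≤ ‖∏ j ∈ s, (1 - w / lam j)‖ * ‖g w‖ := by gcongr
      _ = ‖G w‖ := by rw [hGg w, norm_mul]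
      _ ≤ A * Real.exp (B * ‖w‖) := hbd w
      _ = _ := by rw [hw]; ring_nf
  rw [le_div_iff₀ (by positivity)] at key
  linarith

/-- An entire function of exponential type has `O(R)` zeros in the disc of radius `R`. -/
theorem card_le (h : EnumeratesZeros G lam) (hG : Differentiable ℂ G) (h0 : G 0 ≠ 0)
    {A B R : ℝ} (hbd : ∀ z, ‖G z‖ ≤ A * Real.exp (B * ‖z‖)) (hR : 0 < R)
    {s : Finset J} (hs : ∀ j, j ∈ s ↔ ‖lam j‖ ≤ R) :
    (s.card : ℝ) ≤ Real.log (A / ‖G 0‖) + 4 * B * R := by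
  obtain ⟨g, hg, hGg, -⟩ := h.exists_eq_prod_mul hG h0 hs
  have h1 := norm_cofactor_le hbd hR (s := s)
    (fun j hj => ⟨(hs j).1 hj, h.ne_zero hG h0 j⟩) hg hGg (z := 0) (by simp; positivity)
  have h2 : g 0 = G 0 := by simpa using (hGg 0).symm
  have hG0 : 0 < ‖G 0‖ := norm_pos_iff.2 h0
  have hA : 0 < A := by
    have := hG0.trans_le (hbd 0)
    simpa using this
  rw [h2, ← le_div_iff₀ hG0] at h1
  have h3 : Real.exp s.card ≤ 3 ^ s.card := by
    rw [← mul_one (s.card : ℝ), Real.exp_nat_mul]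
    gcongr
    exact Real.exp_one_lt_three.le
  have h4 := h3.trans h1
  rw [← Real.le_log_iff_exp_le (by positivity), mul_div_right_comm,
    Real.log_mul (by positivity) (by positivity), Real.log_exp] at h4
  exact h4

end EnumeratesZeros

/-! ### Partial fractions for entire functions of exponential type -/

/-- The Borel–Carathéodory theorem and Cauchy's estimate bound the second derivative of the
logarithm of a function without zeros in a disc. -/
theorem norm_deriv_logDeriv_le {g : ℂ → ℂ} (hg : Differentiable ℂ g) {R M : ℝ} (hR : 0 < R)
    (hM : 0 < M) (hne : ∀ z, ‖z‖ ≤ R → g z ≠ 0)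
    (hbd : ∀ z, ‖z‖ ≤ R → ‖g z‖ ≤ ‖g 0‖ * Real.exp M) {z : ℂ} (hz : ‖z‖ ≤ R / 4) :
    ‖deriv (logDeriv g) z‖ ≤ 64 * M / R ^ 2 := by
  have hd : DifferentiableOn ℂ (logDeriv g) (Metric.ball 0 R) := by
    refine DifferentiableOn.div ?_ hg.differentiableOn fun w hw => hne w ?_
    · exact hg.differentiableOn.deriv Metric.isOpen_ball
    · exact (mem_ball_zero_iff.1 hw).le
  obtain ⟨l, hl0, hl⟩ := hd.isExactOn_ball.with_val_at 0 0
  have hld : DifferentiableOn ℂ l (Metric.ball 0 R) := fun w hw =>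
    (hl w hw).differentiableAt.differentiableWithinAt
  have hexp : ∀ w ∈ Metric.ball (0 : ℂ) R, g w = g 0 * Complex.exp (l w) := by
    intro w hw
    have hconst : ∀ v ∈ Metric.ball (0 : ℂ) R,
        HasDerivWithinAt (fun v => g v * Complex.exp (-l v)) 0 (Metric.ball 0 R) v := by
      intro v hv
      have h1 := (hg v).hasDerivAt.mul (hl v hv).neg.cexp
      have hgv := hne v (mem_ball_zero_iff.1 hv).le
      refine HasDerivAt.hasDerivWithinAt (h1.congr_deriv ?_)
      rw [logDeriv_apply]
      field_simp
      simp
    have h2 := (convex_ball (0 : ℂ) R).is_const_of_fderivWithin_eq_zero (𝕜 := ℂ)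
      (f := fun v => g v * Complex.exp (-l v))
      (fun v hv => (hconst v hv).differentiableWithinAt)
      (fun v hv => by
        have := (hconst v hv).hasFDerivWithinAt.fderivWithin (Metric.isOpen_ball.uniqueDiffWithinAt hv)
        rw [this]; ext; simp) hw (Metric.mem_ball_self hR)
    simp only [hl0, neg_zero, Complex.exp_zero, mul_one] at h2
    rw [← h2, mul_assoc, ← Complex.exp_add]
    simp
  have hre : MapsTo l (Metric.ball 0 R) {w | w.re ≤ M} := by
    intro w hw
    have hw' := (mem_ball_zero_iff.1 hw).le
    have h1 := hbd w hw'
    rw [hexp w hw, norm_mul, Complex.norm_exp] at h1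
    have h2 := hne 0 (by simpa using hR.le)
    exact Real.exp_le_exp.1 (le_of_mul_le_mul_left h1 (norm_pos_iff.2 h2))
  have hlb : ∀ w, ‖w‖ ≤ R / 2 → ‖l w‖ ≤ 2 * M := by
    intro w hw
    refine (Complex.borelCaratheodory_zero hM hld hre hR
      (by rw [mem_ball_zero_iff]; linarith) hl0).trans ?_
    rw [div_le_iff₀ (by linarith)]
    nlinarith
  have hzb : z ∈ Metric.ball (0 : ℂ) R := by rw [mem_ball_zero_iff]; linarith
  have h2 : deriv (logDeriv g) z = iteratedDeriv 2 l z := by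
    rw [iteratedDeriv_succ, iteratedDeriv_one]
    refine Filter.EventuallyEq.deriv_eq ?_
    filter_upwards [Metric.isOpen_ball.mem_nhds hzb] with w hw
    exact (hl w hw).deriv.symm
  rw [h2]
  refine (Complex.norm_iteratedDeriv_le_of_forall_mem_sphere_norm_le (R := R / 4) (C := 2 * M) 2
    (by positivity) (hld.diffContOnCl_ball ?_) fun w hw => hlb w ?_).trans (le_of_eq ?_)
  · intro w hw
    rw [mem_closedBall_iff_norm] at hw
    rw [mem_ball_zero_iff]
    have := norm_le_norm_add_norm_sub' w z
    linarith
  · rw [mem_sphere_iff_norm] at hw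
    have := norm_le_norm_add_norm_sub' w z
    linarith
  · simp only [Nat.factorial_two, Nat.cast_ofNat]
    field_simp
    ring

theorem deriv_logDeriv_prod_mul {J : Type*} {lam : J → ℂ} (hlam : ∀ j, lam j ≠ 0) {s : Finset J}
    {G g : ℂ → ℂ} (hg : Differentiable ℂ g)
    (hGg : ∀ z, G z = (∏ j ∈ s, (1 - z / lam j)) * g z) {z : ℂ} (hz : G z ≠ 0) :
    deriv (logDeriv G) z = deriv (logDeriv g) z - ∑ j ∈ s, 1 / (z - lam j) ^ 2 := by
  have hG : Differentiable ℂ G := by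
    rw [show G = fun z => (∏ j ∈ s, (1 - z / lam j)) * g z from funext hGg]
    fun_prop
  have hne : ∀ w, G w ≠ 0 → g w ≠ 0 ∧ ∀ j ∈ s, 1 - w / lam j ≠ 0 := by
    intro w hw
    rw [hGg w] at hw
    exact ⟨right_ne_zero_of_mul hw, Finset.prod_ne_zero_iff.1 (left_ne_zero_of_mul hw)⟩
  have hsub : ∀ w, ∀ j ∈ s, 1 - w / lam j ≠ 0 → w - lam j ≠ 0 := by
    intro w j _ h h'
    apply h
    rw [sub_eq_zero.1 h', div_self (hlam j), sub_self]
  have hlog : ∀ w, G w ≠ 0 → logDeriv G w = logDeriv g w + ∑ j ∈ s, 1 / (w - lam j) := by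
    intro w hw
    obtain ⟨h1, h2⟩ := hne w hw
    rw [show G = fun z => (∏ j ∈ s, (1 - z / lam j)) * g z from funext hGg,
      logDeriv_mul w (Finset.prod_ne_zero_iff.2 h2) h1 (by fun_prop) (hg w),
      logDeriv_prod h2 (fun j _ => by fun_prop), add_comm]
    congr 1
    refine Finset.sum_congr rfl fun j hj => ?_
    have hd : HasDerivAt (fun z => 1 - z / lam j) (-(1 / lam j)) w :=
      ((hasDerivAt_id w).div_const (lam j)).const_sub 1
    rw [logDeriv_apply, hd.deriv]
    have h3 := hlam j
    have h4 := h2 j hj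
    have h5 := hsub w j hj h4
    have h6 : lam j - w ≠ 0 := fun h => h5 (by linear_combination -h)
    field_simp
    ring
  have hev : logDeriv G =ᶠ[𝓝 z] fun w => logDeriv g w + ∑ j ∈ s, 1 / (w - lam j) := by
    filter_upwards [hG.continuous.continuousAt.eventually_ne hz] with w hw
    exact hlog w hw
  rw [hev.deriv_eq]
  obtain ⟨h1, h2⟩ := hne z hz
  have hdg : DifferentiableAt ℂ (logDeriv g) z := by
    refine DifferentiableAt.div ?_ (hg z) h1
    exact (hg.analyticAt z).deriv.differentiableAt
  have hds : HasDerivAt (fun w => ∑ j ∈ s, 1 / (w - lam j)) (∑ j ∈ s, -(1 / (z - lam j) ^ 2)) z := by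
    refine HasDerivAt.fun_sum fun j hj => ?_
    have h3 := (((hasDerivAt_id z).sub_const (lam j)).inv (hsub z j hj (h2 j hj)))
    simp only [id, one_div] at h3 ⊢
    refine h3.congr_deriv ?_
    rw [neg_div, one_div]
  rw [(hdg.hasDerivAt.fun_add hds).deriv, Finset.sum_neg_distrib, sub_eq_add_neg]

/-- If the number of indices with `f j ≤ R` grows at most linearly in `R`, then `∑ f j ^ (-σ)`
converges for `σ > 1`. The sum is compared with a geometric series over dyadic blocks. -/
theorem summable_rpow_of_card_le {J : Type*} {f : J → ℝ} {a b r : ℝ} (hr : 0 < r)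
    (hf : ∀ j, r ≤ f j)
    (hcard : ∀ R : ℝ, 0 < R → ∀ s : Finset J, (∀ j ∈ s, f j ≤ R) → (s.card : ℝ) ≤ a + b * R)
    {σ : ℝ} (hσ : 1 < σ) : Summable fun j => f j ^ (-σ) := by
  classical
  have hfin : ∀ j, ∃ n : ℕ, f j ≤ r * 2 ^ (n + 1) := by
    intro j
    obtain ⟨n, hn⟩ := pow_unbounded_of_one_lt (f j / r) (one_lt_two (α := ℝ))
    refine ⟨n, ?_⟩
    rw [div_lt_iff₀ hr] at hn
    rw [pow_succ]
    have : (0 : ℝ) < 2 ^ n := by positivity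
    nlinarith
  have hlow : ∀ j, r * 2 ^ (Nat.find (hfin j)) ≤ f j := by
    intro j
    rcases h : Nat.find (hfin j) with _ | n
    · simpa using hf j
    · exact (not_le.1 (Nat.find_min (hfin j) (m := n) (by omega))).le
  have ha : 0 ≤ a + b * r := by simpa using hcard r hr ∅ (by simp)
  set c : ℕ → ℝ := fun n => (|a| + |b| * (r * 2 ^ (n + 1))) * (r * 2 ^ n) ^ (-σ) with hc
  have hcs : Summable c := by
    have e : ∀ n : ℕ, c n = |a| * r ^ (-σ) * ((2 : ℝ) ^ (-σ)) ^ n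
        + 2 * |b| * r * r ^ (-σ) * ((2 : ℝ) ^ (1 - σ)) ^ n := by
      intro n
      have e1 : (r * 2 ^ n) ^ (-σ) = r ^ (-σ) * ((2 : ℝ) ^ (-σ)) ^ n := by
        rw [Real.mul_rpow hr.le (by positivity), ← Real.rpow_natCast 2 n, ← Real.rpow_mul (by norm_num),
          mul_comm (n : ℝ), Real.rpow_mul (by norm_num), Real.rpow_natCast]
      have e2 : (2 : ℝ) ^ (1 - σ) = 2 * 2 ^ (-σ) := by
        rw [sub_eq_add_neg, Real.rpow_add (by norm_num), Real.rpow_one]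
      simp only [hc, e1, e2, mul_pow, pow_succ]
      ring
    rw [funext e]
    refine Summable.add ?_ ?_ <;> refine Summable.mul_left _ (summable_geometric_of_lt_one
      (by positivity) (Real.rpow_lt_one_of_one_lt_of_neg (by norm_num) (by linarith)))
  refine summable_of_sum_le (c := ∑' n, c n)
    (fun j => Real.rpow_nonneg (hr.le.trans (hf j)) _) fun s => ?_
  calc ∑ j ∈ s, f j ^ (-σ)
      = ∑ n ∈ s.image fun j => Nat.find (hfin j),
          ∑ j ∈ s with Nat.find (hfin j) = n, f j ^ (-σ) :=
        (Finset.sum_fiberwise_of_maps_to (fun j hj => Finset.mem_image_of_mem _ hj) _).symm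
    _ ≤ ∑ n ∈ s.image fun j => Nat.find (hfin j), c n := by
        refine Finset.sum_le_sum fun n _ => ?_
        have h1 : ∀ j ∈ s.filter (fun j => Nat.find (hfin j) = n),
            f j ^ (-σ) ≤ (r * 2 ^ n) ^ (-σ) := by
          intro j hj
          have hj' := (Finset.mem_filter.1 hj).2
          refine Real.rpow_le_rpow_of_nonpos (by positivity) ?_ (by linarith)
          rw [← hj']
          exact hlow j
        refine (Finset.sum_le_card_nsmul _ _ _ h1).trans ?_
        rw [nsmul_eq_mul]
        refine mul_le_mul_of_nonneg_right ?_ (by positivity)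
        refine (hcard (r * 2 ^ (n + 1)) (by positivity) _ fun j hj => ?_).trans ?_
        · rw [← (Finset.mem_filter.1 hj).2]
          exact Nat.find_spec (hfin j)
        · have h2 : (0 : ℝ) ≤ r * 2 ^ (n + 1) := by positivity
          have := le_abs_self a
          have := mul_le_mul_of_nonneg_right (le_abs_self b) h2
          linarith
    _ ≤ ∑' n, c n := hcs.sum_le_tsum _ fun n _ => by positivity

namespace EnumeratesZeros

variable {J : Type*} {G : ℂ → ℂ} {lam : J → ℂ}

theorem exists_norm_ge (h : EnumeratesZeros G lam) (hG : Differentiable ℂ G) (h0 : G 0 ≠ 0) :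
    ∃ r : ℝ, 0 < r ∧ ∀ j, r ≤ ‖lam j‖ := by
  obtain ⟨r, hr, hb⟩ := Metric.eventually_nhds_iff.1 (hG.continuous.continuousAt.eventually_ne h0)
  refine ⟨r, hr, fun j => ?_⟩
  by_contra! hj
  exact hb (by simpa using hj) ((h.apply_eq_zero_iff hG).2 ⟨j, rfl⟩)

theorem summable_norm_rpow (h : EnumeratesZeros G lam) (hG : Differentiable ℂ G) (h0 : G 0 ≠ 0)
    {A B : ℝ} (hbd : ∀ z, ‖G z‖ ≤ A * Real.exp (B * ‖z‖)) {σ : ℝ} (hσ : 1 < σ) :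
    Summable fun j => ‖lam j‖ ^ (-σ) := by
  obtain ⟨r, hr, hb⟩ := h.exists_norm_ge hG h0
  refine summable_rpow_of_card_le hr hb (a := Real.log (A / ‖G 0‖)) (b := 4 * B)
    (fun R hR s hs => ?_) hσ
  have hfin := h.finite_norm_le hG h0 R
  refine le_trans ?_ (h.card_le hG h0 hbd hR (s := hfin.toFinset) (by simp))
  exact_mod_cast Finset.card_le_card fun j hj => by simpa using hs j hj

/-- The partial fraction expansion of `(log G)''` for an entire function `G` of exponential type.
The zeros in a disc of radius `R` are divided out; the logarithm of the cofactor is `O(R)` there,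
so that its second derivative at a given point is `O(1 / R)`. -/
theorem hasSum_deriv_logDeriv (h : EnumeratesZeros G lam) (hG : Differentiable ℂ G) (h0 : G 0 ≠ 0)
    {A B : ℝ} (hbd : ∀ z, ‖G z‖ ≤ A * Real.exp (B * ‖z‖)) (hB : 0 ≤ B) {z : ℂ} (hz : G z ≠ 0) :
    HasSum (fun j => 1 / (z - lam j) ^ 2) (-deriv (logDeriv G) z) := by
  have hsum : Summable fun j => 1 / (z - lam j) ^ 2 := by
    have h2 := (h.summable_norm_rpow hG h0 hbd (σ := 2) (by norm_num)).mul_left 4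
    refine Summable.of_norm_bounded_eventually h2 ?_
    rw [Filter.eventually_cofinite]
    refine (h.finite_norm_le hG h0 (2 * ‖z‖)).subset fun j hj => ?_
    by_contra hj'
    simp only [mem_ofPred_eq, not_le] at hj'
    apply hj
    have h3 : 0 < ‖lam j‖ := norm_pos_iff.2 (h.ne_zero hG h0 j)
    have h4 : ‖lam j‖ / 2 ≤ ‖z - lam j‖ := by
      have := norm_sub_norm_le (lam j) z
      rw [norm_sub_rev] at this
      linarith
    have h5 : 0 < ‖z - lam j‖ := by linarith
    rw [norm_div, norm_one, norm_pow, Real.rpow_neg h3.le, Real.rpow_two, ← div_eq_mul_inv,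
      div_le_div_iff₀ (by positivity) (by positivity)]
    nlinarith
  have hfin := fun R => h.finite_norm_le hG h0 R
  set s : ℕ → Finset J := fun n => (hfin n).toFinset with hs
  have hst : Tendsto s atTop atTop := by
    refine tendsto_atTop_finset_of_monotone (fun m n hmn j hj => ?_) fun j => ?_
    · simp only [hs, Finite.mem_toFinset, mem_ofPred_eq] at hj ⊢
      exact hj.trans (by exact_mod_cast hmn)
    · obtain ⟨n, hn⟩ := exists_nat_ge ‖lam j‖
      exact ⟨n, by simpa [hs] using hn⟩
  have ht1 : Tendsto (fun n => ∑ j ∈ s n, 1 / (z - lam j) ^ 2) atTop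
      (𝓝 (∑' j, 1 / (z - lam j) ^ 2)) := hsum.hasSum.comp hst
  suffices ht2 : Tendsto (fun n => ∑ j ∈ s n, 1 / (z - lam j) ^ 2) atTop
      (𝓝 (-deriv (logDeriv G) z)) by
    rw [← tendsto_nhds_unique ht1 ht2]
    exact hsum.hasSum
  have hG0 : 0 < ‖G 0‖ := norm_pos_iff.2 h0
  have hA : 0 < A := by simpa using hG0.trans_le (hbd 0)
  set c : ℝ := |Real.log (A / ‖G 0‖)| + 1 with hc
  have hbound : ∀ᶠ n : ℕ in atTop,
      ‖∑ j ∈ s n, 1 / (z - lam j) ^ 2 - (-deriv (logDeriv G) z)‖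
        ≤ 64 * (c * (1 / (n : ℝ)) ^ 2 + 4 * B * (1 / (n : ℝ))) := by
    filter_upwards [eventually_ge_atTop (⌈4 * ‖z‖⌉₊ + 1)] with n hn
    have hn' : 4 * ‖z‖ + 1 ≤ n := by
      refine le_trans ?_ (Nat.cast_le.2 hn)
      push_cast
      have := Nat.le_ceil (4 * ‖z‖)
      linarith
    have hn0 : (0 : ℝ) < n := by have := norm_nonneg z; linarith
    obtain ⟨g, hg, hGg, hgne⟩ := h.exists_eq_prod_mul hG h0 (R := n) (s := s n) (by simp [hs])
    have hg0 : g 0 = G 0 := by simpa using (hGg 0).symm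
    rw [deriv_logDeriv_prod_mul (h.ne_zero hG h0) hg hGg hz]
    have hb := norm_deriv_logDeriv_le hg hn0 (M := c + 4 * B * n) (by positivity) hgne
      (fun w hw => ?_) (z := z) (by linarith)
    · refine le_trans (le_of_eq ?_) (hb.trans (le_of_eq ?_))
      · congr 1; ring
      · field_simp
    · have h1 := norm_cofactor_le hbd hn0 (s := s n)
        (fun j hj => ⟨by simpa [hs] using hj, h.ne_zero hG h0 j⟩) hg hGg (z := w) (by linarith)
      have h2 : ‖g w‖ ≤ A * Real.exp (4 * B * n) := by
        refine le_trans ?_ h1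
        exact le_mul_of_one_le_left (norm_nonneg _) (one_le_pow₀ (by norm_num))
      refine h2.trans ?_
      rw [hg0, Real.exp_add, ← mul_assoc]
      refine mul_le_mul_of_nonneg_right ?_ (Real.exp_pos _).le
      rw [← div_le_iff₀' hG0, ← Real.log_le_iff_le_exp (by positivity)]
      have := le_abs_self (Real.log (A / ‖G 0‖))
      linarith
  have hz0 : Tendsto (fun n : ℕ => 64 * (c * (1 / (n : ℝ)) ^ 2 + 4 * B * (1 / (n : ℝ)))) atTop
      (𝓝 0) := by
    have h1 := tendsto_one_div_atTop_nhds_zero_nat (𝕜 := ℝ)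
    simpa using (((h1.pow 2).const_mul c).add (h1.const_mul (4 * B))).const_mul 64
  rw [tendsto_iff_norm_sub_tendsto_zero]
  exact squeeze_zero' (Eventually.of_forall fun n => norm_nonneg _) hbound hz0

end EnumeratesZeros

/-! ### The Mellin transform of `1 / (t + μ)²` -/

/-- Off a sector around the negative half-line, `|t + μ|` is comparable to `t + |μ|`, uniformly
in `μ`. -/
theorem norm_ofReal_add_sq_ge {mu : ℂ} {k t : ℝ} (hk0 : 0 ≤ k) (hk1 : k < 1) (ht : 0 ≤ t)
    (hmu : -mu.re ≤ k * ‖mu‖) : (1 - k) / 2 * (t + ‖mu‖) ^ 2 ≤ ‖(t : ℂ) + mu‖ ^ 2 := by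
  have h1 : ‖(t : ℂ) + mu‖ ^ 2 = t ^ 2 + 2 * t * mu.re + ‖mu‖ ^ 2 := by
    rw [Complex.sq_norm, Complex.sq_norm, Complex.normSq_apply, Complex.normSq_apply]
    simp
    ring
  rw [h1]
  have h2 : 0 ≤ t * (k * ‖mu‖ + mu.re) := mul_nonneg ht (by linarith)
  have h3 : 0 ≤ (t - ‖mu‖) ^ 2 := sq_nonneg _
  have h4 := mul_nonneg (sub_nonneg.2 hk1.le) h3
  have h5 := mul_nonneg hk0 h3
  nlinarith

theorem integrableOn_rpow_div_add_sq {σ r : ℝ} (h0 : 0 < σ) (h2 : σ < 2) (hr : 0 < r) :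
    IntegrableOn (fun t : ℝ => t ^ (σ - 1) * (1 / (t + r) ^ 2)) (Ioi 0) := by
  have hc : ContinuousOn (fun t : ℝ => 1 / (t + r) ^ 2) (Ici 0) := by
    refine continuousOn_const.div (by fun_prop) fun t ht => ?_
    have : (0 : ℝ) ≤ t := ht
    positivity
  refine mellin_convergent_of_isBigO_scalar (a := 2) (b := 0) ?_ ?_ h2 ?_ h0
  · exact (hc.mono Ioi_subset_Ici_self).locallyIntegrableOn measurableSet_Ioi
  · refine Asymptotics.IsBigO.of_bound 1 ?_
    filter_upwards [eventually_gt_atTop 0] with t ht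
    rw [Real.rpow_neg ht.le, Real.rpow_two, one_mul, ← one_div, Real.norm_of_nonneg (by positivity),
      Real.norm_of_nonneg (by positivity)]
    gcongr
    linarith
  · simp only [neg_zero, Real.rpow_zero]
    refine Asymptotics.IsBigO.of_bound (1 / r ^ 2) ?_
    filter_upwards [self_mem_nhdsWithin] with t ht
    have ht' : (0 : ℝ) < t := ht
    rw [Real.norm_of_nonneg (by positivity), norm_one, mul_one]
    gcongr
    linarith

/-- The kernel `1 / (t + mu) ^ 2` has the Mellin transform `Γ(w) Γ(2 - w)` for `mu = 1`. -/
theorem mellin_one_div_add_one_sq {w : ℂ} (h0 : 0 < w.re) (h2 : w.re < 2) :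
    mellin (fun t : ℝ => 1 / ((t : ℂ) + 1) ^ 2) w = Complex.Gamma w * Complex.Gamma (2 - w) := by
  have hG : Complex.Gamma w * Complex.Gamma (2 - w) = Complex.betaIntegral w (2 - w) := by
    rw [Complex.Gamma_mul_Gamma_eq_betaIntegral h0 (by simpa using h2)]
    simp
  have himg : (fun x : ℝ => x / (1 - x)) '' Ioo 0 1 = Ioi 0 := by
    ext t
    constructor
    · rintro ⟨x, hx, rfl⟩
      exact div_pos hx.1 (by linarith [hx.2])
    · intro ht
      have ht' : (0 : ℝ) < t := ht
      refine ⟨t / (1 + t), ⟨by positivity, by rw [div_lt_one (by positivity)]; linarith⟩, ?_⟩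
      field_simp
      ring
  have hder : ∀ x ∈ Ioo (0 : ℝ) 1,
      HasDerivWithinAt (fun x : ℝ => x / (1 - x)) (1 / (1 - x) ^ 2) (Ioo 0 1) x := by
    intro x hx
    have hx1 : (1 - x) ≠ 0 := by linarith [hx.2]
    have := (hasDerivAt_id x).div ((hasDerivAt_id x).const_sub 1) hx1
    refine (this.congr_deriv ?_).hasDerivWithinAt
    simp
  have hinj : InjOn (fun x : ℝ => x / (1 - x)) (Ioo 0 1) := by
    intro x hx y hy hxy
    have hx1 : (1 - x) ≠ 0 := by linarith [hx.2]
    have hy1 : (1 - y) ≠ 0 := by linarith [hy.2]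
    simp only [div_eq_div_iff hx1 hy1] at hxy
    linarith
  rw [hG, mellin, ← himg, integral_image_eq_integral_abs_deriv_smul measurableSet_Ioo hder hinj,
    Complex.betaIntegral, intervalIntegral.integral_of_le zero_le_one, integral_Ioc_eq_integral_Ioo]
  refine setIntegral_congr_fun measurableSet_Ioo fun x hx => ?_
  have hx0 : 0 < x := hx.1
  have hx1 : 0 < 1 - x := by linarith [hx.2]
  have hne : ((1 - x : ℝ) : ℂ) ≠ 0 := by exact_mod_cast hx1.ne'
  have hcast : (1 - (x : ℂ)) = ((1 - x : ℝ) : ℂ) := by push_cast; rfl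
  have e1 : ((x / (1 - x) : ℝ) : ℂ) ^ (w - 1) = (x : ℂ) ^ (w - 1) * ((1 - x : ℝ) : ℂ) ^ (1 - w) := by
    rw [div_eq_mul_inv, Complex.ofReal_mul, Complex.mul_cpow_ofReal_nonneg hx0.le (by positivity),
      Complex.ofReal_inv, Complex.inv_cpow _ _ (by
        rw [Complex.arg_ofReal_of_nonneg hx1.le]; exact Real.pi_pos.ne), ← Complex.cpow_neg, neg_sub]
  have e2 : ((x / (1 - x) : ℝ) : ℂ) + 1 = 1 / ((1 - x : ℝ) : ℂ) := by
    push_cast at hne ⊢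
    field_simp
    ring
  simp only [smul_eq_mul, Complex.real_smul]
  rw [abs_of_pos (by positivity), e1, e2, hcast, show 2 - w - 1 = 1 - w by ring]
  push_cast at hne ⊢
  field_simp

theorem mellin_one_div_add_ofReal_sq {w : ℂ} (h0 : 0 < w.re) (h2 : w.re < 2) {r : ℝ} (hr : 0 < r) :
    mellin (fun t : ℝ => 1 / ((t : ℂ) + r) ^ 2) w =
      Complex.Gamma w * Complex.Gamma (2 - w) * (r : ℂ) ^ (w - 2) := by
  have hr' : (r : ℂ) ≠ 0 := by exact_mod_cast hr.ne'
  have e : (fun t : ℝ => 1 / ((t : ℂ) + r) ^ 2) =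
      fun t : ℝ => ((r : ℂ) ^ (-2 : ℂ)) •
        (fun t : ℝ => 1 / ((t : ℂ) + 1) ^ 2) (r⁻¹ * t) := by
    funext t
    rw [Complex.cpow_neg, Complex.cpow_ofNat, smul_eq_mul]
    push_cast
    rw [one_div, one_div, ← mul_inv, ← mul_pow]
    congr 2
    field_simp
  rw [e, mellin_const_smul,
    mellin_comp_mul_left (fun t : ℝ => 1 / ((t : ℂ) + 1) ^ 2) _ (inv_pos.2 hr),
    mellin_one_div_add_one_sq h0 h2,
    smul_eq_mul, smul_eq_mul, Complex.ofReal_inv, Complex.inv_cpow _ _ (by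
        rw [Complex.arg_ofReal_of_nonneg hr.le]; exact Real.pi_pos.ne), Complex.cpow_neg _ w, inv_inv,
    sub_eq_add_neg w 2, Complex.cpow_add _ _ hr']
  ring

theorem slitPlane_neg_re_le {mu : ℂ} (hmu : mu ∈ Complex.slitPlane) :
    ∃ k : ℝ, 0 ≤ k ∧ k < 1 ∧ -mu.re ≤ k * ‖mu‖ := by
  have h0 : 0 < ‖mu‖ := norm_pos_iff.2 (Complex.slitPlane_ne_zero hmu)
  have h1 : -mu.re < ‖mu‖ := by
    rcases (neg_le_abs mu.re).trans (Complex.abs_re_le_norm mu) |>.lt_or_eq with h | h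
    · exact h
    · exfalso
      have h2 : ‖mu‖ ^ 2 = mu.re * mu.re + mu.im * mu.im := by
        rw [Complex.sq_norm, Complex.normSq_apply]
      have h3 : mu.im = 0 := by
        rw [← h] at h2
        have : mu.im * mu.im = 0 := by linarith
        simpa using this
      rcases hmu with h4 | h4
      · linarith
      · exact h4 h3
  refine ⟨max 0 (-mu.re / ‖mu‖), le_max_left _ _, max_lt one_pos ((div_lt_one h0).2 h1), ?_⟩
  rw [← div_le_iff₀ h0]
  exact le_max_right _ _

theorem norm_cpow_smul_one_div_sq_le {w mu : ℂ} {k t : ℝ} (hk0 : 0 ≤ k) (hk1 : k < 1) (ht : 0 < t)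
    (hmu0 : mu ≠ 0) (hmu : -mu.re ≤ k * ‖mu‖) :
    ‖(t : ℂ) ^ (w - 1) • (1 / ((t : ℂ) + mu) ^ 2)‖ ≤
      2 / (1 - k) * (t ^ (w.re - 1) * (1 / (t + ‖mu‖) ^ 2)) := by
  have h1 := norm_ofReal_add_sq_ge hk0 hk1 ht.le hmu
  have h2 : 0 < ‖mu‖ := norm_pos_iff.2 hmu0
  have h3 : 0 < 1 - k := by linarith
  rw [norm_smul, Complex.norm_cpow_eq_rpow_re_of_pos ht, norm_div, norm_one, norm_pow]
  simp only [Complex.sub_re, Complex.one_re]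
  rw [mul_left_comm]
  refine mul_le_mul_of_nonneg_left ?_ (by positivity)
  calc 1 / ‖(t : ℂ) + mu‖ ^ 2 ≤ 1 / ((1 - k) / 2 * (t + ‖mu‖) ^ 2) :=
        one_div_le_one_div_of_le (by positivity) h1
    _ = _ := by field_simp

theorem ofReal_add_ne_zero_of_slitPlane {mu : ℂ} (hmu : mu ∈ Complex.slitPlane) {t : ℝ}
    (ht : 0 ≤ t) : (t : ℂ) + mu ≠ 0 := by
  obtain ⟨k, hk0, hk1, hk⟩ := slitPlane_neg_re_le hmu
  intro h
  have h1 := norm_ofReal_add_sq_ge hk0 hk1 ht hk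
  rw [h, norm_zero] at h1
  have h2 : 0 < ‖mu‖ := norm_pos_iff.2 (Complex.slitPlane_ne_zero hmu)
  have h3 : 0 < 1 - k := by linarith
  have : 0 < (1 - k) / 2 * (t + ‖mu‖) ^ 2 := by positivity
  simp at h1
  linarith

theorem continuousOn_cpow_smul_one_div {w mu : ℂ} (hmu : mu ∈ Complex.slitPlane) (n : ℕ) :
    ContinuousOn (fun t : ℝ => (t : ℂ) ^ (w - 1) • (1 / ((t : ℂ) + mu) ^ n)) (Ioi 0) := by
  refine ContinuousOn.mul (fun t ht => ?_) ?_
  · have ht' : (0 : ℝ) < t := ht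
    exact (Complex.continuousAt_ofReal_cpow_const t _ (Or.inr ht'.ne')).continuousWithinAt
  · refine continuousOn_const.div (by fun_prop) fun t ht => ?_
    exact pow_ne_zero _ (ofReal_add_ne_zero_of_slitPlane hmu (le_of_lt ht))

theorem mellinConvergent_one_div_add_sq {w mu : ℂ} (h0 : 0 < w.re) (h2 : w.re < 2)
    (hmu : mu ∈ Complex.slitPlane) :
    MellinConvergent (fun t : ℝ => 1 / ((t : ℂ) + mu) ^ 2) w := by
  obtain ⟨k, hk0, hk1, hk⟩ := slitPlane_neg_re_le hmu
  have hne := Complex.slitPlane_ne_zero hmu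
  refine Integrable.mono' ((integrableOn_rpow_div_add_sq h0 h2 (norm_pos_iff.2 hne)).const_mul
    (2 / (1 - k))) ((continuousOn_cpow_smul_one_div hmu 2).aestronglyMeasurable measurableSet_Ioi) ?_
  filter_upwards [self_mem_ae_restrict measurableSet_Ioi] with t ht
  exact norm_cpow_smul_one_div_sq_le hk0 hk1 ht hne hk

theorem differentiableOn_mellin_one_div_add_sq {w : ℂ} (h0 : 0 < w.re) (h2 : w.re < 2) :
    DifferentiableOn ℂ (fun mu => mellin (fun t : ℝ => 1 / ((t : ℂ) + mu) ^ 2) w)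
      Complex.slitPlane := by
  intro mu hmu
  obtain ⟨k, hk0, hk1, hk⟩ := slitPlane_neg_re_le hmu
  have hne : 0 < ‖mu‖ := norm_pos_iff.2 (Complex.slitPlane_ne_zero hmu)
  have hk' : 0 < 1 - k := by linarith
  set c : ℝ := Real.sqrt ((1 - k) / 2) with hc
  have hc0 : 0 < c := Real.sqrt_pos.2 (by positivity)
  obtain ⟨e, he, hball⟩ := Metric.isOpen_iff.1 Complex.isOpen_slitPlane mu hmu
  set d := min e (c * ‖mu‖ / 2) with hd
  have hd0 : 0 < d := lt_min he (by positivity)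
  have hlow : ∀ t : ℝ, 0 < t → ∀ x ∈ Metric.ball mu d, c / 2 * (t + ‖mu‖) ≤ ‖(t : ℂ) + x‖ := by
    intro t ht x hx
    have h3 : c * (t + ‖mu‖) ≤ ‖(t : ℂ) + mu‖ := by
      refine (pow_le_pow_iff_left₀ (by positivity) (norm_nonneg _) two_ne_zero).1 ?_
      rw [mul_pow, hc, Real.sq_sqrt (by positivity)]
      exact norm_ofReal_add_sq_ge hk0 hk1 ht.le hk
    have h4 : ‖x - mu‖ ≤ c * ‖mu‖ / 2 := (mem_ball_iff_norm.1 hx).le.trans (min_le_right _ _)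
    have h5 := norm_sub_norm_le ((t : ℂ) + mu) ((t : ℂ) + x)
    rw [add_sub_add_left_eq_sub, norm_sub_rev] at h5
    nlinarith [mul_pos hc0 ht]
  have hslit : ∀ x ∈ Metric.ball mu d, x ∈ Complex.slitPlane := fun x hx =>
    hball (Metric.ball_subset_ball (min_le_left _ _) hx)
  have key := hasDerivAt_integral_of_dominated_loc_of_deriv_le
    (μ := volume.restrict (Ioi (0 : ℝ)))
    (F := fun (x : ℂ) (t : ℝ) => (t : ℂ) ^ (w - 1) • (1 / ((t : ℂ) + x) ^ 2))
    (F' := fun (x : ℂ) (t : ℝ) => (t : ℂ) ^ (w - 1) • (-2 / ((t : ℂ) + x) ^ 3))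
    (x₀ := mu) (s := Metric.ball mu d)
    (bound := fun t => 2 * (2 / c) ^ 3 / ‖mu‖ * (t ^ (w.re - 1) * (1 / (t + ‖mu‖) ^ 2)))
    (Metric.ball_mem_nhds mu hd0) ?_ ?_ ?_ ?_ ?_ ?_
  · exact key.2.differentiableAt.differentiableWithinAt
  · filter_upwards [Metric.ball_mem_nhds mu hd0] with x hx
    exact (continuousOn_cpow_smul_one_div (hslit x hx) 2).aestronglyMeasurable measurableSet_Ioi
  · exact mellinConvergent_one_div_add_sq h0 h2 hmu
  · have := ((continuousOn_cpow_smul_one_div (w := w) hmu 3).const_smul (-2 : ℂ)).aestronglyMeasurable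
      (μ := volume) measurableSet_Ioi
    refine this.congr (Eventually.of_forall fun t => ?_)
    simp only [smul_eq_mul, Pi.smul_apply]
    ring
  · filter_upwards [self_mem_ae_restrict measurableSet_Ioi] with t ht x hx
    have ht' : (0 : ℝ) < t := ht
    have h3 := hlow t ht x hx
    rw [norm_smul, Complex.norm_cpow_eq_rpow_re_of_pos ht, norm_div, norm_pow, norm_neg,
      Complex.norm_ofNat]
    simp only [Complex.sub_re, Complex.one_re]
    rw [mul_left_comm]
    refine mul_le_mul_of_nonneg_left ?_ (by positivity)
    calc 2 / ‖(t : ℂ) + x‖ ^ 3 ≤ 2 / (c / 2 * (t + ‖mu‖)) ^ 3 := by gcongr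
      _ = 2 * (2 / c) ^ 3 / (t + ‖mu‖) * (1 / (t + ‖mu‖) ^ 2) := by field_simp
      _ ≤ 2 * (2 / c) ^ 3 / ‖mu‖ * (1 / (t + ‖mu‖) ^ 2) := by gcongr; linarith
  · exact (integrableOn_rpow_div_add_sq h0 h2 hne).const_mul _
  · filter_upwards [self_mem_ae_restrict measurableSet_Ioi] with t ht x hx
    have h3 := ofReal_add_ne_zero_of_slitPlane (hslit x hx) (le_of_lt ht)
    have h4 := ((((hasDerivAt_id x).const_add (t : ℂ)).fun_pow 2).inv (pow_ne_zero 2 h3)).const_smul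
      ((t : ℂ) ^ (w - 1))
    simp only [id, one_div, smul_eq_mul] at h4 ⊢
    refine h4.congr_deriv ?_
    field_simp
    simp
    ring

/-- The Mellin transform of `1 / (t + mu) ^ 2`, by analytic continuation in `mu` from the positive
half-line to the slit plane. -/
theorem mellin_one_div_add_sq {w : ℂ} (h0 : 0 < w.re) (h2 : w.re < 2) {mu : ℂ}
    (hmu : mu ∈ Complex.slitPlane) :
    mellin (fun t : ℝ => 1 / ((t : ℂ) + mu) ^ 2) w =
      Complex.Gamma w * Complex.Gamma (2 - w) * mu ^ (w - 2) := by
  have h1 : AnalyticOnNhd ℂ (fun mu => mellin (fun t : ℝ => 1 / ((t : ℂ) + mu) ^ 2) w)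
      Complex.slitPlane :=
    (differentiableOn_mellin_one_div_add_sq h0 h2).analyticOnNhd Complex.isOpen_slitPlane
  have h3 : AnalyticOnNhd ℂ (fun mu => Complex.Gamma w * Complex.Gamma (2 - w) * mu ^ (w - 2))
      Complex.slitPlane := by
    refine DifferentiableOn.analyticOnNhd (fun z hz => ?_) Complex.isOpen_slitPlane
    exact ((differentiableAt_id.cpow (differentiableAt_const _) hz).const_mul _).differentiableWithinAt
  have hpre : IsPreconnected Complex.slitPlane :=
    (Complex.starConvex_one_slitPlane.isPathConnected
      Complex.one_mem_slitPlane).isConnected.isPreconnected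
  refine h1.eqOn_of_preconnected_of_frequently_eq h3 hpre Complex.one_mem_slitPlane ?_ hmu
  have ht : Tendsto (fun n : ℕ => ((1 + 1 / ((n : ℝ) + 1) : ℝ) : ℂ)) atTop (𝓝[≠] 1) := by
    refine tendsto_nhdsWithin_iff.2 ⟨?_, Eventually.of_forall fun n => ?_⟩
    · have := (tendsto_one_div_add_atTop_nhds_zero_nat (𝕜 := ℝ)).const_add 1
      rw [add_zero] at this
      exact_mod_cast (Complex.continuous_ofReal.tendsto 1).comp this
    · have : (0 : ℝ) < 1 / ((n : ℝ) + 1) := by positivity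
      simp only [mem_compl_iff, mem_singleton_iff]
      rw [← Complex.ofReal_one, Complex.ofReal_inj]
      linarith
  refine ht.frequently (Eventually.frequently (Eventually.of_forall fun n => ?_))
  exact mellin_one_div_add_ofReal_sq h0 h2 (by positivity)

/-- Termwise Mellin transform. The sum and the integral may be exchanged, as the `mu j` stay away from
a sector around the negative half-line. -/
theorem hasSum_mellin_tsum {J : Type*} [Countable J] {mu : J → ℂ} {k : ℝ} (hk0 : 0 ≤ k)
    (hk1 : k < 1) (hmu0 : ∀ j, mu j ≠ 0) (hmu : ∀ j, -(mu j).re ≤ k * ‖mu j‖)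
    {w : ℂ} (h0 : 0 < w.re) (h2 : w.re < 2) (hs : Summable fun j => ‖mu j‖ ^ (w.re - 2)) :
    HasSum (fun j => Complex.Gamma w * Complex.Gamma (2 - w) * mu j ^ (w - 2))
      (mellin (fun t : ℝ => ∑' j, 1 / ((t : ℂ) + mu j) ^ 2) w) := by
  have hslit : ∀ j, mu j ∈ Complex.slitPlane := by
    intro j
    rw [Complex.mem_slitPlane_iff_not_le_zero]
    intro hle
    have h3 : (mu j).re ≤ 0 := (Complex.le_def.1 hle).1
    have h4 : (mu j).im = 0 := (Complex.le_def.1 hle).2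
    have h5 : ‖mu j‖ = -(mu j).re := by
      conv_lhs => rw [← Complex.re_add_im (mu j), h4]
      simp [abs_of_nonpos h3]
    have h6 := hmu j
    have h7 : 0 < ‖mu j‖ := norm_pos_iff.2 (hmu0 j)
    rw [← h5] at h6
    nlinarith
  have hreal : ∀ j, ∫ t in Ioi (0 : ℝ), t ^ (w.re - 1) * (1 / (t + ‖mu j‖) ^ 2) ≤
      ‖Complex.Gamma w.re * Complex.Gamma (2 - w.re)‖ * ‖mu j‖ ^ (w.re - 2) := by
    intro j
    have hpos : 0 < ‖mu j‖ := norm_pos_iff.2 (hmu0 j)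
    have h3 := mellin_one_div_add_ofReal_sq (w := w.re) (by simpa using h0) (by simpa using h2) hpos
    have h4 : mellin (fun t : ℝ => 1 / ((t : ℂ) + (‖mu j‖ : ℝ)) ^ 2) w.re =
        ((∫ t in Ioi (0 : ℝ), t ^ (w.re - 1) * (1 / (t + ‖mu j‖) ^ 2) : ℝ) : ℂ) := by
      rw [mellin, ← integral_complex_ofReal]
      refine setIntegral_congr_fun measurableSet_Ioi fun t ht => ?_
      have ht' : (0 : ℝ) < t := ht
      simp only [smul_eq_mul]
      push_cast
      rw [Complex.ofReal_cpow ht'.le]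
      push_cast
      rfl
    rw [h4] at h3
    refine (le_abs_self _).trans (le_of_eq ?_)
    rw [← Real.norm_eq_abs, ← Complex.norm_real, h3, norm_mul]
    congr 1
    rw [Complex.norm_cpow_eq_rpow_re_of_pos hpos]
    simp
  have key := hasSum_integral_of_summable_integral_norm (μ := volume.restrict (Ioi (0 : ℝ)))
    (F := fun j (t : ℝ) => (t : ℂ) ^ (w - 1) • (1 / ((t : ℂ) + mu j) ^ 2))
    (fun j => mellinConvergent_one_div_add_sq h0 h2 (hslit j)) ?_
  · simp only [tsum_const_smul''] at key
    simpa only [← mellin_one_div_add_sq h0 h2 (hslit _)] using! key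
  · refine Summable.of_nonneg_of_le (fun j => integral_nonneg fun t => norm_nonneg _) (fun j => ?_)
      (hs.mul_left (2 / (1 - k) * ‖Complex.Gamma w.re * Complex.Gamma (2 - w.re)‖))
    calc ∫ t in Ioi (0 : ℝ), ‖(t : ℂ) ^ (w - 1) • (1 / ((t : ℂ) + mu j) ^ 2)‖
        ≤ ∫ t in Ioi (0 : ℝ), 2 / (1 - k) * (t ^ (w.re - 1) * (1 / (t + ‖mu j‖) ^ 2)) := by
          refine setIntegral_mono_on (mellinConvergent_one_div_add_sq h0 h2 (hslit j)).norm
            ((integrableOn_rpow_div_add_sq h0 h2 (norm_pos_iff.2 (hmu0 j))).const_mul _)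
            measurableSet_Ioi fun t ht => ?_
          exact norm_cpow_smul_one_div_sq_le hk0 hk1 ht (hmu0 j) (hmu j)
      _ ≤ _ := by
          rw [integral_const_mul, mul_assoc]
          refine mul_le_mul_of_nonneg_left (hreal j) ?_
          have : 0 < 1 - k := by linarith
          positivity

/-! ### Entire functions with exponential asymptotics along a ray -/

/-- The entire function `G` has no zeros on the ray `u [0, ∞)`, and along this ray
`z G(z) = e^{κ z} E(z)`, where `E` tends to `K ≠ 0` and the first two derivatives of `E` decay
exponentially. -/
structure RayAsymptotics (G E : ℂ → ℂ) (u κ K : ℂ) (δ : ℝ) : Prop where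
  differentiable : Differentiable ℂ G
  differentiable_factor : Differentiable ℂ E
  norm_dir : ‖u‖ = 1
  ne_zero : ∀ t : ℝ, 0 ≤ t → G (t * u) ≠ 0
  mul_eq : ∀ z, z * G z = Complex.exp (κ * z) * E z
  tendsto : Tendsto (fun t : ℝ => E (t * u)) atTop (𝓝 K)
  limit_ne_zero : K ≠ 0
  decay_pos : 0 < δ
  deriv_isBigO : (fun t : ℝ => deriv E (t * u)) =O[atTop] fun t => Real.exp (-δ * t)
  deriv_deriv_isBigO :
    (fun t : ℝ => deriv (deriv E) (t * u)) =O[atTop] fun t => Real.exp (-δ * t)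

/-- The function `t ↦ -(d/dt)² log G(t u)` on the ray, with its leading term `-1 / t ^ 2` at infinity
removed for `t > 1`. -/
noncomputable def rayRemainder (G : ℂ → ℂ) (u : ℂ) (t : ℝ) : ℂ :=
  -u ^ 2 * deriv (logDeriv G) (t * u) + (Ioi (1 : ℝ)).indicator (fun t => 1 / (t : ℂ) ^ 2) t

theorem HasDerivAt.comp_ofReal_mul_const {f : ℂ → ℂ} {f' u : ℂ} {t : ℝ}
    (h : HasDerivAt f f' (t * u)) : HasDerivAt (fun t : ℝ => f (t * u)) (u * f') t := by
  have h1 : HasDerivAt (fun z : ℂ => z * u) u (t : ℂ) := by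
    simpa using (hasDerivAt_id (t : ℂ)).mul_const u
  have h2 : HasDerivAt (fun z : ℂ => f (z * u)) (f' * u) (t : ℂ) :=
    HasDerivAt.comp (t : ℂ) (h₂ := f) h h1
  exact (mul_comm f' u) ▸ h2.comp_ofReal

namespace RayAsymptotics

variable {G E : ℂ → ℂ} {u κ K : ℂ} {δ : ℝ}

theorem dir_ne_zero (h : RayAsymptotics G E u κ K δ) : u ≠ 0 := by
  intro hu
  have := h.norm_dir
  simp [hu] at this

theorem apply_zero_ne_zero (h : RayAsymptotics G E u κ K δ) : G 0 ≠ 0 := by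
  simpa using h.ne_zero 0 le_rfl

theorem analyticAt_logDeriv (h : RayAsymptotics G E u κ K δ) {t : ℝ} (ht : 0 ≤ t) :
    AnalyticAt ℂ (logDeriv G) (t * u) := by
  have h1 : AnalyticAt ℂ G (t * u) := h.differentiable.analyticAt _
  exact h1.deriv.div h1 (h.ne_zero t ht)

theorem factor_ne_zero (h : RayAsymptotics G E u κ K δ) {t : ℝ} (ht : 0 < t) :
    E (t * u) ≠ 0 := by
  have h1 := h.mul_eq (t * u)
  intro h2
  rw [h2, mul_zero] at h1
  have h3 : (t : ℂ) * u ≠ 0 := mul_ne_zero (by exact_mod_cast ht.ne') h.dir_ne_zero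
  exact (mul_ne_zero h3 (h.ne_zero t ht.le)) h1

theorem logDeriv_eq (h : RayAsymptotics G E u κ K δ) {z : ℂ} (hz : z ≠ 0) (hE : E z ≠ 0) :
    logDeriv G z = κ + logDeriv E z - 1 / z := by
  have hev : G =ᶠ[𝓝 z] fun z => Complex.exp (κ * z) * E z / z := by
    filter_upwards [isOpen_ne.mem_nhds hz] with w hw
    rw [← h.mul_eq w]
    exact (mul_div_cancel_left₀ _ hw).symm
  have hd := h.differentiable_factor
  have h1 : HasDerivAt (fun z => Complex.exp (κ * z)) (Complex.exp (κ * z) * κ) z := by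
    simpa using ((hasDerivAt_id z).const_mul κ).cexp
  have h2 : logDeriv (fun z => Complex.exp (κ * z)) z = κ := by
    rw [logDeriv_apply, h1.deriv]
    field_simp
  rw [logDeriv_congr_nhds hev |>.eq_of_nhds, logDeriv_div (f := fun z => Complex.exp (κ * z) * E z)
    (g := fun z => z) z (mul_ne_zero (Complex.exp_ne_zero _) hE) hz (by fun_prop) (by fun_prop),
    logDeriv_mul (f := fun z => Complex.exp (κ * z)) (g := E) z (Complex.exp_ne_zero _) hE
      (by fun_prop) (hd z), h2, logDeriv_id']

theorem deriv_logDeriv_eq (h : RayAsymptotics G E u κ K δ) {z : ℂ} (hz : z ≠ 0) (hE : E z ≠ 0) :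
    deriv (logDeriv G) z =
      (deriv (deriv E) z * E z - deriv E z ^ 2) / E z ^ 2 + 1 / z ^ 2 := by
  have hd := h.differentiable_factor
  have hev : logDeriv G =ᶠ[𝓝 z] fun z => κ + deriv E z / E z - 1 / z := by
    filter_upwards [isOpen_ne.mem_nhds hz, hd.continuous.continuousAt.eventually_ne hE]
      with w hw hEw
    exact h.logDeriv_eq hw hEw
  have hd2 : DifferentiableAt ℂ (deriv E) z := (hd.analyticAt z).deriv.differentiableAt
  have h1 := ((hd2.hasDerivAt.div (hd z).hasDerivAt hE).const_add κ).sub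
    ((hasDerivAt_id z).inv hz)
  rw [hev.deriv_eq]
  simp only [id, ← one_div] at h1
  refine (HasDerivAt.deriv (h1.congr_deriv ?_))
  ring

theorem rayRemainder_eq (h : RayAsymptotics G E u κ K δ) {t : ℝ} (ht : 1 < t) :
    rayRemainder G u t = -u ^ 2 *
      ((deriv (deriv E) (t * u) * E (t * u) - deriv E (t * u) ^ 2) / E (t * u) ^ 2) := by
  have ht0 : (0 : ℝ) < t := by linarith
  have ht' : (t : ℂ) ≠ 0 := by exact_mod_cast ht0.ne'
  have hu := h.dir_ne_zero
  rw [rayRemainder, indicator_of_mem (show t ∈ Ioi (1 : ℝ) from ht),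
    h.deriv_logDeriv_eq (mul_ne_zero ht' hu) (h.factor_ne_zero ht0)]
  field_simp
  ring

theorem rayRemainder_isBigO (h : RayAsymptotics G E u κ K δ) :
    rayRemainder G u =O[atTop] fun t => Real.exp (-δ * t) := by
  have hE1 : (fun t : ℝ => E (t * u)) =O[atTop] fun _ => (1 : ℝ) := h.tendsto.isBigO_one ℝ
  have hone : (fun t : ℝ => Real.exp (-δ * t)) =O[atTop] fun _ => (1 : ℝ) := by
    refine Asymptotics.IsBigO.of_bound 1 ?_
    filter_upwards [eventually_ge_atTop 0] with t ht
    rw [norm_one, mul_one, Real.norm_eq_abs, Real.abs_exp, Real.exp_le_one_iff]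
    nlinarith [h.decay_pos]
  have hinv : (fun t : ℝ => (E (t * u) ^ 2)⁻¹) =O[atTop] fun _ => (1 : ℝ) :=
    ((h.tendsto.pow 2).inv₀ (pow_ne_zero 2 h.limit_ne_zero)).isBigO_one ℝ
  have h2 : (fun t : ℝ => -u ^ 2 * ((deriv (deriv E) (t * u) * E (t * u) - deriv E (t * u) ^ 2) *
      (E (t * u) ^ 2)⁻¹)) =O[atTop] fun t => Real.exp (-δ * t) := by
    refine Asymptotics.IsBigO.const_mul_left ?_ _
    have h3 : (fun t : ℝ => deriv (deriv E) (t * u) * E (t * u)) =O[atTop]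
        fun t => Real.exp (-δ * t) := by simpa using h.deriv_deriv_isBigO.mul hE1
    have h4 : (fun t : ℝ => deriv E (t * u) ^ 2) =O[atTop] fun t => Real.exp (-δ * t) := by
      simpa [sq] using h.deriv_isBigO.mul (h.deriv_isBigO.trans hone)
    simpa using (h3.sub h4).mul hinv
  refine h2.congr' ?_ EventuallyEq.rfl
  filter_upwards [eventually_gt_atTop 1] with t ht
  rw [h.rayRemainder_eq ht, div_eq_mul_inv]

theorem continuousOn_deriv_logDeriv (h : RayAsymptotics G E u κ K δ) :
    ContinuousOn (fun t : ℝ => -u ^ 2 * deriv (logDeriv G) (t * u)) (Ici 0) := by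
  intro t ht
  have h1 : ContinuousAt (deriv (logDeriv G)) ((t : ℂ) * u) :=
    (h.analyticAt_logDeriv ht).deriv.continuousAt
  have h2 : ContinuousAt (fun t : ℝ => (t : ℂ) * u) t := by fun_prop
  exact (continuousAt_const.mul (ContinuousAt.comp (g := deriv (logDeriv G))
    (f := fun t : ℝ => (t : ℂ) * u) h1 h2)).continuousWithinAt

theorem locallyIntegrableOn_rayRemainder (h : RayAsymptotics G E u κ K δ) :
    LocallyIntegrableOn (rayRemainder G u) (Ioi 0) := by
  refine LocallyIntegrableOn.add
    ((h.continuousOn_deriv_logDeriv.mono Ioi_subset_Ici_self).locallyIntegrableOn measurableSet_Ioi)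
    ?_
  have h1 : ContinuousOn (fun t : ℝ => 1 / (t : ℂ) ^ 2) (Ioi 0) := by
    refine continuousOn_const.div (by fun_prop) fun t ht => pow_ne_zero 2 ?_
    exact_mod_cast (ne_of_gt ht)
  have h2 := h1.locallyIntegrableOn (μ := volume) measurableSet_Ioi
  intro x hx
  obtain ⟨s, hs, hi⟩ := h2 x hx
  exact ⟨s, hs, hi.indicator measurableSet_Ioi⟩

theorem rayRemainder_isBigO_zero (h : RayAsymptotics G E u κ K δ) :
    rayRemainder G u =O[𝓝[>] 0] (fun t : ℝ => t ^ (-(0 : ℝ))) := by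
  simp only [neg_zero, Real.rpow_zero]
  have h1 : ContinuousWithinAt (fun t : ℝ => -u ^ 2 * deriv (logDeriv G) (t * u)) (Ioi 0) 0 :=
    (h.continuousOn_deriv_logDeriv 0 (mem_Ici.2 le_rfl)).mono Ioi_subset_Ici_self
  refine (h1.tendsto.isBigO_one ℝ).congr' ?_ EventuallyEq.rfl
  have h2 : Ioo (0 : ℝ) 1 ∈ 𝓝[>] 0 := Ioo_mem_nhdsGT one_pos
  filter_upwards [h2] with t ht
  rw [rayRemainder, indicator_of_notMem (by simpa using ht.2.le), add_zero]

theorem differentiableAt_mellin (h : RayAsymptotics G E u κ K δ) {w : ℂ} (hw : 0 < w.re) :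
    DifferentiableAt ℂ (mellin (rayRemainder G u)) w :=
  mellin_differentiableAt_of_isBigO_rpow_exp h.decay_pos h.locallyIntegrableOn_rayRemainder
    h.rayRemainder_isBigO h.rayRemainder_isBigO_zero hw

theorem mellinConvergent (h : RayAsymptotics G E u κ K δ) {w : ℂ} (hw : 0 < w.re) :
    MellinConvergent (rayRemainder G u) w :=
  mellinConvergent_of_isBigO_rpow_exp h.decay_pos h.locallyIntegrableOn_rayRemainder
    h.rayRemainder_isBigO h.rayRemainder_isBigO_zero hw

/-- The term `1 / t²` on `(1, ∞)`, which is removed in the remainder, contributes a simple pole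
at `w = 2`. -/
theorem mellin_deriv_logDeriv (h : RayAsymptotics G E u κ K δ) {w : ℂ} (h0 : 0 < w.re)
    (h2 : w.re < 2) :
    mellin (fun t : ℝ => -u ^ 2 * deriv (logDeriv G) (t * u)) w =
      mellin (rayRemainder G u) w - 1 / (2 - w) := by
  have hint : IntegrableOn (fun t : ℝ => (t : ℂ) ^ (w - 3)) (Ioi 1) :=
    integrableOn_Ioi_cpow_of_lt (by simp; linarith) one_pos
  have hval : ∫ t : ℝ in Ioi 1, (t : ℂ) ^ (w - 3) = 1 / (2 - w) := by
    rw [integral_Ioi_cpow_of_lt (by simp; linarith) one_pos]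
    simp only [Complex.ofReal_one, Complex.one_cpow]
    rw [show w - 3 + 1 = -(2 - w) by ring, neg_div_neg_eq]
  have hind : ∀ t ∈ Ioi (0 : ℝ), (t : ℂ) ^ (w - 1) •
      (Ioi (1 : ℝ)).indicator (fun t => 1 / (t : ℂ) ^ 2) t =
      (Ioi (1 : ℝ)).indicator (fun t : ℝ => (t : ℂ) ^ (w - 3)) t := by
    intro t ht
    have ht' : (t : ℂ) ≠ 0 := by exact_mod_cast (ne_of_gt ht)
    by_cases h1 : t ∈ Ioi (1 : ℝ)
    · rw [indicator_of_mem h1, indicator_of_mem h1, smul_eq_mul,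
        show w - 3 = (w - 1) + (-2 : ℂ) by ring, Complex.cpow_add _ _ ht', Complex.cpow_neg,
        Complex.cpow_ofNat, one_div]
    · rw [indicator_of_notMem h1, indicator_of_notMem h1, smul_zero]
  have hsub : Ioi (0 : ℝ) ∩ Ioi 1 = Ioi 1 := by
    rw [Ioi_inter_Ioi]; norm_num
  have hind_int : ∫ t in Ioi (0 : ℝ), (Ioi (1 : ℝ)).indicator (fun t : ℝ => (t : ℂ) ^ (w - 3)) t =
      1 / (2 - w) := by
    rw [setIntegral_indicator measurableSet_Ioi, hsub, hval]
  have hi2 : IntegrableOn ((Ioi (1 : ℝ)).indicator (fun t : ℝ => (t : ℂ) ^ (w - 3))) (Ioi 0) :=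
    (hint.integrable_indicator measurableSet_Ioi).integrableOn
  rw [← hind_int, mellin, mellin, ← integral_sub (h.mellinConvergent h0) hi2]
  refine setIntegral_congr_fun measurableSet_Ioi fun t ht => ?_
  rw [← hind t ht, rayRemainder, smul_add, add_sub_cancel_right]

/-- The exponential of the Mellin transform of the remainder at `2`, computed by integrating
`t (log G)''` by parts: the boundary term at infinity contains the constant `K` in the asymptotics
of `G` along the ray. -/
theorem exp_mellin_two (h : RayAsymptotics G E u κ K δ) :
    Complex.exp (mellin (rayRemainder G u) 2) = Complex.exp 1 * K / (u * G 0) := by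
  have hu := h.dir_ne_zero
  have hG0 := h.apply_zero_ne_zero
  set p : ℝ → ℂ := fun t => u * logDeriv G (t * u) with hp
  have hpder : ∀ t : ℝ, 0 ≤ t → HasDerivAt p (u ^ 2 * deriv (logDeriv G) (t * u)) t := by
    intro t ht
    have := ((h.analyticAt_logDeriv ht).differentiableAt.hasDerivAt.comp_ofReal_mul_const).const_mul u
    refine this.congr_deriv ?_
    ring
  have hpc : ContinuousOn p (Ici 0) := fun t ht => (hpder t ht).continuousAt.continuousWithinAt
  set P : ℝ → ℂ := fun t => ∫ x in (0 : ℝ)..t, p x with hP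
  have hPc : ∀ T : ℝ, 0 ≤ T → ContinuousOn P (Icc 0 T) := by
    intro T hT
    have := intervalIntegral.continuousOn_primitive_interval (μ := volume) (f := p) (a := 0) (b := T)
      (by
        rw [uIcc_of_le hT]
        exact (hpc.mono Icc_subset_Ici_self).integrableOn_Icc)
    rwa [uIcc_of_le hT] at this
  have hPder : ∀ t : ℝ, 0 < t → HasDerivAt P (p t) t := by
    intro t ht
    refine intervalIntegral.integral_hasDerivAt_right ?_ ?_ (hpder t ht.le).continuousAt
    · refine ContinuousOn.intervalIntegrable ?_
      rw [uIcc_of_le ht.le]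
      exact hpc.mono Icc_subset_Ici_self
    · exact (hpc.mono Ioi_subset_Ici_self).stronglyMeasurableAtFilter isOpen_Ioi t ht
  -- `P` is the logarithm of `G` along the ray, up to the constant `log (G 0)`
  have hexpP : ∀ T : ℝ, 0 < T → Complex.exp (P T) = G (T * u) / G 0 := by
    intro T hT
    have hder : ∀ t ∈ Ioo (0 : ℝ) T,
        HasDerivAt (fun t : ℝ => G (t * u) * Complex.exp (-P t)) 0 t := by
      intro t ht
      have h1 := ((h.differentiable _).hasDerivAt.comp_ofReal_mul_const (t := t) (u := u)).mul
        (hPder t ht.1).neg.cexp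
      refine h1.congr_deriv ?_
      have := h.ne_zero t ht.1.le
      have h2 := mul_div_cancel₀ (deriv G (t * u)) this
      simp only [hp, logDeriv_apply, Pi.neg_apply]
      linear_combination -(u * Complex.exp (-P t)) * h2
    have hcont : ContinuousOn (fun t : ℝ => G (t * u) * Complex.exp (-P t)) (Icc 0 T) := by
      have h1 : Continuous fun t : ℝ => G (t * u) :=
        h.differentiable.continuous.comp (by fun_prop)
      exact h1.continuousOn.mul (Complex.continuous_exp.comp_continuousOn (hPc T hT.le).neg)
    have h2 := intervalIntegral.integral_eq_sub_of_hasDerivAt_of_le hT.le hcont hder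
      (by simp)
    have hP0 : P 0 = 0 := by simp [hP]
    rw [intervalIntegral.integral_zero, hP0, neg_zero, Complex.exp_zero, mul_one,
      Complex.ofReal_zero, zero_mul, eq_comm, sub_eq_zero] at h2
    rw [eq_div_iff hG0, ← h2, mul_left_comm, ← Complex.exp_add]
    simp
  have hint2 : IntegrableOn (fun t : ℝ => (t : ℂ) * rayRemainder G u t) (Ioi 0) := by
    refine (h.mellinConvergent (w := 2) (by simp)).congr_fun (fun t ht => ?_) measurableSet_Ioi
    simp only [smul_eq_mul]
    rw [show (2 : ℂ) - 1 = 1 by norm_num, Complex.cpow_one]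
  have hmel : mellin (rayRemainder G u) 2 = ∫ t in Ioi (0 : ℝ), (t : ℂ) * rayRemainder G u t := by
    rw [mellin]
    refine setIntegral_congr_fun measurableSet_Ioi fun t ht => ?_
    simp only [smul_eq_mul]
    rw [show (2 : ℂ) - 1 = 1 by norm_num, Complex.cpow_one]
  have hlim1 : Tendsto (fun T : ℝ => ∫ t in (0 : ℝ)..T, (t : ℂ) * rayRemainder G u t) atTop
      (𝓝 (mellin (rayRemainder G u) 2)) := by
    rw [hmel]
    exact intervalIntegral_tendsto_integral_Ioi 0 hint2 tendsto_id
  have hII : ∀ a b : ℝ, 0 ≤ a → a ≤ b →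
      IntervalIntegrable (fun t : ℝ => (t : ℂ) * rayRemainder G u t) volume a b := by
    intro a b ha hab
    rw [intervalIntegrable_iff_integrableOn_Ioc_of_le hab]
    exact hint2.mono_set fun t ht => lt_of_le_of_lt ha ht.1
  have hval : ∀ T : ℝ, 1 < T → ∫ t in (0 : ℝ)..T, (t : ℂ) * rayRemainder G u t =
      -(T * p T) + P T + (Real.log T : ℂ) := by
    intro T hT
    rw [← intervalIntegral.integral_add_adjacent_intervals (hII 0 1 le_rfl zero_le_one)
      (hII 1 T zero_le_one hT.le)]
    have e1 : ∫ t in (0 : ℝ)..1, (t : ℂ) * rayRemainder G u t = -p 1 + P 1 := by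
      have := intervalIntegral.integral_eq_sub_of_hasDerivAt_of_le
        (f := fun t : ℝ => -((t : ℂ) * p t) + P t) zero_le_one
        (f' := fun t : ℝ => (t : ℂ) * rayRemainder G u t) ?_ (fun t ht => ?_)
        (hII 0 1 le_rfl zero_le_one)
      · rw [this]
        simp [hP]
      · refine ContinuousOn.add (ContinuousOn.neg (ContinuousOn.mul (by fun_prop) ?_))
          (hPc 1 zero_le_one)
        exact hpc.mono Icc_subset_Ici_self
      · have h1 := ((Complex.ofRealCLM.hasDerivAt (x := t)).mul (hpder t ht.1.le)).neg.add
          (hPder t ht.1)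
        refine h1.congr_deriv ?_
        rw [rayRemainder, indicator_of_notMem (by simpa using ht.2.le)]
        simp
    have e2 : ∫ t in (1 : ℝ)..T, (t : ℂ) * rayRemainder G u t =
        -(T * p T) + P T + (Real.log T : ℂ) - (-p 1 + P 1) := by
      have := intervalIntegral.integral_eq_sub_of_hasDerivAt_of_le
        (f := fun t : ℝ => -((t : ℂ) * p t) + P t + (Real.log t : ℂ)) hT.le
        (f' := fun t : ℝ => (t : ℂ) * rayRemainder G u t) ?_ (fun t ht => ?_)
        (hII 1 T zero_le_one hT.le)
      · rw [this]
        simp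
      · refine ContinuousOn.add (ContinuousOn.add (ContinuousOn.neg (ContinuousOn.mul
          (by fun_prop) ?_)) ((hPc T (by linarith)).mono (Icc_subset_Icc_left zero_le_one))) ?_
        · exact hpc.mono fun t ht => zero_le_one.trans ht.1
        · refine Complex.continuous_ofReal.comp_continuousOn (Real.continuousOn_log.mono ?_)
          intro t ht
          have : (1 : ℝ) ≤ t := ht.1
          simp only [mem_compl_iff, mem_singleton_iff]
          linarith
      · have ht0 : (0 : ℝ) < t := by linarith [ht.1]
        have ht0' : (t : ℂ) ≠ 0 := by exact_mod_cast ht0.ne'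
        have h1 := (((Complex.ofRealCLM.hasDerivAt (x := t)).mul (hpder t ht0.le)).neg.add
          (hPder t ht0)).add (Real.hasDerivAt_log ht0.ne').ofReal_comp
        refine h1.congr_deriv ?_
        rw [rayRemainder, indicator_of_mem (show t ∈ Ioi (1 : ℝ) from ht.1)]
        simp
        field_simp
    rw [e1, e2]
    ring
  have hexp : ∀ T : ℝ, 1 < T →
      Complex.exp (∫ t in (0 : ℝ)..T, (t : ℂ) * rayRemainder G u t) =
      Complex.exp (1 - u * (T * deriv E (T * u) / E (T * u))) * E (T * u) / (u * G 0) := by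
    intro T hT
    have hT0 : (0 : ℝ) < T := by linarith
    have hT0' : (T : ℂ) ≠ 0 := by exact_mod_cast hT0.ne'
    have hE := h.factor_ne_zero hT0
    rw [hval T hT, Complex.exp_add, Complex.exp_add, hexpP T hT0, ← Complex.ofReal_exp,
      Real.exp_log hT0]
    have e1 : (T : ℂ) * p T = κ * (T * u) + u * (T * deriv E (T * u) / E (T * u)) - 1 := by
      simp only [hp]
      rw [h.logDeriv_eq (mul_ne_zero hT0' hu) hE, logDeriv_apply]
      field_simp
    have e2 : G (T * u) = Complex.exp (κ * (T * u)) * E (T * u) / (T * u) := by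
      rw [← h.mul_eq, mul_div_cancel_left₀ _ (mul_ne_zero hT0' hu)]
    rw [e1, e2, show -(κ * (T * u) + u * (T * deriv E (T * u) / E (T * u)) - 1) =
      (1 - u * (T * deriv E (T * u) / E (T * u))) - κ * (T * u) by ring, Complex.exp_sub]
    field_simp
  have hlim0 : Tendsto (fun T : ℝ => (T : ℂ) * deriv E (T * u)) atTop (𝓝 0) := by
    have h1 : (fun T : ℝ => (T : ℂ) * deriv E (T * u)) =O[atTop]
        fun T : ℝ => T * Real.exp (-δ * T) := by
      refine Asymptotics.IsBigO.mul ?_ h.deriv_isBigO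
      exact Asymptotics.isBigO_of_le _ fun T => by simp
    refine h1.trans_tendsto ?_
    have := tendsto_rpow_mul_exp_neg_mul_atTop_nhds_zero 1 δ h.decay_pos
    simpa using this
  have hlim2 : Tendsto (fun T : ℝ => Complex.exp (1 - u * (T * deriv E (T * u) / E (T * u))) *
      E (T * u) / (u * G 0)) atTop (𝓝 (Complex.exp 1 * K / (u * G 0))) := by
    have h1 := (hlim0.div h.tendsto h.limit_ne_zero).const_mul u
    have h2 := (h1.const_sub 1).cexp
    simpa using (h2.mul h.tendsto).div_const (u * G 0)
  refine tendsto_nhds_unique (hlim1.cexp.congr' ?_) hlim2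
  filter_upwards [eventually_gt_atTop 1] with T hT
  exact hexp T hT

end RayAsymptotics

/-! ### The zeta function of the zeros -/

theorem norm_cpow_neg_le {z : ℂ} (hz : z ≠ 0) {s : ℂ} {a b M : ℝ} (ha : a ≤ s.re) (hb : s.re ≤ b)
    (hM : |s.im| ≤ M) :
    ‖z ^ (-s)‖ ≤ (‖z‖ ^ (-a) + ‖z‖ ^ (-b)) * Real.exp (Real.pi * M) := by
  have h0 : 0 < ‖z‖ := norm_pos_iff.2 hz
  rw [Complex.norm_cpow_of_ne_zero hz, div_eq_mul_inv, ← Real.exp_neg]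
  refine mul_le_mul ?_ ?_ (Real.exp_pos _).le (by positivity)
  · simp only [Complex.neg_re]
    rcases le_total 1 ‖z‖ with h1 | h1
    · have := Real.rpow_le_rpow_of_exponent_le h1 (neg_le_neg ha)
      have h2 : 0 ≤ ‖z‖ ^ (-b) := by positivity
      linarith
    · have := Real.rpow_le_rpow_of_exponent_ge h0 h1 (neg_le_neg hb)
      have h2 : 0 ≤ ‖z‖ ^ (-a) := by positivity
      linarith
  · refine Real.exp_le_exp.2 ?_
    simp only [Complex.neg_im, mul_neg, neg_neg]
    refine (le_abs_self _).trans ?_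
    rw [abs_mul]
    exact mul_le_mul (Complex.abs_arg_le_pi z) hM (abs_nonneg _) Real.pi_pos.le

theorem summable_cpow_neg {J : Type*} {mu : J → ℂ} (hmu : ∀ j, mu j ≠ 0)
    (hs : ∀ σ : ℝ, 1 < σ → Summable fun j => ‖mu j‖ ^ (-σ)) {s : ℂ} (h1 : 1 < s.re) :
    Summable fun j => mu j ^ (-s) :=
  Summable.of_norm_bounded (((hs _ h1).add (hs _ h1)).mul_right (Real.exp (Real.pi * |s.im|)))
    fun j => norm_cpow_neg_le (hmu j) le_rfl le_rfl le_rfl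

theorem differentiableAt_tsum_cpow_neg {J : Type*} {mu : J → ℂ} (hmu : ∀ j, mu j ≠ 0)
    (hs : ∀ σ : ℝ, 1 < σ → Summable fun j => ‖mu j‖ ^ (-σ)) {s : ℂ} (h1 : 1 < s.re) :
    DifferentiableAt ℂ (fun s => ∑' j, mu j ^ (-s)) s := by
  set U : Set ℂ := {w | (1 + s.re) / 2 < w.re} ∩ {w | w.re < s.re + 1} ∩
    {w | |w.im| < |s.im| + 1} with hU
  have hUo : IsOpen U := by
    refine ((isOpen_lt continuous_const Complex.continuous_re).inter
      (isOpen_lt Complex.continuous_re continuous_const)).inter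
      (isOpen_lt (continuous_abs.comp Complex.continuous_im) continuous_const)
  have hsU : s ∈ U := by
    refine ⟨⟨?_, ?_⟩, ?_⟩
    · show (1 + s.re) / 2 < s.re
      linarith
    · show s.re < s.re + 1
      linarith
    · show |s.im| < |s.im| + 1
      linarith
  have hd : DifferentiableOn ℂ (fun s => ∑' j, mu j ^ (-s)) U := by
    refine Complex.differentiableOn_tsum_of_summable_norm
      (u := fun j => (‖mu j‖ ^ (-((1 + s.re) / 2)) + ‖mu j‖ ^ (-(s.re + 1))) *
        Real.exp (Real.pi * (|s.im| + 1))) ?_ ?_ hUo ?_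
    · exact ((hs _ (by linarith)).add (hs _ (by linarith))).mul_right _
    · intro j w _
      exact (differentiableAt_id.neg.const_cpow (Or.inl (hmu j))).differentiableWithinAt
    · rintro j w ⟨⟨hw1, hw2⟩, hw3⟩
      exact norm_cpow_neg_le (hmu j) (le_of_lt hw1) (le_of_lt hw2) (le_of_lt hw3)
  exact (hd s hsU).differentiableAt (hUo.mem_nhds hsU)

/-- The continuation to `Re s < 2` of the zeta function of the zeros of `G`, rotated so that the
cut `u (0, ∞)` becomes the negative half-line. -/
noncomputable def zetaContinuation (G : ℂ → ℂ) (u s : ℂ) : ℂ :=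
  (-1 + s * mellin (rayRemainder G u) (2 - s)) *
    ((Complex.Gamma (1 + s))⁻¹ * (Complex.Gamma (2 - s))⁻¹)

namespace RayAsymptotics

variable {G E : ℂ → ℂ} {u κ K : ℂ} {δ : ℝ}

theorem differentiableAt_zetaContinuation (h : RayAsymptotics G E u κ K δ) {s : ℂ}
    (hs : s.re < 2) : DifferentiableAt ℂ (zetaContinuation G u) s := by
  have h1 : DifferentiableAt ℂ (fun s => mellin (rayRemainder G u) (2 - s)) s :=
    (h.differentiableAt_mellin (w := 2 - s) (by simpa using hs)).comp s (by fun_prop)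
  have h2 : DifferentiableAt ℂ (fun s => (Complex.Gamma (1 + s))⁻¹) s :=
    (Complex.differentiable_one_div_Gamma (1 + s)).comp s (by fun_prop)
  have h3 : DifferentiableAt ℂ (fun s => (Complex.Gamma (2 - s))⁻¹) s :=
    (Complex.differentiable_one_div_Gamma (2 - s)).comp s (by fun_prop)
  unfold zetaContinuation
  fun_prop

theorem zetaContinuation_zero (G : ℂ → ℂ) (u : ℂ) : zetaContinuation G u 0 = -1 := by
  simp [zetaContinuation]

theorem hasDerivAt_zetaContinuation (h : RayAsymptotics G E u κ K δ) :
    HasDerivAt (zetaContinuation G u) (mellin (rayRemainder G u) 2 - 1) 0 := by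
  have h1 : HasDerivAt (fun s => mellin (rayRemainder G u) (2 - s))
      (deriv (fun s => mellin (rayRemainder G u) (2 - s)) 0) 0 := by
    refine DifferentiableAt.hasDerivAt ?_
    exact (h.differentiableAt_mellin (w := 2 - 0) (by simp)).comp (0 : ℂ) (by fun_prop)
  set m := deriv (fun s => mellin (rayRemainder G u) (2 - s)) 0
  have h2 := ((hasDerivAt_id (0 : ℂ)).mul h1).const_add (-1)
  have hg1 : HasDerivAt Complex.Gamma (-(Real.eulerMascheroniConstant : ℂ)) (1 + 0) := by
    simpa using Complex.hasDerivAt_Gamma_one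
  have hg2 : HasDerivAt Complex.Gamma (1 - (Real.eulerMascheroniConstant : ℂ)) (2 - 0) := by
    have h3 := Complex.hasDerivAt_Gamma_nat 1
    have e : ((1 : ℕ) : ℂ) + 1 = 2 - 0 := by norm_num
    rw [e] at h3
    refine h3.congr_deriv ?_
    simp
    ring
  have h3 := (HasDerivAt.comp (0 : ℂ) hg1 ((hasDerivAt_id (0 : ℂ)).const_add 1)).inv (by simp)
  have h4 := (HasDerivAt.comp (0 : ℂ) hg2 ((hasDerivAt_id (0 : ℂ)).const_sub 2)).inv (by simp)
  refine (h2.mul (h3.mul h4)).congr_deriv ?_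
  simp
  ring

end RayAsymptotics

namespace EnumeratesZeros

variable {J : Type*} {G E : ℂ → ℂ} {lam : J → ℂ} {u κ K : ℂ} {δ A B k : ℝ}

theorem countable (hl : EnumeratesZeros G lam) (hG : Differentiable ℂ G) (h0 : G 0 ≠ 0) :
    Countable J := by
  rw [← countable_univ_iff]
  have : (univ : Set J) = ⋃ n : ℕ, {j | ‖lam j‖ ≤ n} := by
    ext j
    simpa using exists_nat_ge ‖lam j‖
  rw [this]
  exact countable_iUnion fun n => (hl.finite_norm_le hG h0 n).countable

theorem hasSum_rotated (hl : EnumeratesZeros G lam) (h : RayAsymptotics G E u κ K δ)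
    (hbd : ∀ z, ‖G z‖ ≤ A * Real.exp (B * ‖z‖)) (hB : 0 ≤ B) {t : ℝ} (ht : 0 ≤ t) :
    HasSum (fun j => 1 / ((t : ℂ) + -(lam j / u)) ^ 2)
      (-u ^ 2 * deriv (logDeriv G) (t * u)) := by
  have h1 := (hl.hasSum_deriv_logDeriv h.differentiable h.apply_zero_ne_zero hbd hB
    (h.ne_zero t ht)).mul_left (u ^ 2)
  have hu := h.dir_ne_zero
  rw [mul_neg, ← neg_mul] at h1
  convert! h1 using 2 with j
  have e : (t : ℂ) + -(lam j / u) = (t * u - lam j) / u := by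
    field_simp
    ring
  rw [e, div_pow, one_div_div, ← mul_one_div]

/-- `G` has infinitely many zeros: otherwise `∑ⱼ t² / (t - lam j / u)²` would tend to the number of
zeros as `t → ∞`, but the asymptotics of `G` on the ray give the limit `-1`. -/
theorem infinite (hl : EnumeratesZeros G lam) (h : RayAsymptotics G E u κ K δ)
    (hbd : ∀ z, ‖G z‖ ≤ A * Real.exp (B * ‖z‖)) (hB : 0 ≤ B) : Infinite J := by
  by_contra hinf
  rw [not_infinite_iff_finite] at hinf
  have := Fintype.ofFinite J
  have h1 : Tendsto (fun t : ℝ => ∑ j, (t : ℂ) ^ 2 * (1 / ((t : ℂ) + -(lam j / u)) ^ 2)) atTop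
      (𝓝 (∑ _j : J, 1)) := by
    refine tendsto_finsetSum _ fun j _ => ?_
    have h2 : Tendsto (fun t : ℝ => (t : ℂ)⁻¹) atTop (𝓝 0) :=
      tendsto_inv₀_cobounded.comp (RCLike.tendsto_ofReal_atTop_cobounded ℂ)
    have h3 := (((h2.mul_const (-(lam j / u))).const_add 1).pow 2).inv₀ (by simp)
    simp only [zero_mul, add_zero, one_pow, inv_one] at h3
    refine h3.congr' ?_
    filter_upwards [eventually_gt_atTop 0] with t ht
    have ht' : (t : ℂ) ≠ 0 := by exact_mod_cast ht.ne'
    have e : 1 + (t : ℂ)⁻¹ * -(lam j / u) = ((t : ℂ) + -(lam j / u)) / t := by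
      field_simp
    rw [e, div_pow, inv_div, mul_one_div]
  have h2 : Tendsto (fun t : ℝ => (t : ℂ) ^ 2 * rayRemainder G u t - 1) atTop (𝓝 (0 - 1)) := by
    refine Tendsto.sub_const ?_ 1
    have h3 : (fun t : ℝ => (t : ℂ) ^ 2 * rayRemainder G u t) =O[atTop]
        fun t : ℝ => t ^ 2 * Real.exp (-δ * t) := by
      refine Asymptotics.IsBigO.mul ?_ h.rayRemainder_isBigO
      exact Asymptotics.isBigO_of_le _ fun t => by simp
    refine h3.trans_tendsto ?_
    simpa using tendsto_rpow_mul_exp_neg_mul_atTop_nhds_zero 2 δ h.decay_pos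
  have h3 := tendsto_nhds_unique (h1.congr' ?_) h2
  · have h4 : ((Fintype.card J : ℕ) : ℂ) + 1 = 0 := by
      simp at h3
      rw [h3]
      ring
    exact Nat.cast_add_one_ne_zero _ h4
  · filter_upwards [eventually_gt_atTop 1] with t ht
    have ht' : (t : ℂ) ≠ 0 := by exact_mod_cast (show t ≠ 0 by linarith)
    have h5 := (hl.hasSum_rotated h hbd hB (t := t) (by linarith)).unique (hasSum_fintype _)
    rw [← Finset.mul_sum, ← h5, rayRemainder, indicator_of_mem (show t ∈ Ioi (1 : ℝ) from ht)]
    field_simp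
    ring

/-- The two expressions for the zeta function agree on the strip `1 < Re s < 2` on which the Dirichlet
series and the Mellin transform both converge. -/
theorem hasSum_zetaContinuation (hl : EnumeratesZeros G lam) (h : RayAsymptotics G E u κ K δ)
    (hbd : ∀ z, ‖G z‖ ≤ A * Real.exp (B * ‖z‖)) (hB : 0 ≤ B) (hk0 : 0 ≤ k) (hk1 : k < 1)
    (hsec : ∀ j, (lam j / u).re ≤ k * ‖lam j‖) {s : ℂ} (h1 : 1 < s.re) (h2 : s.re < 2) :
    HasSum (fun j => (-(lam j / u)) ^ (-s)) (zetaContinuation G u s) := by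
  have hG0 := h.apply_zero_ne_zero
  have := hl.countable h.differentiable hG0
  have hnorm : ∀ j, ‖-(lam j / u)‖ = ‖lam j‖ := fun j => by
    rw [norm_neg, norm_div, h.norm_dir, div_one]
  have hs0 : s ≠ 0 := fun h0 => by simp [h0] at h1; linarith
  have hsum := hasSum_mellin_tsum (mu := fun j => -(lam j / u)) hk0 hk1
    (fun j => neg_ne_zero.2 (div_ne_zero (hl.ne_zero h.differentiable hG0 j) h.dir_ne_zero))
    (fun j => by simpa only [hnorm, Complex.neg_re, neg_neg] using hsec j)
    (w := 2 - s) (by simpa using h2) (by simp; linarith) ?_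
  · have hm : mellin (fun t : ℝ => ∑' j, 1 / ((t : ℂ) + -(lam j / u)) ^ 2) (2 - s) =
        mellin (rayRemainder G u) (2 - s) - 1 / s := by
      rw [show 1 / s = 1 / (2 - (2 - s)) by ring_nf,
        ← h.mellin_deriv_logDeriv (w := 2 - s) (by simpa using h2) (by simp; linarith), mellin,
        mellin]
      refine setIntegral_congr_fun measurableSet_Ioi fun t ht => ?_
      have ht' : (0 : ℝ) ≤ t := le_of_lt ht
      rw [(hl.hasSum_rotated h hbd hB ht').tsum_eq]
    rw [hm] at hsum
    have hg1 : Complex.Gamma s ≠ 0 := Complex.Gamma_ne_zero_of_re_pos (by linarith)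
    have hg2 : Complex.Gamma (2 - s) ≠ 0 :=
      Complex.Gamma_ne_zero_of_re_pos (by simpa using h2)
    have hfin := hsum.mul_left ((Complex.Gamma (2 - s) * Complex.Gamma s)⁻¹)
    have e1 : (Complex.Gamma (2 - s) * Complex.Gamma s)⁻¹ *
        (mellin (rayRemainder G u) (2 - s) - 1 / s) = zetaContinuation G u s := by
      rw [zetaContinuation, add_comm 1 s, Complex.Gamma_add_one s hs0]
      field_simp
      ring
    rw [e1] at hfin
    convert! hfin using 2 with j
    rw [show (2 : ℂ) - (2 - s) = s by ring, show 2 - s - 2 = -s by ring,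
      inv_mul_cancel_left₀ (mul_ne_zero hg2 hg1)]
  · have h3 := hl.summable_norm_rpow h.differentiable hG0 hbd h1
    simpa only [hnorm, Complex.sub_re, Complex.re_ofNat, sub_sub_cancel_left] using h3

/-- The zeta function of the zeros of `G`, rotated so that the ray without zeros becomes the negative
half-line, extends to an entire function, and its derivative at `0` is determined by the value
of `G` at `0` and by the asymptotics of `G` along the ray. -/
theorem exists_zeta (hl : EnumeratesZeros G lam) (h : RayAsymptotics G E u κ K δ)
    (hbd : ∀ z, ‖G z‖ ≤ A * Real.exp (B * ‖z‖)) (hB : 0 ≤ B) (hk0 : 0 ≤ k) (hk1 : k < 1)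
    (hsec : ∀ j, (lam j / u).re ≤ k * ‖lam j‖) :
    ∃ Z : ℂ → ℂ, Differentiable ℂ Z ∧
      (∀ s : ℂ, 1 < s.re → HasSum (fun j => (-(lam j / u)) ^ (-s)) (Z s)) ∧
      Z 0 = -1 ∧ Complex.exp (deriv Z 0) = K / (u * G 0) := by
  have hG0 := h.apply_zero_ne_zero
  have hnorm : ∀ j, ‖-(lam j / u)‖ = ‖lam j‖ := fun j => by
    rw [norm_neg, norm_div, h.norm_dir, div_one]
  have hmu : ∀ j, -(lam j / u) ≠ 0 := fun j =>
    neg_ne_zero.2 (div_ne_zero (hl.ne_zero h.differentiable hG0 j) h.dir_ne_zero)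
  have hs : ∀ σ : ℝ, 1 < σ → Summable fun j => ‖-(lam j / u)‖ ^ (-σ) := fun σ hσ => by
    simpa only [hnorm] using hl.summable_norm_rpow h.differentiable hG0 hbd hσ
  set D : ℂ → ℂ := fun s => ∑' j, (-(lam j / u)) ^ (-s) with hD
  have hDsum : ∀ s : ℂ, 1 < s.re → HasSum (fun j => (-(lam j / u)) ^ (-s)) (D s) :=
    fun s h1 => (summable_cpow_neg hmu hs h1).hasSum
  set Z : ℂ → ℂ := fun s => if 1 < s.re then D s else zetaContinuation G u s with hZ
  have hZD : ∀ s : ℂ, 1 < s.re → Z s = D s := fun s h1 => if_pos h1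
  have hZC : ∀ s : ℂ, s.re < 2 → Z s = zetaContinuation G u s := by
    intro s h2
    by_cases h1 : 1 < s.re
    · rw [hZD s h1]
      exact (hDsum s h1).unique (hl.hasSum_zetaContinuation h hbd hB hk0 hk1 hsec h1 h2)
    · exact if_neg h1
  have hopen1 : IsOpen {s : ℂ | 1 < s.re} := isOpen_lt continuous_const Complex.continuous_re
  have hopen2 : IsOpen {s : ℂ | s.re < 2} := isOpen_lt Complex.continuous_re continuous_const
  have hev : ∀ s : ℂ, s.re < 2 → Z =ᶠ[𝓝 s] zetaContinuation G u := fun s h2 => by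
    filter_upwards [hopen2.mem_nhds h2] with w hw using hZC w hw
  refine ⟨Z, fun s => ?_, fun s h1 => ?_, ?_, ?_⟩
  · by_cases h1 : 1 < s.re
    · refine (differentiableAt_tsum_cpow_neg hmu hs h1).congr_of_eventuallyEq ?_
      filter_upwards [hopen1.mem_nhds h1] with w hw using hZD w hw
    · have h2 : s.re < 2 := by linarith
      exact (h.differentiableAt_zetaContinuation h2).congr_of_eventuallyEq (hev s h2)
  · rw [hZD s h1]
    exact hDsum s h1
  · rw [hZC 0 (by simp), RayAsymptotics.zetaContinuation_zero]
  · rw [(hev 0 (by simp)).deriv_eq, h.hasDerivAt_zetaContinuation.deriv, Complex.exp_sub,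
      h.exp_mellin_two]
    field_simp

end EnumeratesZeros

/-! ### The spectral determinant as a value of the characteristic function -/

theorem exp_logCut (θ : ℝ) {z : ℂ} (hz : z ≠ 0) : Complex.exp (logCut θ z) = z := by
  have h1 := self_sub_toIocDiv_zsmul Real.two_pi_pos (θ - 2 * Real.pi) z.arg
  rw [logCut, Complex.exp_add, ← Complex.ofReal_exp, Real.exp_log (norm_pos_iff.2 hz), ← h1]
  set m := toIocDiv Real.two_pi_pos (θ - 2 * Real.pi) z.arg
  have h2 : (((z.arg - m • (2 * Real.pi) : ℝ)) : ℂ) * Complex.I =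
      z.arg * Complex.I - m * (2 * Real.pi * Complex.I) := by
    push_cast [zsmul_eq_mul]
    ring
  rw [h2, Complex.exp_sub, Complex.exp_int_mul_two_pi_mul_I, div_one,
    Complex.norm_mul_exp_arg_mul_I]

/-- The powers for the branch with cut `e^{iθ} (0, ∞)` are, up to an exponential factor, the principal
powers of the numbers rotated by `e^{-i(θ - π)}`. -/
theorem exp_neg_mul_logCut (θ : ℝ) {z : ℂ} (hz : z ≠ 0) (s : ℂ) :
    Complex.exp (-s * logCut θ z) = Complex.exp (-s * ((θ - Real.pi) * Complex.I)) *
      (-(z / Complex.exp (θ * Complex.I))) ^ (-s) := by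
  have h1 : -(z / Complex.exp (θ * Complex.I)) =
      Complex.exp (logCut θ z - (θ - Real.pi) * Complex.I) := by
    rw [Complex.exp_sub, exp_logCut θ hz, sub_mul, Complex.exp_sub, Complex.exp_pi_mul_I]
    field_simp
  have him : (logCut θ z - (θ - Real.pi) * Complex.I).im =
      toIocMod Real.two_pi_pos (θ - 2 * Real.pi) z.arg - (θ - Real.pi) := by
    simp [logCut]
  have hmem := toIocMod_mem_Ioc Real.two_pi_pos (θ - 2 * Real.pi) z.arg
  rw [h1, Complex.cpow_def_of_ne_zero (Complex.exp_ne_zero _), Complex.log_exp, ← Complex.exp_add]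
  · congr 1
    ring
  · rw [him]
    linarith [hmem.1]
  · rw [him]
    linarith [hmem.2]

/-- Two meromorphic functions that agree on a half-plane agree near every point at which both are
analytic. -/
theorem Meromorphic.eventuallyEq_of_eq_on_re_gt {f g : ℂ → ℂ} (hf : Meromorphic f)
    (hg : Meromorphic g) {c : ℝ} (h : ∀ s : ℂ, c < s.re → f s = g s) {x : ℂ}
    (hfx : AnalyticAt ℂ f x) (hgx : AnalyticAt ℂ g x) : f =ᶠ[𝓝 x] g := by
  have hm : MeromorphicOn (f - g) univ := fun z _ => (hf z).sub (hg z)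
  have h1 : meromorphicOrderAt (f - g) ((c + 1 : ℝ) : ℂ) = ⊤ := by
    rw [meromorphicOrderAt_eq_top_iff]
    have hopen : IsOpen {s : ℂ | c < s.re} := isOpen_lt continuous_const Complex.continuous_re
    have hev : ∀ᶠ s in 𝓝 ((c + 1 : ℝ) : ℂ), (f - g) s = 0 := by
      have hmem : ((c + 1 : ℝ) : ℂ) ∈ {s : ℂ | c < s.re} := by
        show c < ((c + 1 : ℝ) : ℂ).re
        rw [Complex.ofReal_re]
        linarith
      filter_upwards [hopen.mem_nhds hmem] with s hs
      rw [Pi.sub_apply, h s hs, sub_self]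
    exact hev.filter_mono nhdsWithin_le_nhds
  have h2 : meromorphicOrderAt (f - g) x = ⊤ := by
    by_contra h2
    exact hm.meromorphicOrderAt_ne_top_of_isPreconnected isPreconnected_univ (mem_univ x)
      (mem_univ _) h2 h1
  have h3 : ∀ᶠ s in 𝓝[≠] x, (f - g) s = 0 := meromorphicOrderAt_eq_top_iff.1 h2
  have h4 := ((hfx.sub hgx).frequently_zero_iff_eventually_zero).1 h3.frequently
  filter_upwards [h4] with s hs
  exact sub_eq_zero.1 hs

/-- The zeros can be enumerated by the natural numbers, as there are infinitely many of them. -/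
theorem exists_enumeratesZeros {G E : ℂ → ℂ} {u κ K : ℂ} {δ A B : ℝ}
    (h : RayAsymptotics G E u κ K δ) (hbd : ∀ z, ‖G z‖ ≤ A * Real.exp (B * ‖z‖)) (hB : 0 ≤ B) :
    ∃ ev : ℕ → ℂ, EnumeratesZeros G ev := by
  have hJ : EnumeratesZeros G (fun j : Σ z : ℂ, Fin (analyticOrderNatAt G z) => j.1) := by
    intro z
    have he : {j : Σ z : ℂ, Fin (analyticOrderNatAt G z) | j.1 = z} =
        range (Sigma.mk (β := fun z : ℂ => Fin (analyticOrderNatAt G z)) z) := by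
      ext ⟨w, i⟩
      constructor
      · rintro rfl
        exact ⟨i, rfl⟩
      · rintro ⟨i', hi'⟩
        exact (congrArg Sigma.fst hi').symm
    rw [he, ← image_univ, sigma_mk_injective.encard_image, encard_univ, ENat.card_eq_coe_fintype_card,
      Fintype.card_fin, Nat.cast_analyticOrderNatAt
        (h.differentiable.analyticOrderAt_ne_top h.apply_zero_ne_zero z)]
  have := hJ.infinite h hbd hB
  have := hJ.countable h.differentiable h.apply_zero_ne_zero
  obtain ⟨e⟩ := nonempty_equiv_of_countable (α := ℕ)
    (β := Σ z : ℂ, Fin (analyticOrderNatAt G z))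
  refine ⟨fun n => (e n).1, fun z => ?_⟩
  rw [← hJ z, ← e.injective.encard_image]
  congr 1
  ext j
  simp only [mem_image, mem_ofPred_eq]
  exact ⟨fun ⟨n, hn, hj⟩ => hj ▸ hn, fun hj => ⟨e.symm j, by simpa using hj, by simp⟩⟩

/-- The spectral determinant of an operator whose eigenvalues are the zeros of `G`, with
multiplicities, where the cut is a ray along which `z G(z) ~ K e^{κ z}`. -/
theorem hasSpectralDet_iff {X : Type*} [AddCommGroup X] [Module ℂ X] {T : X →ₗ.[ℂ] X}
    {G E : ℂ → ℂ} {κ K : ℂ} {δ A B k θ : ℝ} (hT : ∀ z, algMultiplicity T z = analyticOrderAt G z)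
    (h : RayAsymptotics G E (Complex.exp (θ * Complex.I)) κ K δ)
    (hbd : ∀ z, ‖G z‖ ≤ A * Real.exp (B * ‖z‖)) (hB : 0 ≤ B) (hk0 : 0 ≤ k) (hk1 : k < 1)
    (hsec : ∀ z, G z = 0 → (z / Complex.exp (θ * Complex.I)).re ≤ k * ‖z‖) {D : ℂ} :
    HasSpectralDet T θ D ↔ D = -(G 0 / K) := by
  set u := Complex.exp (θ * Complex.I) with hu
  have hKne := h.limit_ne_zero
  have hG0 := h.apply_zero_ne_zero
  have hu0 := h.dir_ne_zero
  -- every enumeration of the eigenvalues has an entire zeta function with the claimed derivative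
  have key : ∀ ev : ℕ → ℂ, EnumeratesZeros G ev → ∃ Z : ℂ → ℂ, Differentiable ℂ Z ∧
      (∀ s : ℂ, 1 < s.re → HasSum (fun j => Complex.exp (-s * logCut θ (ev j))) (Z s)) ∧
      Complex.exp (-deriv Z 0) = -(G 0 / K) := by
    intro ev hev
    obtain ⟨Z, hZ, hZs, hZ0, hZd⟩ := hev.exists_zeta h hbd hB hk0 hk1
      (fun j => hsec _ ((hev.apply_eq_zero_iff h.differentiable).2 ⟨j, rfl⟩))
    refine ⟨fun s => Complex.exp (-s * ((θ - Real.pi) * Complex.I)) * Z s, by fun_prop,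
      fun s hs => ?_, ?_⟩
    · simp_rw [exp_neg_mul_logCut θ (hev.ne_zero h.differentiable hG0 _)]
      exact (hZs s hs).mul_left _
    · have h1 : HasDerivAt (fun s : ℂ => Complex.exp (-s * ((θ - Real.pi) * Complex.I)))
          (-((θ - Real.pi) * Complex.I)) 0 := by
        have := (((hasDerivAt_id (0 : ℂ)).neg).mul_const ((θ - Real.pi) * Complex.I)).cexp
        simpa using this
      have h2 := (h1.mul (hZ 0).hasDerivAt).deriv
      have h3 : deriv (fun s => Complex.exp (-s * ((θ - Real.pi) * Complex.I)) * Z s) 0 =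
          (θ - Real.pi) * Complex.I + deriv Z 0 := by
        refine h2.trans ?_
        simp [hZ0]
      rw [h3, neg_add, Complex.exp_add, Complex.exp_neg (deriv Z 0), hZd, sub_mul, neg_sub,
        Complex.exp_sub, Complex.exp_pi_mul_I, ← hu]
      field_simp
  have hanalytic : ∀ {Z : ℂ → ℂ}, Differentiable ℂ Z → ∀ s, AnalyticAt ℂ Z s :=
    fun hZ s => hZ.analyticAt s
  constructor
  · rintro ⟨Z, ⟨hZm, ev, hev, -, hZs⟩, hZ0, rfl⟩
    obtain ⟨Y, hY, hYs, hYd⟩ := key ev fun z => (hev z).trans (hT z)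
    have heq : Z =ᶠ[𝓝 0] Y :=
      hZm.eventuallyEq_of_eq_on_re_gt (fun s => (hanalytic hY s).meromorphicAt) (c := 1)
        (fun s hs => (hZs s hs).unique (hYs s hs)) hZ0 (hanalytic hY 0)
    rw [heq.deriv_eq, hYd]
  · rintro rfl
    obtain ⟨ev, hev⟩ := exists_enumeratesZeros h hbd hB
    obtain ⟨Y, hY, hYs, hYd⟩ := key ev hev
    exact ⟨Y, ⟨fun s => (hanalytic hY s).meromorphicAt, ev, fun z => (hev z).trans (hT z).symm,
      hev.ne_zero h.differentiable hG0, hYs⟩, hanalytic hY 0, hYd.symm⟩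

/-! ### Algebraic multiplicity from a Jordan chain -/

section JordanChain

variable {X : Type*} [AddCommGroup X] [Module ℂ X] {T : X →ₗ.[ℂ] X} {z : ℂ}

theorem mem_kerPow_succ {n : ℕ} {x : X} :
    x ∈ kerPow T z (n + 1) ↔ ∃ y, (x, y) ∈ T.graph ∧ y - z • x ∈ kerPow T z n := by
  simp only [kerPow, Submodule.mem_map, Submodule.mem_comap, LinearPMap.mem_graph_iff]
  constructor
  · rintro ⟨x, hx, rfl⟩
    exact ⟨T x, ⟨x, rfl, rfl⟩, hx⟩
  · rintro ⟨y, ⟨x, rfl, rfl⟩, hy⟩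
    exact ⟨x, hy, rfl⟩

theorem isEigenvalue_iff_graph : IsEigenvalue T z ↔ ∃ x, x ≠ 0 ∧ (x, z • x) ∈ T.graph := by
  simp only [IsEigenvalue, LinearPMap.mem_graph_iff]
  constructor
  · rintro ⟨x, hx, h⟩
    exact ⟨x, by simpa using hx, x, rfl, h⟩
  · rintro ⟨x, hx, x, rfl, h⟩
    exact ⟨x, by simpa using hx, h⟩

theorem algMultiplicity_eq_zero (h : ∀ x, (x, z • x) ∈ T.graph → x = 0) :
    algMultiplicity T z = 0 := by
  have hk : ∀ n, kerPow T z n = ⊥ := by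
    intro n
    induction n with
    | zero => rfl
    | succ n ih =>
      rw [eq_bot_iff]
      intro x hx
      obtain ⟨y, hxy, hy⟩ := mem_kerPow_succ.1 hx
      rw [ih, Submodule.mem_bot, sub_eq_zero] at hy
      rw [hy] at hxy
      simpa using h x hxy
  simp [algMultiplicity, hk]

variable {M : ℕ} {v : ℕ → X}

theorem chain_mem_kerPow (h0 : v 0 = 0)
    (hv : ∀ k ≤ M, (v (k + 1), z • v (k + 1) + v k) ∈ T.graph) :
    ∀ k ≤ M + 1, v k ∈ kerPow T z k := by
  intro k
  induction k with
  | zero => intro _; simp [h0]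
  | succ k ih =>
    intro hk
    refine mem_kerPow_succ.2 ⟨_, hv k (by omega), ?_⟩
    rw [add_sub_cancel_left]
    exact ih (by omega)

theorem chain_notMem_kerPow (h1 : v 1 ≠ 0)
    (hv : ∀ k ≤ M, (v (k + 1), z • v (k + 1) + v k) ∈ T.graph) :
    ∀ k ≤ M, v (k + 1) ∉ kerPow T z k := by
  intro k
  induction k with
  | zero => intro _; simpa [kerPow] using h1
  | succ k ih =>
    intro hk hmem
    obtain ⟨y, hy, hy'⟩ := mem_kerPow_succ.1 hmem
    have h2 := T.mem_graph_snd_inj hy (hv (k + 1) hk) rfl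
    rw [h2, add_sub_cancel_left] at hy'
    exact ih (by omega) hy'

theorem kerPow_mono : Monotone (kerPow T z) := by
  refine monotone_nat_of_le_succ fun n => ?_
  induction n with
  | zero => exact bot_le
  | succ n ih =>
    intro x hx
    obtain ⟨y, hy, hy'⟩ := mem_kerPow_succ.1 hx
    exact mem_kerPow_succ.2 ⟨y, hy, ih hy'⟩

/-- If `v 1, …, v (M + 1)` is a Jordan chain for the eigenvalue `z` of `T`, if `v 1` spans the
eigenspace, and if the chain cannot be prolonged, then `z` has algebraic multiplicity `M + 1`. -/
theorem algMultiplicity_eq_of_chain (h0 : v 0 = 0) (h1 : v 1 ≠ 0)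
    (hv : ∀ k ≤ M, (v (k + 1), z • v (k + 1) + v k) ∈ T.graph)
    (hker : ∀ (y : X) (c : ℂ), (y, z • y + c • v (M + 1)) ∈ T.graph → ∃ d : ℂ, y = d • v 1) :
    algMultiplicity T z = (M + 1 : ℕ) := by
  have hli : ∀ n ≤ M + 1, LinearIndependent ℂ fun i : Fin n => v (i + 1) := by
    intro n
    induction n with
    | zero => exact fun _ => linearIndependent_empty_type
    | succ n ih =>
      intro hn
      rw [linearIndependent_finSucc']
      refine ⟨ih (by omega), fun hmem => ?_⟩
      refine chain_notMem_kerPow h1 hv n (by omega) (Submodule.span_le.2 ?_ hmem)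
      rintro _ ⟨i, rfl⟩
      exact kerPow_mono i.2 (chain_mem_kerPow h0 hv (i + 1) (by omega))
  have hsup : (⨆ n, kerPow T z n) =
      Submodule.span ℂ (range fun i : Fin (M + 1) => v (i + 1)) := by
    refine le_antisymm (iSup_le fun n => ?_) (Submodule.span_le.2 ?_)
    · induction n with
      | zero => exact bot_le
      | succ n ih =>
        intro x hx
        obtain ⟨y, hxy, hy⟩ := mem_kerPow_succ.1 hx
        obtain ⟨c, hc⟩ := (Submodule.mem_span_range_iff_exists_fun ℂ).1 (ih hy)
        -- subtracting a combination of the chain leaves a multiple of its last vector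
        have hsum := Submodule.sum_mem T.graph (t := Finset.univ)
          (f := fun i : Fin M => c i.castSucc • ((v (i + 2), z • v (i + 2) + v (i + 1)) : X × X))
          fun i _ => T.graph.smul_mem _ (hv (i + 1) i.2)
        have hsub := T.graph.sub_mem hxy hsum
        rw [Fin.sum_univ_castSucc] at hc
        have hy2 : y = z • x + ((∑ i : Fin M, c i.castSucc • v (i + 1)) +
            c (Fin.last M) • v (M + 1)) := by
          have : (∑ i : Fin M, c i.castSucc • v (i + 1)) + c (Fin.last M) • v (M + 1) =
            y - z • x := by simpa using hc
          rw [this]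
          abel
        have hpair : (x, y) - ∑ i : Fin M, c i.castSucc •
            ((v (i + 2), z • v (i + 2) + v (i + 1)) : X × X) =
            (x - ∑ i : Fin M, c i.castSucc • v (i + 2),
              z • (x - ∑ i : Fin M, c i.castSucc • v (i + 2)) + c (Fin.last M) • v (M + 1)) := by
          refine Prod.ext ?_ ?_
          · simp [Prod.fst_sum]
          · simp only [Prod.snd_sub, Prod.snd_sum, Prod.smul_snd, smul_add, Finset.sum_add_distrib,
              smul_sub, Finset.smul_sum]
            rw [hy2]
            simp only [smul_comm z]
            abel
        rw [hpair] at hsub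
        obtain ⟨d, hd⟩ := hker _ _ hsub
        rw [sub_eq_iff_eq_add] at hd
        rw [hd]
        refine Submodule.add_mem _ (Submodule.smul_mem _ _ (Submodule.subset_span ⟨0, by simp⟩))
          (Submodule.sum_mem _ fun i _ => Submodule.smul_mem _ _
            (Submodule.subset_span ⟨i.succ, by simp⟩))
    · rintro _ ⟨i, rfl⟩
      exact le_iSup (kerPow T z) (i + 1 : ℕ) (chain_mem_kerPow h0 hv (i + 1) (by omega))
  rw [algMultiplicity, hsup, rank_span (hli _ le_rfl), Set.toENat_cardinalMk, ← image_univ,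
    (hli _ le_rfl).injective.encard_image]
  simp

end JordanChain

/-! ### Sobolev functions: continuity, gluing, uniqueness for `w'' = z² w` -/

theorem IsH1.continuousOn {c d : ℝ} {F g : ℝ → ℂ} (h : IsH1 c d F g) : ContinuousOn F (Icc c d) := by
  rcases le_or_gt c d with hcd | hcd
  · have h1 : ContinuousOn (fun x => F c + ∫ t in c..x, g t) (Icc c d) := by
      refine continuousOn_const.add ?_
      have := intervalIntegral.continuousOn_primitive_interval (μ := volume) (f := g)
        (a := c) (b := d) (by
          rw [uIcc_of_le hcd, integrableOn_Icc_iff_integrableOn_Ioo]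
          exact h.integrableOn)
      rwa [uIcc_of_le hcd] at this
    exact h1.congr h.2
  · rw [Icc_eq_empty_of_lt hcd]
    exact continuousOn_empty _

theorem IsH1.congr_deriv {c d : ℝ} {F g g' : ℝ → ℂ} (h : IsH1 c d F g)
    (hg : g =ᵐ[volume.restrict (Ioo c d)] g') : IsH1 c d F g' := by
  refine ⟨(memLp_congr_ae hg).1 h.1, fun x hx => ?_⟩
  rw [h.2 x hx]
  congr 1
  rw [intervalIntegral.integral_of_le hx.1, intervalIntegral.integral_of_le hx.1,
    integral_Ioc_eq_integral_Ioo, integral_Ioc_eq_integral_Ioo]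
  exact integral_congr_ae (ae_restrict_of_ae_restrict_of_subset (Ioo_subset_Ioo_right hx.2) hg)

theorem IsH1.sub {c d : ℝ} {F g F' g' : ℝ → ℂ} (h : IsH1 c d F g) (h' : IsH1 c d F' g') :
    IsH1 c d (F - F') (g - g') := by
  simpa [sub_eq_add_neg] using h.add (h'.smul (-1))

/-- Sobolev functions on adjacent intervals with the same trace at the common end point glue. -/
theorem IsH1.glue {a b c : ℝ} (hab : a ≤ b) (hbc : b ≤ c) {F p q : ℝ → ℂ} (h1 : IsH1 a b F p)
    (h2 : IsH1 b c F q) : IsH1 a c F (fun x => if x ≤ b then p x else q x) := by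
  set g : ℝ → ℂ := fun x => if x ≤ b then p x else q x with hg
  have e1 : g =ᵐ[volume.restrict (Ioo a b)] p := by
    filter_upwards [self_mem_ae_restrict measurableSet_Ioo] with x hx
    exact if_pos hx.2.le
  have e2 : g =ᵐ[volume.restrict (Ioo b c)] q := by
    filter_upwards [self_mem_ae_restrict measurableSet_Ioo] with x hx
    exact if_neg (not_le.2 hx.1)
  have k1 := h1.congr_deriv e1.symm
  have k2 := h2.congr_deriv e2.symm
  refine ⟨?_, fun x hx => ?_⟩
  · have m1 : MemLp g 2 (volume.restrict (Ioc a b)) := by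
      rw [← restrict_Ioo_eq_restrict_Ioc]; exact k1.1
    have m2 : MemLp g 2 (volume.restrict (Ioo b c)) := k2.1
    refine (memLp_indicator_iff_restrict measurableSet_Ioo).1 ?_
    have i1 := (memLp_indicator_iff_restrict (μ := volume) measurableSet_Ioc).2 m1
    have i2 := (memLp_indicator_iff_restrict (μ := volume) measurableSet_Ioo).2 m2
    refine (memLp_congr_ae ?_).1 (i1.add i2)
    filter_upwards [Measure.ae_ne volume c, Measure.ae_ne volume b] with x hxc hxb
    by_cases hx1 : x ∈ Ioc a b
    · have hx2 : x ∉ Ioo b c := fun h => (not_lt.2 hx1.2) h.1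
      have hx3 : x ∈ Ioo a c := ⟨hx1.1, lt_of_lt_of_le (lt_of_le_of_ne hx1.2 hxb) hbc⟩
      simp [hx1, hx2, hx3]
    · by_cases hx2 : x ∈ Ioo b c
      · have hx3 : x ∈ Ioo a c := ⟨hab.trans_lt hx2.1, hx2.2⟩
        simp [hx1, hx2, hx3]
      · have hx3 : x ∉ Ioo a c := by
          intro h
          rcases le_or_gt x b with h' | h'
          · exact hx1 ⟨h.1, h'⟩
          · exact hx2 ⟨h', h.2⟩
        simp [hx1, hx2, hx3]
  · rcases le_or_gt x b with hxb | hxb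
    · exact k1.2 x ⟨hx.1, hxb⟩
    · rw [k2.2 x ⟨hxb.le, hx.2⟩, k1.2 b ⟨hab, le_rfl⟩, add_assoc,
        intervalIntegral.integral_add_adjacent_intervals (k1.intervalIntegrable ⟨hab, le_rfl⟩)
          (k2.intervalIntegrable ⟨hxb.le, hx.2⟩)]

theorem IsH1.hasDerivWithinAt {c d : ℝ} {F g : ℝ → ℂ} (h : IsH1 c d F g)
    (hg : ContinuousOn g (Icc c d)) {x : ℝ} (hx : x ∈ Ico c d) :
    HasDerivWithinAt F (g x) (Ici x) x := by
  have h1 : HasDerivWithinAt (fun y => F c + ∫ t in c..y, g t) (g x) (Ici x) x := by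
    refine HasDerivWithinAt.const_add _ ?_
    have hgx : ContinuousWithinAt g (Ioi x) x := by
      refine (hg x ⟨hx.1, hx.2.le⟩).mono_of_mem_nhdsWithin ?_
      filter_upwards [Ioo_mem_nhdsGT hx.2] with y hy
      exact ⟨hx.1.trans hy.1.le, hy.2.le⟩
    refine intervalIntegral.integral_hasDerivWithinAt_right
      (h.intervalIntegrable ⟨hx.1, hx.2.le⟩) ?_ hgx
    refine ⟨Ioo x d, Ioo_mem_nhdsGT hx.2, ?_⟩
    exact ((hg.mono fun y hy => ⟨hx.1.trans hy.1.le, hy.2.le⟩).aestronglyMeasurable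
      measurableSet_Ioo)
  refine h1.congr_of_eventuallyEq ?_ (h.2 x ⟨hx.1, hx.2.le⟩)
  filter_upwards [Ico_mem_nhdsGE hx.2] with y hy
  exact h.2 y ⟨hx.1.trans hy.1, hy.2.le⟩

/-- The initial value problem `F'' = μ F`, `F(c) = F'(c) = 0` has only the zero solution. -/
theorem IsH2.eq_zero_of_initial {c d : ℝ} {F G H : ℝ → ℂ} (h : IsH2 c d F G H) {m : ℂ}
    (hH : H =ᵐ[volume.restrict (Ioo c d)] fun x => m * F x) (hF : F c = 0) (hG : G c = 0) :
    ∀ x ∈ Icc c d, F x = 0 ∧ G x = 0 := by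
  have hFc := h.1.continuousOn
  have hGc := h.2.continuousOn
  have h2 : IsH1 c d G (fun x => m * F x) := h.2.congr_deriv hH
  have key := eq_zero_of_abs_deriv_le_mul_abs_self_of_eq_zero_right
    (f := fun x => (F x, G x)) (f' := fun x => (G x, m * F x)) (K := 1 + ‖m‖) (a := c) (b := d)
    (hFc.prodMk hGc)
    (fun x hx => (h.1.hasDerivWithinAt hGc hx).prodMk
      (h2.hasDerivWithinAt (continuousOn_const.mul hFc) hx)) (by simp [hF, hG]) ?_
  · intro x hx
    simpa using key x hx
  · intro x _
    have h3 : ‖G x‖ ≤ ‖(F x, G x)‖ := norm_snd_le (F x, G x)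
    have h4 : ‖F x‖ ≤ ‖(F x, G x)‖ := norm_fst_le (F x, G x)
    have h5 := norm_nonneg m
    have h6 := norm_nonneg (F x, G x)
    rw [Prod.norm_def (G x, m * F x)]
    refine max_le ?_ ?_
    · simp only []
      nlinarith
    · simp only [norm_mul]
      nlinarith [mul_le_mul_of_nonneg_left h4 h5]

/-! ### Taylor coefficients as contour integrals -/

/-- The contour integral of `f(ζ) / (ζ - z) ^ k` over a circle around `z`, divided by `2 π i`; the
value of the radius does not matter. For an entire function `f` it is `0` for `k = 0`, and the
`(k - 1)`-th Taylor coefficient of `f` at `z` for `k > 0`. -/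
noncomputable def circleCoeff (z : ℂ) (k : ℕ) (f : ℂ → ℂ) : ℂ :=
  (2 * Real.pi * Complex.I)⁻¹ * ∮ ζ in C(z, ‖z‖ + 1), ((ζ - z) ^ k)⁻¹ * f ζ

section CircleCoeff

variable {z : ℂ} {k : ℕ} {f g : ℂ → ℂ}

theorem sub_ne_zero_of_mem_circle {ζ : ℂ} (h : ζ ∈ Metric.sphere z (‖z‖ + 1)) : ζ - z ≠ 0 := by
  rw [mem_sphere_iff_norm] at h
  rw [← norm_pos_iff, h]
  positivity

theorem circleIntegrable_circleCoeff (hf : ContinuousOn f (Metric.sphere z (‖z‖ + 1))) :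
    CircleIntegrable (fun ζ => ((ζ - z) ^ k)⁻¹ * f ζ) z (‖z‖ + 1) := by
  refine ContinuousOn.circleIntegrable (by positivity) (ContinuousOn.mul ?_ hf)
  exact ContinuousOn.inv₀ (by fun_prop) fun ζ hζ => pow_ne_zero _ (sub_ne_zero_of_mem_circle hζ)

theorem circleCoeff_congr (h : EqOn f g (Metric.sphere z (‖z‖ + 1))) :
    circleCoeff z k f = circleCoeff z k g := by
  rw [circleCoeff, circleCoeff]
  congr 1
  refine circleIntegral.integral_congr (by positivity) fun ζ hζ => ?_
  exact congrArg (((ζ - z) ^ k)⁻¹ * ·) (h hζ)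

theorem circleCoeff_add (hf : ContinuousOn f (Metric.sphere z (‖z‖ + 1)))
    (hg : ContinuousOn g (Metric.sphere z (‖z‖ + 1))) :
    circleCoeff z k (fun ζ => f ζ + g ζ) = circleCoeff z k f + circleCoeff z k g := by
  rw [circleCoeff, circleCoeff, circleCoeff, ← mul_add, ← circleIntegral.integral_add
    (circleIntegrable_circleCoeff hf) (circleIntegrable_circleCoeff hg)]
  simp only [mul_add]

theorem circleCoeff_const_mul (c : ℂ) :
    circleCoeff z k (fun ζ => c * f ζ) = c * circleCoeff z k f := by
  rw [circleCoeff, circleCoeff, mul_left_comm c, ← circleIntegral.integral_const_mul c]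
  congr 2
  funext ζ
  ring

/-- Multiplication by `ζ = z + (ζ - z)` on Taylor coefficients. -/
theorem circleCoeff_id_mul (hf : ContinuousOn f (Metric.sphere z (‖z‖ + 1))) :
    circleCoeff z (k + 1) (fun ζ => ζ * f ζ) =
      z * circleCoeff z (k + 1) f + circleCoeff z k f := by
  have h1 : circleCoeff z k f = circleCoeff z (k + 1) (fun ζ => (ζ - z) * f ζ) := by
    rw [circleCoeff, circleCoeff]
    congr 1
    refine circleIntegral.integral_congr (by positivity) fun ζ hζ => ?_
    have := sub_ne_zero_of_mem_circle hζ
    field_simp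
    ring
  rw [h1, ← circleCoeff_const_mul, ← circleCoeff_add (by fun_prop) (by fun_prop)]
  congr 1
  funext ζ
  ring

theorem circleCoeff_eq_zero_of_le {n : ℕ} (hk : k ≤ n) (hg : Differentiable ℂ g) :
    circleCoeff z k (fun ζ => (ζ - z) ^ n * g ζ) = 0 := by
  rw [circleCoeff]
  have h1 : ∮ ζ in C(z, ‖z‖ + 1), ((ζ - z) ^ k)⁻¹ * ((ζ - z) ^ n * g ζ) =
      ∮ ζ in C(z, ‖z‖ + 1), (ζ - z) ^ (n - k) * g ζ := by
    refine circleIntegral.integral_congr (by positivity) fun ζ hζ => ?_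
    have h2 := sub_ne_zero_of_mem_circle hζ
    have h3 : (ζ - z) ^ n = (ζ - z) ^ k * (ζ - z) ^ (n - k) := by
      rw [← pow_add, Nat.add_sub_cancel' hk]
    simp only [h3]
    field_simp
  have h2 : Differentiable ℂ fun ζ => (ζ - z) ^ (n - k) * g ζ := by fun_prop
  rw [h1, (h2.diffContOnCl).circleIntegral_eq_zero (by positivity), mul_zero]

theorem circleCoeff_succ_pow_mul (n : ℕ) (hg : Differentiable ℂ g) :
    circleCoeff z (n + 1) (fun ζ => (ζ - z) ^ n * g ζ) = g z := by
  rw [circleCoeff]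
  have h1 : ∮ ζ in C(z, ‖z‖ + 1), ((ζ - z) ^ (n + 1))⁻¹ * ((ζ - z) ^ n * g ζ) =
      ∮ ζ in C(z, ‖z‖ + 1), (ζ - z)⁻¹ • g ζ := by
    refine circleIntegral.integral_congr (by positivity) fun ζ hζ => ?_
    have h2 := sub_ne_zero_of_mem_circle hζ
    simp only [smul_eq_mul]
    field_simp
    ring
  have h2 := Complex.two_pi_I_inv_smul_circleIntegral_sub_inv_smul_of_differentiable_on_off_countable
    (R := ‖z‖ + 1) (c := z) (w := z) (f := g) countable_empty
    (Metric.mem_ball_self (by positivity)) hg.continuous.continuousOn fun x _ => hg x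
  rw [h1, ← smul_eq_mul, h2]

theorem circleCoeff_zero (hf : Differentiable ℂ f) : circleCoeff z 0 f = 0 := by
  simpa using circleCoeff_eq_zero_of_le (z := z) (k := 0) (n := 0) le_rfl hf

theorem circleCoeff_one (hf : Differentiable ℂ f) : circleCoeff z 1 f = f z := by
  simpa using circleCoeff_succ_pow_mul (z := z) 0 hf

theorem continuous_circleCoeff {g : ℂ → ℝ → ℂ} (hg : Continuous (Function.uncurry g)) :
    Continuous fun t => circleCoeff z k (g · t) := by
  refine continuous_const.mul ?_
  simp only [circleIntegral, deriv_circleMap, smul_eq_mul]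
  refine intervalIntegral.continuous_parametric_intervalIntegral_of_continuous' ?_ _ _
  refine Continuous.mul (by fun_prop) (Continuous.mul ?_ ?_)
  · refine Continuous.inv₀ (by fun_prop) fun p => pow_ne_zero _ ?_
    exact sub_ne_zero_of_mem_circle (circleMap_mem_sphere z (by positivity) _)
  · exact hg.comp (by fun_prop : Continuous fun p : ℝ × ℝ => (circleMap z (‖z‖ + 1) p.2, p.1))

theorem circleCoeff_intervalIntegral {g : ℂ → ℝ → ℂ} (hg : Continuous (Function.uncurry g))
    (c x : ℝ) : circleCoeff z k (fun ζ => ∫ t in c..x, g ζ t) =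
      ∫ t in c..x, circleCoeff z k (g · t) := by
  have hcont : Continuous fun p : ℝ × ℝ => circleMap 0 (‖z‖ + 1) p.1 * Complex.I *
      (((circleMap z (‖z‖ + 1) p.1 - z) ^ k)⁻¹ * g (circleMap z (‖z‖ + 1) p.1) p.2) := by
    refine Continuous.mul (by fun_prop) (Continuous.mul ?_ ?_)
    · refine Continuous.inv₀ (by fun_prop) fun p => pow_ne_zero _ ?_
      exact sub_ne_zero_of_mem_circle (circleMap_mem_sphere z (by positivity) _)
    · exact hg.comp (by fun_prop : Continuous fun p : ℝ × ℝ => (circleMap z (‖z‖ + 1) p.1, p.2))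
  simp only [circleCoeff, circleIntegral, deriv_circleMap, smul_eq_mul,
    intervalIntegral.integral_const_mul]
  congr 1
  rw [← intervalIntegral_intervalIntegral_swap]
  · simp only [intervalIntegral.integral_const_mul]
  · exact (hcont.continuousOn.integrableOn_compact (isCompact_uIcc.prod isCompact_uIcc)).mono_set
      (prod_mono uIoc_subset_uIcc uIoc_subset_uIcc)

theorem memLp_of_continuous {F : ℝ → ℂ} (hF : Continuous F) (c d : ℝ) :
    MemLp F 2 (volume.restrict (Ioo c d)) := by
  obtain ⟨C, hC⟩ := (isCompact_Icc (a := c) (b := d)).exists_bound_of_continuousOn hF.continuousOn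
  refine MemLp.of_bound hF.aestronglyMeasurable C ?_
  filter_upwards [self_mem_ae_restrict measurableSet_Ioo] with x hx
  exact hC x (Ioo_subset_Icc_self hx)

/-- Taylor coefficients in the parameter of a family of `H¹` functions. -/
theorem isH1_circleCoeff {f g : ℂ → ℝ → ℂ} {c d : ℝ} (hg : Continuous (Function.uncurry g))
    (hfc : ContinuousOn (f · c) (Metric.sphere z (‖z‖ + 1)))
    (hfg : ∀ ζ ∈ Metric.sphere z (‖z‖ + 1), ∀ x ∈ Icc c d, f ζ x = f ζ c + ∫ t in c..x, g ζ t) :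
    IsH1 c d (fun x => circleCoeff z k (f · x)) (fun x => circleCoeff z k (g · x)) := by
  refine ⟨memLp_of_continuous (continuous_circleCoeff hg) c d, fun x hx => ?_⟩
  rw [← circleCoeff_intervalIntegral hg, ← circleCoeff_add hfc]
  · exact circleCoeff_congr fun ζ hζ => hfg ζ hζ x hx
  · refine Continuous.continuousOn ?_
    exact intervalIntegral.continuous_parametric_intervalIntegral_of_continuous' hg _ _

end CircleCoeff

/-! ### The characteristic function of the damped wave operator -/

/-- `sinh (ζ x) / ζ`, extended to `ζ = 0` by its limit `x`. -/
noncomputable def sinhDiv (ζ : ℂ) (x : ℝ) : ℂ :=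
  dslope (fun ζ : ℂ => Complex.sinh (ζ * x)) 0 ζ

theorem mul_sinhDiv (ζ : ℂ) (x : ℝ) : ζ * sinhDiv ζ x = Complex.sinh (ζ * x) := by
  simpa [sinhDiv] using sub_smul_dslope (fun ζ : ℂ => Complex.sinh (ζ * x)) 0 ζ

theorem sinhDiv_zero_left (x : ℝ) : sinhDiv 0 x = x := by
  have h1 : HasDerivAt (fun ζ : ℂ => Complex.sinh (ζ * x)) (Complex.cosh (0 * x) * x) 0 := by
    have := ((hasDerivAt_id (0 : ℂ)).mul_const (x : ℂ)).csinh
    simpa using this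
  rw [sinhDiv, dslope_same, h1.deriv]
  simp

theorem sinhDiv_of_ne_zero {ζ : ℂ} (hζ : ζ ≠ 0) (x : ℝ) :
    sinhDiv ζ x = Complex.sinh (ζ * x) / ζ := by
  rw [eq_div_iff hζ, mul_comm, mul_sinhDiv]

theorem sinhDiv_zero_right (ζ : ℂ) : sinhDiv ζ 0 = 0 := by
  rcases eq_or_ne ζ 0 with rfl | h
  · simp [sinhDiv_zero_left]
  · simp [sinhDiv_of_ne_zero h]

theorem differentiable_sinhDiv (x : ℝ) : Differentiable ℂ (sinhDiv · x) := by
  have h : Differentiable ℂ fun ζ : ℂ => Complex.sinh (ζ * x) := by fun_prop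
  rw [← differentiableOn_univ] at h ⊢
  exact (Complex.differentiableOn_dslope Filter.univ_mem).2 h

theorem hasDerivAt_cosh_mul (ζ : ℂ) (x : ℝ) :
    HasDerivAt (fun x : ℝ => Complex.cosh (ζ * x)) (ζ * Complex.sinh (ζ * x)) x := by
  have h := ((hasDerivAt_id (x : ℂ)).const_mul ζ).ccosh.comp_ofReal
  refine h.congr_deriv ?_
  simp
  ring

theorem hasDerivAt_sinhDiv (ζ : ℂ) (x : ℝ) :
    HasDerivAt (fun x : ℝ => sinhDiv ζ x) (Complex.cosh (ζ * x)) x := by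
  rcases eq_or_ne ζ 0 with rfl | hζ
  · simp only [sinhDiv_zero_left]
    rw [zero_mul, Complex.cosh_zero]
    exact Complex.ofRealCLM.hasDerivAt (x := x)
  · simp only [sinhDiv_of_ne_zero hζ]
    have h := (((hasDerivAt_id (x : ℂ)).const_mul ζ).csinh.comp_ofReal).div_const ζ
    refine h.congr_deriv ?_
    simp
    field_simp

theorem cosh_mul_eq_add_integral (ζ : ℂ) (c x : ℝ) :
    Complex.cosh (ζ * x) = Complex.cosh (ζ * c) + ∫ t in c..x, ζ * Complex.sinh (ζ * t) := by
  rw [intervalIntegral.integral_eq_sub_of_hasDerivAt (fun t _ => hasDerivAt_cosh_mul ζ t)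
    (Continuous.intervalIntegrable (by fun_prop) _ _)]
  ring

theorem sinhDiv_eq_add_integral (ζ : ℂ) (c x : ℝ) :
    sinhDiv ζ x = sinhDiv ζ c + ∫ t in c..x, Complex.cosh (ζ * t) := by
  rw [intervalIntegral.integral_eq_sub_of_hasDerivAt (fun t _ => hasDerivAt_sinhDiv ζ t)
    (Continuous.intervalIntegrable (by fun_prop) _ _)]
  ring

/-- The solution `w` of `w'' = ζ² w` on `(0, a)` and on `(a, ∞)` with `w(0) = 0`, `w'(0) = 1` and
`w'(a⁺) - w'(a⁻) = α ζ w(a)`. -/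
noncomputable def shooting (a : ℝ) (α ζ : ℂ) (x : ℝ) : ℂ :=
  sinhDiv ζ x + α * Complex.sinh (ζ * a) * sinhDiv ζ (max (x - a) 0)

/-- The derivative of `shooting a α ζ` to the right of `a`. -/
noncomputable def shootingDeriv (a : ℝ) (α ζ : ℂ) (x : ℝ) : ℂ :=
  Complex.cosh (ζ * x) + α * Complex.sinh (ζ * a) * Complex.cosh (ζ * (x - a : ℝ))

/-- The characteristic function of the damped wave operator: the value at `L` of the solution
`shooting a α ζ` of the eigenvalue equation. -/
noncomputable def dampedCharFun (L a : ℝ) (α ζ : ℂ) : ℂ := shooting a α ζ L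

section Chain

variable {L a : ℝ} {α z : ℂ}

theorem differentiable_shooting (a : ℝ) (α : ℂ) (x : ℝ) : Differentiable ℂ (shooting a α · x) := by
  have h1 := differentiable_sinhDiv x
  have h2 := differentiable_sinhDiv (max (x - a) 0)
  unfold shooting
  fun_prop

theorem shooting_of_le {x : ℝ} (hx : x ≤ a) (ζ : ℂ) : shooting a α ζ x = sinhDiv ζ x := by
  rw [shooting, max_eq_right (by linarith), sinhDiv_zero_right, mul_zero, add_zero]

theorem shooting_of_ge {x : ℝ} (hx : a ≤ x) (ζ : ℂ) :
    shooting a α ζ x = sinhDiv ζ x + α * Complex.sinh (ζ * a) * sinhDiv ζ (x - a) := by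
  rw [shooting, max_eq_left (by linarith)]

theorem mul_shooting (ζ : ℂ) (x : ℝ) : ζ * shooting a α ζ x =
    Complex.sinh (ζ * x) + α * Complex.sinh (ζ * a) * Complex.sinh (ζ * (max (x - a) 0 : ℝ)) := by
  rw [shooting, mul_add, mul_sinhDiv, mul_left_comm, mul_sinhDiv]

theorem continuous_mul_mul_shooting :
    Continuous (Function.uncurry fun ζ x => ζ * (ζ * shooting a α ζ x)) := by
  simp only [mul_shooting]
  unfold Function.uncurry
  fun_prop

theorem shooting_eq_add_integral_left {x : ℝ} (hx : x ∈ Icc 0 a) (ζ : ℂ) :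
    shooting a α ζ x = shooting a α ζ 0 + ∫ t in (0 : ℝ)..x, Complex.cosh (ζ * t) := by
  rw [shooting_of_le hx.2, shooting_of_le (hx.1.trans hx.2), sinhDiv_eq_add_integral ζ 0 x]

theorem cosh_eq_add_integral_shooting {x : ℝ} (hx : x ∈ Icc 0 a) (ζ : ℂ) :
    Complex.cosh (ζ * x) =
      Complex.cosh (ζ * (0 : ℝ)) + ∫ t in (0 : ℝ)..x, ζ * (ζ * shooting a α ζ t) := by
  rw [cosh_mul_eq_add_integral ζ 0 x]
  congr 1
  refine intervalIntegral.integral_congr fun t ht => ?_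
  rw [uIcc_of_le hx.1] at ht
  simp only [shooting_of_le (ht.2.trans hx.2), mul_sinhDiv]

theorem integral_comp_sub_const {f : ℝ → ℂ} (a x : ℝ) :
    ∫ t in a..x, f (t - a) = ∫ t in (0 : ℝ)..(x - a), f t := by
  rw [intervalIntegral.integral_comp_sub_right, sub_self]

theorem shooting_eq_add_integral_right {x : ℝ} (hx : a ≤ x) (ζ : ℂ) :
    shooting a α ζ x = shooting a α ζ a + ∫ t in a..x, shootingDeriv a α ζ t := by
  have h1 : ∫ t in a..x, shootingDeriv a α ζ t = (∫ t in a..x, Complex.cosh (ζ * t)) +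
      α * Complex.sinh (ζ * a) * ∫ t in a..x, Complex.cosh (ζ * (t - a : ℝ)) := by
    unfold shootingDeriv
    rw [intervalIntegral.integral_add (Continuous.intervalIntegrable (by fun_prop) _ _)
      (Continuous.intervalIntegrable (by fun_prop) _ _), intervalIntegral.integral_const_mul]
  rw [h1, integral_comp_sub_const (f := fun t => Complex.cosh (ζ * t)), shooting_of_ge hx,
    shooting_of_le le_rfl, sinhDiv_eq_add_integral ζ a x, sinhDiv_eq_add_integral ζ 0 (x - a),
    sinhDiv_zero_right]
  ring

theorem shootingDeriv_eq_add_integral {x : ℝ} (hx : a ≤ x) (ζ : ℂ) :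
    shootingDeriv a α ζ x =
      shootingDeriv a α ζ a + ∫ t in a..x, ζ * (ζ * shooting a α ζ t) := by
  have h1 : ∫ t in a..x, ζ * (ζ * shooting a α ζ t) = (∫ t in a..x, ζ * Complex.sinh (ζ * t)) +
      α * Complex.sinh (ζ * a) * ∫ t in a..x, ζ * Complex.sinh (ζ * (t - a : ℝ)) := by
    rw [← intervalIntegral.integral_const_mul,
      ← intervalIntegral.integral_add (Continuous.intervalIntegrable (by fun_prop) _ _)
      (Continuous.intervalIntegrable (by fun_prop) _ _)]
    refine intervalIntegral.integral_congr fun t ht => ?_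
    rw [uIcc_of_le hx] at ht
    simp only [mul_shooting, max_eq_left (sub_nonneg.2 ht.1)]
    ring
  rw [h1, integral_comp_sub_const (f := fun t => ζ * Complex.sinh (ζ * t)), shootingDeriv,
    shootingDeriv, cosh_mul_eq_add_integral ζ a x, cosh_mul_eq_add_integral ζ 0 (x - a)]
  simp
  ring

/-- The Taylor coefficients in `ζ` at `z` of `shooting a α ζ`, with the indexing of `circleCoeff`. -/
noncomputable def chainW (a : ℝ) (α z : ℂ) (k : ℕ) (x : ℝ) : ℂ :=
  circleCoeff z k fun ζ => shooting a α ζ x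

/-- The Taylor coefficients at `z` of `ζ * shooting a α ζ`. -/
noncomputable def chainV (a : ℝ) (α z : ℂ) (k : ℕ) (x : ℝ) : ℂ :=
  circleCoeff z k fun ζ => ζ * shooting a α ζ x

/-- The Taylor coefficients at `z` of `ζ² * shooting a α ζ`. -/
noncomputable def chainZ (a : ℝ) (α z : ℂ) (k : ℕ) (x : ℝ) : ℂ :=
  circleCoeff z k fun ζ => ζ * (ζ * shooting a α ζ x)

/-- The Taylor coefficients at `z` of the derivative of `shooting a α ζ` to the left of `a`. -/
noncomputable def chainP (z : ℂ) (k : ℕ) (x : ℝ) : ℂ :=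
  circleCoeff z k fun ζ => Complex.cosh (ζ * x)

/-- The Taylor coefficients at `z` of the derivative of `shooting a α ζ` to the right of `a`. -/
noncomputable def chainQ (a : ℝ) (α z : ℂ) (k : ℕ) (x : ℝ) : ℂ :=
  circleCoeff z k fun ζ => shootingDeriv a α ζ x

theorem chainV_succ (k : ℕ) (x : ℝ) :
    chainV a α z (k + 1) x = z * chainW a α z (k + 1) x + chainW a α z k x :=
  circleCoeff_id_mul (differentiable_shooting a α x).continuous.continuousOn

theorem chainZ_succ (k : ℕ) (x : ℝ) :
    chainZ a α z (k + 1) x = z * chainV a α z (k + 1) x + chainV a α z k x :=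
  circleCoeff_id_mul
    (continuous_id.mul (differentiable_shooting a α x).continuous).continuousOn

theorem chainW_zero (x : ℝ) : chainW a α z 0 x = 0 :=
  circleCoeff_zero (differentiable_shooting a α x)

theorem chainV_zero (x : ℝ) : chainV a α z 0 x = 0 :=
  circleCoeff_zero (differentiable_id.mul (differentiable_shooting a α x))

theorem chainW_apply_zero (ha : 0 ≤ a) (k : ℕ) : chainW a α z k 0 = 0 := by
  simp only [chainW, shooting_of_le ha, sinhDiv_zero_right]
  simpa using circleCoeff_const_mul (z := z) (k := k) (f := fun _ => 0) 0

theorem chainP_one_zero : chainP z 1 0 = 1 := by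
  have h : Differentiable ℂ fun ζ : ℂ => Complex.cosh (ζ * (0 : ℝ)) := by fun_prop
  rw [chainP, circleCoeff_one h]
  simp

theorem chainQ_sub_chainP (k : ℕ) :
    chainQ a α z k a - chainP z k a = α * chainV a α z k a := by
  have h1 : chainQ a α z k a = chainP z k a + circleCoeff z k fun ζ => α * (ζ * shooting a α ζ a) := by
    have h2 : Continuous fun ζ => α * (ζ * shooting a α ζ a) :=
      continuous_const.mul (continuous_id.mul (differentiable_shooting a α a).continuous)
    rw [chainP, chainQ, ← circleCoeff_add (by fun_prop) h2.continuousOn]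
    refine circleCoeff_congr fun ζ _ => ?_
    simp only [shootingDeriv, mul_shooting, sub_self, max_self]
    simp
  rw [h1, circleCoeff_const_mul, chainV]
  ring

theorem isH2_chain_left (k : ℕ) : IsH2 0 a (chainW a α z k) (chainP z k) (chainZ a α z k) := by
  constructor
  · refine isH1_circleCoeff (by unfold Function.uncurry; fun_prop)
      (differentiable_shooting a α 0).continuous.continuousOn fun ζ _ x hx => ?_
    exact shooting_eq_add_integral_left hx ζ
  · refine isH1_circleCoeff continuous_mul_mul_shooting (by fun_prop) fun ζ _ x hx => ?_
    exact cosh_eq_add_integral_shooting hx ζ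

theorem isH2_chain_right (k : ℕ) : IsH2 a L (chainW a α z k) (chainQ a α z k) (chainZ a α z k) := by
  constructor
  · refine isH1_circleCoeff (by unfold Function.uncurry shootingDeriv; fun_prop)
      (differentiable_shooting a α a).continuous.continuousOn fun ζ _ x hx => ?_
    exact shooting_eq_add_integral_right hx.1 ζ
  · refine isH1_circleCoeff continuous_mul_mul_shooting (by unfold shootingDeriv; fun_prop)
      fun ζ _ x hx => ?_
    exact shootingDeriv_eq_add_integral hx.1 ζ

theorem isH1_chainW (ha : a ∈ Ioo 0 L) (k : ℕ) : ∃ g, IsH1 0 L (chainW a α z k) g :=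
  ⟨_, (isH2_chain_left k).1.glue ha.1.le ha.2.le (isH2_chain_right k).1⟩

theorem isH1_chainV (ha : a ∈ Ioo 0 L) (k : ℕ) : ∃ g, IsH1 0 L (chainV a α z k) g := by
  rcases k with _ | k
  · exact ⟨0, by rw [show chainV a α z 0 = 0 from funext chainV_zero]; exact isH1_zero 0 L⟩
  · obtain ⟨g, hg⟩ := isH1_chainW (α := α) (z := z) ha k
    obtain ⟨g', hg'⟩ := isH1_chainW (α := α) (z := z) ha (k + 1)
    refine ⟨z • g' + g, ?_⟩
    rw [show chainV a α z (k + 1) = z • chainW a α z (k + 1) + chainW a α z k from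
      funext fun x => chainV_succ k x]
    exact (hg'.smul z).add hg

theorem memLp_of_isH1 {F g : ℝ → ℂ} (h : IsH1 0 L F g) : MemLp F 2 (volume.restrict (Ioo 0 L)) := by
  obtain ⟨C, hC⟩ := (isCompact_Icc (a := (0 : ℝ)) (b := L)).exists_bound_of_continuousOn h.continuousOn
  refine MemLp.of_bound ((h.continuousOn.mono Ioo_subset_Icc_self).aestronglyMeasurable
    measurableSet_Ioo) C ?_
  filter_upwards [self_mem_ae_restrict measurableSet_Ioo] with x hx
  exact hC x (Ioo_subset_Icc_self hx)

/-- The vectors of the Jordan chain in the energy space: the Taylor coefficients at `z` of the family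
`(ζ * shooting a α ζ, shooting a α ζ)`. -/
theorem exists_chain (ha : a ∈ Ioo 0 L) (α z : ℂ) : ∃ X : ℕ → EnergySpace L, ∀ k,
    (X k).1 =ᵐ[volume.restrict (Ioo 0 L)] chainV a α z k ∧
    ((X k).2 : L2Space L) =ᵐ[volume.restrict (Ioo 0 L)] chainW a α z k := by
  have hk : ∀ k, ∃ x : EnergySpace L, x.1 =ᵐ[volume.restrict (Ioo 0 L)] chainV a α z k ∧
      (x.2 : L2Space L) =ᵐ[volume.restrict (Ioo 0 L)] chainW a α z k := by
    intro k
    obtain ⟨g, hg⟩ := isH1_chainV (α := α) (z := z) ha k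
    obtain ⟨g', hg'⟩ := isH1_chainW (α := α) (z := z) ha k
    have m := memLp_of_isH1 hg
    have m' := memLp_of_isH1 hg'
    exact ⟨(m.toLp _, ⟨m'.toLp _, _, g', m'.coeFn_toLp, hg'⟩), m.coeFn_toLp, m'.coeFn_toLp⟩
  choose X hX using hk
  exact ⟨X, hX⟩

variable {X : ℕ → EnergySpace L}

theorem chain_zero (hX : ∀ k, (X k).1 =ᵐ[volume.restrict (Ioo 0 L)] chainV a α z k ∧
    ((X k).2 : L2Space L) =ᵐ[volume.restrict (Ioo 0 L)] chainW a α z k) : X 0 = 0 := by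
  refine Prod.ext (Lp.ext ?_) (Subtype.ext (Lp.ext ?_))
  · refine (hX 0).1.trans ?_
    rw [show chainV a α z 0 = 0 from funext chainV_zero]
    exact (Lp.coeFn_zero _ _ _).symm
  · refine (hX 0).2.trans ?_
    rw [show chainW a α z 0 = 0 from funext chainW_zero]
    exact (Lp.coeFn_zero _ _ _).symm

/-- `(H_α - z) X_{k+1} = X_k` as long as the boundary condition at `L` holds for both vectors. -/
theorem chain_mem_graph (ha : a ∈ Ioo 0 L)
    (hX : ∀ k, (X k).1 =ᵐ[volume.restrict (Ioo 0 L)] chainV a α z k ∧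
      ((X k).2 : L2Space L) =ᵐ[volume.restrict (Ioo 0 L)] chainW a α z k) {k : ℕ}
    (h1 : chainW a α z (k + 1) L = 0) (h2 : chainW a α z k L = 0) :
    (X (k + 1), z • X (k + 1) + X k) ∈ dampedWaveGraph L a α := by
  obtain ⟨V', hV'⟩ := isH1_chainV (α := α) (z := z) ha (k + 1)
  obtain ⟨W', hW'⟩ := isH1_chainW (α := α) (z := z) ha (k + 1)
  refine ⟨chainV a α z (k + 1), V', chainW a α z (k + 1), W', chainP z (k + 1),
    chainQ a α z (k + 1), chainZ a α z (k + 1), (hX _).1, (hX _).2, ?_, ?_,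
    ⟨hV', ?_, ?_⟩, ⟨hW', chainW_apply_zero ha.1.le _, h1⟩, isH2_chain_left _, isH2_chain_right _,
    chainQ_sub_chainP _⟩
  · have e1 := Lp.coeFn_add (z • (X (k + 1)).1) (X k).1
    have e2 := Lp.coeFn_smul z (X (k + 1)).1
    filter_upwards [e1, e2, (hX (k + 1)).1, (hX k).1] with x e1 e2 e3 e4
    change (z • (X (k + 1)).1 + (X k).1 : L2Space L) x = _
    rw [e1, Pi.add_apply, e2, Pi.smul_apply, e3, e4, chainZ_succ, smul_eq_mul]
  · refine Lp.ext ?_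
    have e1 := Lp.coeFn_add (z • ((X (k + 1)).2 : L2Space L)) ((X k).2 : L2Space L)
    have e2 := Lp.coeFn_smul z ((X (k + 1)).2 : L2Space L)
    filter_upwards [e1, e2, (hX (k + 1)).1, (hX (k + 1)).2, (hX k).2] with x e1 e2 e3 e4 e5
    change (z • ((X (k + 1)).2 : L2Space L) + ((X k).2 : L2Space L) : L2Space L) x = _
    rw [e1, Pi.add_apply, e2, Pi.smul_apply, e3, e4, e5, chainV_succ, smul_eq_mul]
  · rw [chainV_succ, chainW_apply_zero ha.1.le, chainW_apply_zero ha.1.le]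
    ring
  · rw [chainV_succ, h1, h2]
    ring

end Chain

/-! ### Algebraic multiplicities are orders of zeros of the characteristic function -/

section Multiplicity

variable {L a : ℝ} {α z : ℂ} {X : ℕ → EnergySpace L}

/-- The equation `(H_α - z) y = c X_n` has, apart from the boundary condition at `L`, only the
solutions `c X_{n+1} + d X_1`. -/
theorem exists_eq_of_mem_dampedWaveGraph (ha : a ∈ Ioo 0 L)
    (hX : ∀ k, (X k).1 =ᵐ[volume.restrict (Ioo 0 L)] chainV a α z k ∧
      ((X k).2 : L2Space L) =ᵐ[volume.restrict (Ioo 0 L)] chainW a α z k) {n : ℕ}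
    {y : EnergySpace L} {c : ℂ} (hy : (y, z • y + c • X n) ∈ dampedWaveGraph L a α) :
    ∃ d : ℂ, y = c • X (n + 1) + d • X 1 ∧
      c * chainW a α z (n + 1) L + d * chainW a α z 1 L = 0 := by
  obtain ⟨V, V', W, W', P, Q, W2, hV, hW, hW2, hVW, ⟨hV1, -, -⟩, ⟨hW1, hW0, hWL⟩, hl, hr, hj⟩ := hy
  dsimp only at hV hW hW2 hVW
  have hVcont := hV1.continuousOn
  have hWcont := hW1.continuousOn
  obtain ⟨W₁, hCW⟩ := isH1_chainW (α := α) (z := z) ha n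
  have hC := hCW.continuousOn
  -- The second component of the equation: `V = z W + c W_n`, first almost everywhere.
  have hVae : V =ᵐ[volume.restrict (Ioo 0 L)] fun x => z * W x + c * chainW a α z n x := by
    have e1 := Lp.coeFn_add (z • (y.2 : L2Space L)) (c • ((X n).2 : L2Space L))
    have e2 := Lp.coeFn_smul z (y.2 : L2Space L)
    have e3 := Lp.coeFn_smul c ((X n).2 : L2Space L)
    have e0 : y.1 = z • (y.2 : L2Space L) + c • ((X n).2 : L2Space L) := hVW.symm
    rw [← e0] at e1
    filter_upwards [hV, e1, e2, e3, hW, (hX n).2] with x hV e1 e2 e3 hW hXn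
    rw [← hV, e1, Pi.add_apply, e2, e3, Pi.smul_apply, Pi.smul_apply, hW, hXn]
    rfl
  have hVeq : EqOn V (fun x => z * W x + c * chainW a α z n x) (Icc 0 L) := by
    have h1 : EqOn V (fun x => z * W x + c * chainW a α z n x) (Ioo 0 L) :=
      Measure.eqOn_open_of_ae_eq hVae isOpen_Ioo (hVcont.mono Ioo_subset_Icc_self)
        (((continuousOn_const.mul hWcont).add (continuousOn_const.mul hC)).mono
          Ioo_subset_Icc_self)
    refine h1.of_subset_closure hVcont
      ((continuousOn_const.mul hWcont).add (continuousOn_const.mul hC)) Ioo_subset_Icc_self ?_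
    rw [closure_Ioo (ha.1.trans ha.2).ne]
  have hW2ae : W2 =ᵐ[volume.restrict (Ioo 0 L)] fun x => z * V x + c * chainV a α z n x := by
    have e1 := Lp.coeFn_add (z • y.1) (c • (X n).1)
    have e2 := Lp.coeFn_smul z y.1
    have e3 := Lp.coeFn_smul c (X n).1
    have e0 : (z • y + c • X n).1 = z • y.1 + c • (X n).1 := rfl
    rw [e0] at hW2
    filter_upwards [hV, e1, e2, e3, hW2, (hX n).1] with x hV e1 e2 e3 hW2 hXn
    rw [← hW2, e1, Pi.add_apply, e2, e3, Pi.smul_apply, Pi.smul_apply, hV, hXn]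
    rfl
  set d : ℂ := P 0 - c * chainP z (n + 1) 0 with hd
  have hode : (W2 - c • chainZ a α z (n + 1) - d • chainZ a α z 1) =ᵐ[volume.restrict (Ioo 0 L)]
      fun x => z ^ 2 * (W - c • chainW a α z (n + 1) - d • chainW a α z 1) x := by
    filter_upwards [hW2ae, self_mem_ae_restrict measurableSet_Ioo] with x h1 hx
    have h2 := hVeq (Ioo_subset_Icc_self hx)
    simp only [Pi.sub_apply, Pi.smul_apply, smul_eq_mul, h1, h2, chainZ_succ, chainV_succ]
    simp only [zero_add, chainV_zero, chainW_zero]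
    ring
  have hleft : IsH2 0 a (W - c • chainW a α z (n + 1) - d • chainW a α z 1)
      (P - c • chainP z (n + 1) - d • chainP z 1)
      (W2 - c • chainZ a α z (n + 1) - d • chainZ a α z 1) :=
    ⟨(hl.1.sub ((isH2_chain_left _).1.smul c)).sub ((isH2_chain_left _).1.smul d),
      (hl.2.sub ((isH2_chain_left _).2.smul c)).sub ((isH2_chain_left _).2.smul d)⟩
  have hright : IsH2 a L (W - c • chainW a α z (n + 1) - d • chainW a α z 1)
      (Q - c • chainQ a α z (n + 1) - d • chainQ a α z 1)
      (W2 - c • chainZ a α z (n + 1) - d • chainZ a α z 1) :=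
    ⟨(hr.1.sub ((isH2_chain_right _).1.smul c)).sub ((isH2_chain_right _).1.smul d),
      (hr.2.sub ((isH2_chain_right _).2.smul c)).sub ((isH2_chain_right _).2.smul d)⟩
  have z1 := hleft.eq_zero_of_initial (m := z ^ 2)
    (ae_restrict_of_ae_restrict_of_subset (Ioo_subset_Ioo_right ha.2.le) hode)
    (by simp [hW0, chainW_apply_zero ha.1.le]) (by simp [hd, chainP_one_zero])
  obtain ⟨za, zpa⟩ := z1 a ⟨ha.1.le, le_rfl⟩
  have z2 := hright.eq_zero_of_initial (m := z ^ 2)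
    (ae_restrict_of_ae_restrict_of_subset (Ioo_subset_Ioo_left ha.1.le) hode) za ?_
  · have hzero : ∀ x ∈ Icc 0 L, W x = c * chainW a α z (n + 1) x + d * chainW a α z 1 x := by
      intro x hx
      have h0 : (W - c • chainW a α z (n + 1) - d • chainW a α z 1) x = 0 := by
        rcases le_total x a with h | h
        · exact (z1 x ⟨hx.1, h⟩).1
        · exact (z2 x ⟨h, hx.2⟩).1
      simp only [Pi.sub_apply, Pi.smul_apply, smul_eq_mul] at h0
      linear_combination h0
    refine ⟨d, Prod.ext (Lp.ext ?_) (Subtype.ext (Lp.ext ?_)), ?_⟩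
    · have e1 := Lp.coeFn_add (c • (X (n + 1)).1) (d • (X 1).1)
      have e2 := Lp.coeFn_smul c (X (n + 1)).1
      have e3 := Lp.coeFn_smul d (X 1).1
      change _ =ᵐ[_] ((c • (X (n + 1)).1 + d • (X 1).1 : L2Space L) : ℝ → ℂ)
      filter_upwards [hV, e1, e2, e3, (hX (n + 1)).1, (hX 1).1,
        self_mem_ae_restrict measurableSet_Ioo] with x hV e1 e2 e3 h4 h5 hx
      have hx' := Ioo_subset_Icc_self hx
      have h6 := chainV_succ (a := a) (α := α) (z := z) 0 x
      simp only [zero_add, chainW_zero, add_zero] at h6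
      rw [e1, Pi.add_apply, e2, e3, Pi.smul_apply, Pi.smul_apply, hV, h4, h5, hVeq hx', smul_eq_mul,
        smul_eq_mul, chainV_succ, h6]
      simp only [hzero x hx']
      ring
    · have e1 := Lp.coeFn_add (c • ((X (n + 1)).2 : L2Space L)) (d • ((X 1).2 : L2Space L))
      have e2 := Lp.coeFn_smul c ((X (n + 1)).2 : L2Space L)
      have e3 := Lp.coeFn_smul d ((X 1).2 : L2Space L)
      change _ =ᵐ[_]
        ((c • ((X (n + 1)).2 : L2Space L) + d • ((X 1).2 : L2Space L) : L2Space L) : ℝ → ℂ)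
      filter_upwards [hW, e1, e2, e3, (hX (n + 1)).2, (hX 1).2,
        self_mem_ae_restrict measurableSet_Ioo] with x hW e1 e2 e3 h4 h5 hx
      rw [e1, Pi.add_apply, e2, e3, Pi.smul_apply, Pi.smul_apply, hW, h4, h5,
        hzero x (Ioo_subset_Icc_self hx)]
      rfl
    · rw [← hzero L ⟨(ha.1.trans ha.2).le, le_rfl⟩, hWL]
  · -- The jump conditions at `a` of the two functions agree.
    simp only [Pi.sub_apply, Pi.smul_apply, smul_eq_mul] at zpa za ⊢
    have k1 := chainQ_sub_chainP (a := a) (α := α) (z := z) (n + 1)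
    have k2 := chainQ_sub_chainP (a := a) (α := α) (z := z) 1
    have k3 := hVeq (show a ∈ Icc 0 L from ⟨ha.1.le, ha.2.le⟩)
    have k4 := chainV_succ (a := a) (α := α) (z := z) n a
    have k5 := chainV_succ (a := a) (α := α) (z := z) 0 a
    simp only [zero_add, chainW_zero, add_zero] at k5
    simp only at k3
    rw [k4] at k1
    rw [k5] at k2
    rw [k3] at hj
    linear_combination hj + zpa - c * k1 - d * k2 + α * z * za

theorem chain_one_ne_zero (ha : a ∈ Ioo 0 L)
    (hX : ((X 1).2 : L2Space L) =ᵐ[volume.restrict (Ioo 0 L)] chainW a α z 1) : X 1 ≠ 0 := by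
  intro h
  rw [h] at hX
  have h1 : chainW a α z 1 =ᵐ[volume.restrict (Ioo 0 a)] 0 :=
    ae_restrict_of_ae_restrict_of_subset (Ioo_subset_Ioo_right ha.2.le)
      (hX.symm.trans (Lp.coeFn_zero _ _ _))
  have h2 := isH2_chain_left (a := a) (α := α) (z := z) 1
  have h3 : EqOn (chainP z 1) 0 (Ioo 0 a) :=
    Measure.eqOn_open_of_ae_eq (h2.1.eq_zero h1) isOpen_Ioo
      (h2.2.continuousOn.mono Ioo_subset_Icc_self) continuousOn_const
  have h4 : EqOn (chainP z 1) 0 (Icc 0 a) :=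
    h3.of_subset_closure h2.2.continuousOn continuousOn_const Ioo_subset_Icc_self
      (closure_Ioo ha.1.ne).ge
  have h5 := h4 ⟨le_rfl, ha.1.le⟩
  rw [chainP_one_zero] at h5
  exact one_ne_zero h5

theorem differentiable_dampedCharFun (L a : ℝ) (α : ℂ) : Differentiable ℂ (dampedCharFun L a α) :=
  differentiable_shooting a α L

theorem dampedCharFun_zero (ha : a ∈ Ioo 0 L) (α : ℂ) : dampedCharFun L a α 0 = L := by
  rw [dampedCharFun, shooting_of_ge ha.2.le]
  simp [sinhDiv_zero_left]

theorem analyticOrderAt_dampedCharFun_ne_top (ha : a ∈ Ioo 0 L) (α z : ℂ) :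
    analyticOrderAt (dampedCharFun L a α) z ≠ ⊤ := by
  refine (differentiable_dampedCharFun L a α).analyticOrderAt_ne_top ?_ z
  rw [dampedCharFun_zero ha]
  exact_mod_cast (ha.1.trans ha.2).ne'

/-- The algebraic multiplicity of `z` as an eigenvalue of `H_α` is the order of `z` as a zero of the
characteristic function. -/
theorem algMultiplicity_dampedWaveOp (ha : a ∈ Ioo 0 L) (α z : ℂ) :
    algMultiplicity (dampedWaveOp L a α) z = analyticOrderAt (dampedCharFun L a α) z := by
  obtain ⟨X, hX⟩ := exists_chain ha α z
  obtain ⟨N, hN⟩ := ENat.ne_top_iff_exists.1 (analyticOrderAt_dampedCharFun_ne_top ha α z)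
  obtain ⟨g, hg, hGg, hgz⟩ :=
    exists_differentiable_eq_pow_mul N (differentiable_dampedCharFun L a α) hN.symm
  have hcoeff : ∀ k, chainW a α z k L = circleCoeff z k fun ζ => (ζ - z) ^ N * g ζ := by
    intro k
    exact circleCoeff_congr fun ζ _ => hGg ζ
  have hle : ∀ k ≤ N, chainW a α z k L = 0 := fun k hk => by
    rw [hcoeff, circleCoeff_eq_zero_of_le hk hg]
  have hne : chainW a α z (N + 1) L ≠ 0 := by
    rwa [hcoeff, circleCoeff_succ_pow_mul N hg]
  have h0 := chain_zero hX
  rw [← hN]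
  rcases N with _ | M
  · refine algMultiplicity_eq_zero fun y hy => ?_
    rw [dampedWaveOp_graph ha] at hy
    obtain ⟨d, hd1, hd2⟩ := exists_eq_of_mem_dampedWaveGraph (n := 0) (c := 0) ha hX (by simpa using hy)
    rw [zero_mul, zero_add] at hd2
    rcases mul_eq_zero.1 hd2 with h | h
    · simpa [h] using hd1
    · exact absurd h hne
  · refine algMultiplicity_eq_of_chain h0 (chain_one_ne_zero ha (hX 1).2) (fun k hk => ?_)
      fun y c hy => ?_
    · rw [dampedWaveOp_graph ha]
      exact chain_mem_graph ha hX (hle _ (by omega)) (hle _ (by omega))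
    · rw [dampedWaveOp_graph ha] at hy
      obtain ⟨d, hd1, hd2⟩ := exists_eq_of_mem_dampedWaveGraph ha hX hy
      rw [hle 1 (by omega), mul_zero, add_zero] at hd2
      have hc : c = 0 := (mul_eq_zero.1 hd2).resolve_right hne
      exact ⟨d, by simpa [hc] using hd1⟩

theorem isEigenvalue_dampedWaveOp_iff (ha : a ∈ Ioo 0 L) (α z : ℂ) :
    IsEigenvalue (dampedWaveOp L a α) z ↔ dampedCharFun L a α z = 0 := by
  obtain ⟨X, hX⟩ := exists_chain ha α z
  have hG : dampedCharFun L a α z = chainW a α z 1 L :=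
    (circleCoeff_one (differentiable_dampedCharFun L a α)).symm
  rw [isEigenvalue_iff_graph, dampedWaveOp_graph ha, hG]
  constructor
  · rintro ⟨y, hy0, hy⟩
    obtain ⟨d, hd1, hd2⟩ := exists_eq_of_mem_dampedWaveGraph (n := 0) (c := 0) ha hX (by simpa using hy)
    rw [zero_mul, zero_add] at hd2
    refine (mul_eq_zero.1 hd2).resolve_left fun h => hy0 ?_
    simpa [h] using hd1
  · intro h
    refine ⟨X 1, chain_one_ne_zero ha (hX 1).2, ?_⟩
    have := chain_mem_graph (k := 0) ha hX h (chainW_zero L)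
    simpa [chain_zero hX] using this

end Multiplicity

/-! ### Exponential sums -/

/-- The exponential sum `K + ∑ c_i e^{-b_i z}` with real frequencies `b_i`. -/
noncomputable def expSum {ι : Type*} [Fintype ι] (K : ℂ) (c : ι → ℂ) (b : ι → ℝ) (z : ℂ) : ℂ :=
  K + ∑ i, c i * Complex.exp (-(b i * z))

section ExpSum

variable {ι : Type*} [Fintype ι] {K : ℂ} {c : ι → ℂ} {b : ι → ℝ}

theorem hasDerivAt_expSum (K : ℂ) (c : ι → ℂ) (b : ι → ℝ) (z : ℂ) :
    HasDerivAt (expSum K c b) (expSum 0 (fun i => -(b i * c i)) b z) z := by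
  unfold expSum
  rw [zero_add]
  refine HasDerivAt.const_add _ (HasDerivAt.fun_sum fun i _ => ?_)
  have h := ((((hasDerivAt_id z).const_mul (b i : ℂ)).neg).cexp).const_mul (c i)
  refine h.congr_deriv ?_
  simp
  ring

theorem deriv_expSum (K : ℂ) (c : ι → ℂ) (b : ι → ℝ) :
    deriv (expSum K c b) = expSum 0 (fun i => -(b i * c i)) b :=
  funext fun z => (hasDerivAt_expSum K c b z).deriv

theorem norm_expSum_sub_le {r : ℝ} (z : ℂ) (hr : ∀ i, r ≤ b i * z.re) :
    ‖expSum K c b z - K‖ ≤ (∑ i, ‖c i‖) * Real.exp (-r) := by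
  rw [expSum, add_sub_cancel_left, Finset.sum_mul]
  refine norm_sum_le_of_le _ fun i _ => ?_
  rw [norm_mul, Complex.norm_exp]
  gcongr
  simpa using hr i

theorem isBigO_expSum_zero {u : ℂ} {δ : ℝ} (hδ : ∀ i, δ ≤ b i * u.re) :
    (fun t : ℝ => expSum 0 c b (t * u)) =O[atTop] fun t => Real.exp (-δ * t) := by
  refine Asymptotics.IsBigO.of_bound (∑ i, ‖c i‖) ?_
  filter_upwards [eventually_ge_atTop 0] with t ht
  have h := norm_expSum_sub_le (K := 0) (c := c) (b := b) (r := δ * t) (t * u) fun i => by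
    rw [Complex.re_ofReal_mul]
    nlinarith [hδ i]
  rw [sub_zero] at h
  rwa [Real.norm_of_nonneg (Real.exp_pos _).le, neg_mul]

theorem tendsto_expSum {u : ℂ} {δ : ℝ} (hδ0 : 0 < δ) (hδ : ∀ i, δ ≤ b i * u.re) :
    Tendsto (fun t : ℝ => expSum K c b (t * u)) atTop (𝓝 K) := by
  have h1 : Tendsto (fun t : ℝ => Real.exp (-δ * t)) atTop (𝓝 0) := by
    refine Real.tendsto_exp_atBot.comp ?_
    exact tendsto_id.const_mul_atTop_of_neg (by linarith)
  have h2 := (isBigO_expSum_zero (c := c) hδ).trans_tendsto h1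
  have h3 : ∀ z, expSum K c b z = K + expSum 0 c b z := fun z => by simp [expSum]
  simpa [h3] using h2.const_add K

/-- An exponential sum with nonzero constant term and positive frequencies has no zeros in some right
half-plane. -/
theorem exists_expSum_ne_zero (hK : K ≠ 0) (hb : ∀ i, 0 < b i) :
    ∃ M : ℝ, ∀ z : ℂ, M < z.re → expSum K c b z ≠ 0 := by
  rcases isEmpty_or_nonempty ι with h | h
  · exact ⟨0, fun z _ => by simpa [expSum] using hK⟩
  obtain ⟨i₀, hi₀⟩ := Finite.exists_min b
  have h1 : Tendsto (fun x : ℝ => (∑ i, ‖c i‖) * Real.exp (-(b i₀ * x))) atTop (𝓝 0) := by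
    have h2 : Tendsto (fun x : ℝ => Real.exp (-(b i₀ * x))) atTop (𝓝 0) :=
      Real.tendsto_exp_neg_atTop_nhds_zero.comp (tendsto_id.const_mul_atTop (hb i₀))
    simpa using h2.const_mul (∑ i, ‖c i‖)
  obtain ⟨M, hM⟩ := eventually_atTop.1
    ((h1.eventually_lt_const (norm_pos_iff.2 hK)).and (eventually_ge_atTop 0))
  refine ⟨M, fun z hz h0 => ?_⟩
  obtain ⟨h3, h4⟩ := hM z.re hz.le
  have h5 := norm_expSum_sub_le (K := K) (c := c) (b := b) (r := b i₀ * z.re) z fun i =>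
    mul_le_mul_of_nonneg_right (hi₀ i) h4
  rw [h0, zero_sub, norm_neg] at h5
  exact absurd h3 (not_lt.2 h5)

end ExpSum

/-! ### Zeros in a strip and rays through the origin -/

/-- A given point lies in no narrow sector around the positive half-line, unless it lies on the
half-line itself. -/
theorem eventually_ne_polar (w : ℂ) : ∀ᶠ ε in 𝓝[>] (0 : ℝ), ∀ τ : ℝ, τ ≠ 0 → |τ| ≤ ε →
    ∀ r : ℝ, 0 < r → w ≠ r * Complex.exp (τ * Complex.I) := by
  have h1 : ∀ᶠ ε in 𝓝[>] (0 : ℝ), ε < Real.pi := by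
    exact Filter.Eventually.filter_mono nhdsWithin_le_nhds (eventually_lt_nhds Real.pi_pos)
  have h2 : ∀ᶠ ε in 𝓝[>] (0 : ℝ), w.arg ≠ 0 → ε < |w.arg| := by
    by_cases h : w.arg = 0
    · exact Eventually.of_forall fun ε h' => absurd h h'
    · have : ∀ᶠ ε in 𝓝[>] (0 : ℝ), ε < |w.arg| :=
        Filter.Eventually.filter_mono nhdsWithin_le_nhds (eventually_lt_nhds (abs_pos.2 h))
      exact this.mono fun ε hε _ => hε
  filter_upwards [h1, h2] with ε h1 h2 τ hτ hτε r hr hw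
  have h3 : w.arg = τ := by
    rw [hw, Complex.exp_mul_I]
    exact Complex.arg_mul_cos_add_sin_mul_I hr
      ⟨by linarith [neg_abs_le τ], by linarith [le_abs_self τ]⟩
  rw [h3] at h2
  exact absurd (h2 hτ) (not_lt.2 hτε)

section Strip

variable {G : ℂ → ℂ} {M : ℝ}

/-- If the zeros of an entire function lie in a vertical strip, all sufficiently narrow sectors
around a real half-axis contain no zeros off that half-axis. -/
theorem exists_sector_ne_zero (hG : Differentiable ℂ G) (h0 : G 0 ≠ 0)
    (hM : ∀ z, G z = 0 → |z.re| ≤ M) {c : ℂ} (hc : c = 1 ∨ c = -1) :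
    ∃ ε ∈ Ioo 0 (Real.pi / 2), ∀ τ : ℝ, τ ≠ 0 → |τ| ≤ ε → ∀ r : ℝ, 0 < r →
      G (c * (r * Complex.exp (τ * Complex.I))) ≠ 0 := by
  have hfin := hG.finite_zeros_norm_le h0 (2 * M)
  have h1 := (hfin.eventually_all (l := 𝓝[>] (0 : ℝ))
    (p := fun z ε => ∀ τ : ℝ, τ ≠ 0 → |τ| ≤ ε → ∀ r : ℝ, 0 < r →
      c * z ≠ r * Complex.exp (τ * Complex.I))).2 fun z _ => eventually_ne_polar (c * z)
  have hpi := Real.pi_pos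
  have h2 : ∀ᶠ ε in 𝓝[>] (0 : ℝ), ε ∈ Ioo 0 (Real.pi / 3) := Ioo_mem_nhdsGT (by positivity)
  obtain ⟨ε, h3, h4⟩ := (h1.and h2).exists
  refine ⟨ε, ⟨h4.1, by linarith [h4.2]⟩, fun τ hτ hτε r hr hz => ?_⟩
  have hcc : c * c = 1 := by rcases hc with rfl | rfl <;> norm_num
  have hcn : ‖c‖ = 1 := by rcases hc with rfl | rfl <;> simp
  refine h3 _ ⟨?_, hz⟩ τ hτ hτε r hr (by rw [← mul_assoc, hcc, one_mul])
  -- On the sector `|z| ≤ 2 |Re z|`, since `cos τ ≥ 1 / 2`.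
  have h5 : ‖c * (r * Complex.exp (τ * Complex.I))‖ = r := by
    rw [norm_mul, norm_mul, hcn, Complex.norm_exp_ofReal_mul_I, Complex.norm_real,
      Real.norm_of_nonneg hr.le]
    ring
  have h6 : |(c * (r * Complex.exp (τ * Complex.I))).re| = r * Real.cos τ := by
    have h7 : 0 ≤ Real.cos τ := Real.cos_nonneg_of_mem_Icc
      ⟨by linarith [neg_abs_le τ, h4.2], by linarith [le_abs_self τ, h4.2]⟩
    have h8 : (r * Complex.exp (τ * Complex.I)).re = r * Real.cos τ := by
      rw [Complex.re_ofReal_mul, Complex.exp_ofReal_mul_I_re]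
    rcases hc with rfl | rfl
    · rw [one_mul, h8, abs_of_nonneg (by positivity)]
    · rw [neg_one_mul, Complex.neg_re, abs_neg, h8, abs_of_nonneg (by positivity)]
  have h9 : 1 / 2 ≤ Real.cos τ := by
    rw [← Real.cos_pi_div_three, ← Real.cos_abs τ]
    exact Real.cos_le_cos_of_nonneg_of_le_pi (abs_nonneg _) (by linarith)
      (hτε.trans h4.2.le)
  have h10 := hM _ hz
  rw [h6] at h10
  rw [h5]
  nlinarith

/-- If the zeros of an entire function lie in a vertical strip and avoid a ray that is not vertical,
they avoid a cone around the ray. -/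
theorem exists_re_div_le_mul_norm (hG : Differentiable ℂ G) (h0 : G 0 ≠ 0)
    (hM : ∀ z, G z = 0 → |z.re| ≤ M) {u : ℂ} (hu : ‖u‖ = 1) (hre : u.re ≠ 0)
    (hray : ∀ t : ℝ, 0 ≤ t → G (t * u) ≠ 0) :
    ∃ k : ℝ, 0 ≤ k ∧ k < 1 ∧ ∀ z, G z = 0 → (z / u).re ≤ k * ‖z‖ := by
  have hu0 : u ≠ 0 := by rw [← norm_ne_zero_iff, hu]; exact one_ne_zero
  have hsq : u.re ^ 2 + u.im ^ 2 = 1 := by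
    rw [← one_pow 2, ← hu, ← Complex.normSq_eq_norm_sq, Complex.normSq_apply]
    ring
  have him : |u.im| < 1 := by
    rw [← sq_lt_one_iff_abs_lt_one]
    linarith [pow_pos (abs_pos.2 hre) 2, sq_abs u.re]
  have hre1 : |u.re| ≤ 1 := hu ▸ Complex.abs_re_le_norm u
  have hdiv : ∀ z, (z / u).re = z.re * u.re + z.im * u.im := fun z => by
    rw [Complex.div_re, Complex.normSq_eq_norm_sq, hu]
    ring
  have hstrict : ∀ z, G z = 0 → (z / u).re < ‖z‖ := by
    intro z hz
    have h1 : ‖z / u‖ = ‖z‖ := by rw [norm_div, hu, div_one]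
    rw [← h1]
    refine lt_of_le_of_ne (Complex.re_le_norm _) fun h => ?_
    have h2 : z = (‖z‖ : ℝ) * u := by
      have h3 := Complex.eq_coe_norm_of_nonneg (Complex.re_eq_norm.1 h)
      rw [h1, div_eq_iff hu0] at h3
      exact h3
    rw [h2] at hz
    exact hray _ (norm_nonneg z) hz
  set R := 2 * M / (1 - |u.im|) with hR
  have hfin := hG.finite_zeros_norm_le h0 R
  have e1 : ∀ᶠ k in 𝓝[<] (1 : ℝ), ∀ z ∈ {z | ‖z‖ ≤ R ∧ G z = 0}, (z / u).re ≤ k * ‖z‖ := by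
    refine hfin.eventually_all.2 fun z hz => ?_
    have hlim : Tendsto (fun k : ℝ => k * ‖z‖) (𝓝[<] 1) (𝓝 (1 * ‖z‖)) :=
      ((continuous_id.mul continuous_const).tendsto 1).mono_left nhdsWithin_le_nhds
    rw [one_mul] at hlim
    exact (hlim.eventually_const_lt (hstrict z hz.2)).mono fun k hk => hk.le
  have e2 : ∀ᶠ k in 𝓝[<] (1 : ℝ), k ∈ Ioo ((1 + |u.im|) / 2) 1 := Ioo_mem_nhdsLT (by linarith)
  obtain ⟨k, h1, h2⟩ := (e1.and e2).exists
  refine ⟨k, by linarith [h2.1, abs_nonneg u.im], h2.2, fun z hz => ?_⟩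
  rcases le_or_gt ‖z‖ R with h | h
  · exact h1 z ⟨h, hz⟩
  · rw [hR, div_lt_iff₀ (by linarith)] at h
    rw [hdiv]
    have h3 : z.re * u.re ≤ M := by
      refine (le_abs_self _).trans ?_
      rw [abs_mul]
      nlinarith [hM z hz, abs_nonneg z.re, abs_nonneg u.re]
    have h4 : z.im * u.im ≤ ‖z‖ * |u.im| := by
      refine (le_abs_self _).trans ?_
      rw [abs_mul]
      exact mul_le_mul_of_nonneg_right (Complex.abs_im_le_norm z) (abs_nonneg _)
    nlinarith [h2.1, norm_nonneg z]

end Strip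

/-! ### Asymptotics and growth of the characteristic function -/

section CharFun

variable {L a : ℝ} {α : ℂ}

theorem mul_dampedCharFun (ha : a ∈ Ioo 0 L) (α z : ℂ) : z * dampedCharFun L a α z =
    Complex.sinh (z * L) + α * Complex.sinh (z * a) * Complex.sinh (z * (L - a : ℝ)) := by
  rw [dampedCharFun, mul_shooting, max_eq_left (by linarith [ha.2])]

/-- The factor `E` in `z * dampedCharFun L a α z = e^{σ L z} E(z)`, which tends to `(α + 2 σ) / 4` as
`σ Re z → ∞`. -/
noncomputable def dampedFactor (L a : ℝ) (α : ℂ) (σ : ℝ) : ℂ → ℂ :=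
  expSum ((α + 2 * σ) / 4) ![(α - 2 * σ) / 4, -(α / 4), -(α / 4)]
    fun i => σ * ![2 * L, 2 * a, 2 * (L - a)] i

theorem mul_dampedCharFun_eq_exp_mul (ha : a ∈ Ioo 0 L) (α : ℂ) {σ : ℝ} (hσ : σ = 1 ∨ σ = -1)
    (z : ℂ) : z * dampedCharFun L a α z =
      Complex.exp ((σ * L : ℝ) * z) * dampedFactor L a α σ z := by
  have e1 : ∀ x : ℝ, Complex.exp (-(z * x)) = (Complex.exp (z * x))⁻¹ := fun x => Complex.exp_neg _
  have hL : Complex.exp (z * L) = Complex.exp (z * a) * Complex.exp (z * (L - a : ℝ)) := by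
    rw [← Complex.exp_add]
    congr 1
    push_cast
    ring
  have h1 := Complex.exp_ne_zero (z * a)
  have h2 := Complex.exp_ne_zero (z * (L - a : ℝ))
  have d : ∀ x : ℝ, Complex.exp (-(((2 * x : ℝ) : ℂ) * z)) = (Complex.exp (z * x))⁻¹ ^ 2 := fun x => by
    rw [← Complex.exp_neg, ← Complex.exp_nat_mul]
    congr 1
    push_cast
    ring
  have d' : ∀ x : ℝ, Complex.exp (-(((-(2 * x) : ℝ) : ℂ) * z)) = Complex.exp (z * x) ^ 2 := fun x => by
    rw [← Complex.exp_nat_mul]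
    congr 1
    push_cast
    ring
  have hE : dampedFactor L a α σ z = (α + 2 * σ) / 4 +
      ((α - 2 * σ) / 4 * Complex.exp (-((σ * (2 * L) : ℝ) * z)) +
        -(α / 4) * Complex.exp (-((σ * (2 * a) : ℝ) * z)) +
        -(α / 4) * Complex.exp (-((σ * (2 * (L - a)) : ℝ) * z))) := by
    rw [dampedFactor, expSum, Fin.sum_univ_three]
    rfl
  rw [mul_dampedCharFun ha, hE]
  rcases hσ with rfl | rfl
  · have h3 : Complex.exp (((1 * L : ℝ) : ℂ) * z) = Complex.exp (z * L) := by
      rw [one_mul, mul_comm]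
    rw [h3]
    simp only [one_mul, d, Complex.sinh, e1]
    rw [hL]
    generalize Complex.exp (z * a) = x at h1 ⊢
    generalize Complex.exp (z * (L - a : ℝ)) = y at h2 ⊢
    push_cast
    field_simp
    ring
  · have h3 : Complex.exp (((-1 * L : ℝ) : ℂ) * z) = (Complex.exp (z * L))⁻¹ := by
      rw [← e1]
      congr 1
      push_cast
      ring
    rw [h3]
    simp only [neg_one_mul, d', Complex.sinh, e1]
    rw [hL]
    generalize Complex.exp (z * a) = x at h1 ⊢
    generalize Complex.exp (z * (L - a : ℝ)) = y at h2 ⊢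
    push_cast
    field_simp
    ring

theorem norm_exp_le_of_norm_le {w : ℂ} {r : ℝ} (h : ‖w‖ ≤ r) : ‖Complex.exp w‖ ≤ Real.exp r := by
  rw [Complex.norm_exp]
  exact Real.exp_le_exp.2 ((Complex.re_le_norm w).trans h)

theorem norm_sinh_le_of_norm_le {w : ℂ} {r : ℝ} (h : ‖w‖ ≤ r) : ‖Complex.sinh w‖ ≤ Real.exp r := by
  rw [Complex.sinh, norm_div, Complex.norm_ofNat, div_le_iff₀ two_pos]
  refine (norm_sub_le _ _).trans ?_
  linarith [norm_exp_le_of_norm_le h, norm_exp_le_of_norm_le ((norm_neg w).trans_le h)]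

theorem norm_cosh_le_of_norm_le {w : ℂ} {r : ℝ} (h : ‖w‖ ≤ r) : ‖Complex.cosh w‖ ≤ Real.exp r := by
  rw [Complex.cosh, norm_div, Complex.norm_ofNat, div_le_iff₀ two_pos]
  refine (norm_add_le _ _).trans ?_
  linarith [norm_exp_le_of_norm_le h, norm_exp_le_of_norm_le ((norm_neg w).trans_le h)]

theorem norm_sinhDiv_le {x : ℝ} (hx : 0 ≤ x) (ζ : ℂ) : ‖sinhDiv ζ x‖ ≤ x * Real.exp (x * ‖ζ‖) := by
  rw [sinhDiv_eq_add_integral ζ 0 x, sinhDiv_zero_right, zero_add]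
  have h := intervalIntegral.norm_integral_le_of_norm_le_const (a := (0 : ℝ)) (b := x)
    (f := fun t : ℝ => Complex.cosh (ζ * t)) (C := Real.exp (x * ‖ζ‖)) fun t ht => by
      rw [uIoc_of_le hx] at ht
      refine norm_cosh_le_of_norm_le ?_
      rw [norm_mul, Complex.norm_real, Real.norm_of_nonneg ht.1.le, mul_comm]
      exact mul_le_mul_of_nonneg_right ht.2 (norm_nonneg _)
  rwa [sub_zero, abs_of_nonneg hx, mul_comm] at h

theorem norm_dampedCharFun_le (ha : a ∈ Ioo 0 L) (α z : ℂ) :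
    ‖dampedCharFun L a α z‖ ≤ (L + ‖α‖ * L) * Real.exp (L * ‖z‖) := by
  have hL : 0 ≤ L := (ha.1.trans ha.2).le
  rw [dampedCharFun, shooting_of_ge ha.2.le, add_mul]
  refine norm_add_le_of_le (norm_sinhDiv_le hL z) ?_
  have h1 : ‖Complex.sinh (z * a)‖ ≤ Real.exp (a * ‖z‖) := by
    refine norm_sinh_le_of_norm_le ?_
    rw [norm_mul, Complex.norm_real, Real.norm_of_nonneg ha.1.le, mul_comm]
  have h2 := norm_sinhDiv_le (sub_nonneg.2 ha.2.le) z
  have h3 : Real.exp (L * ‖z‖) = Real.exp (a * ‖z‖) * Real.exp ((L - a) * ‖z‖) := by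
    rw [← Real.exp_add]
    congr 1
    ring
  rw [norm_mul, norm_mul, h3]
  calc ‖α‖ * ‖Complex.sinh (z * a)‖ * ‖sinhDiv z (L - a)‖
      ≤ ‖α‖ * Real.exp (a * ‖z‖) * ((L - a) * Real.exp ((L - a) * ‖z‖)) := by gcongr
    _ ≤ ‖α‖ * Real.exp (a * ‖z‖) * (L * Real.exp ((L - a) * ‖z‖)) := by
        gcongr
        linarith [ha.1]
    _ = _ := by ring

/-- The eigenvalues of `H_α` lie in a vertical strip. -/
theorem exists_abs_re_le_of_dampedCharFun_eq_zero (ha : a ∈ Ioo 0 L) (hα : α ≠ 2) (hα' : α ≠ -2) :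
    ∃ M : ℝ, ∀ z, dampedCharFun L a α z = 0 → |z.re| ≤ M := by
  have hb : ∀ i, 0 < ![2 * L, 2 * a, 2 * (L - a)] i := by
    have h1 := ha.1
    have h2 := ha.2
    intro i
    fin_cases i <;> simp <;> linarith
  have hzero : ∀ σ : ℝ, (σ = 1 ∨ σ = -1) → ∀ z, dampedCharFun L a α z = 0 →
      dampedFactor L a α σ z = 0 := by
    intro σ hσ z hz
    have h := mul_dampedCharFun_eq_exp_mul ha α hσ z
    rw [hz, mul_zero, eq_comm] at h
    exact (mul_eq_zero.1 h).resolve_left (Complex.exp_ne_zero _)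
  have key : ∀ σ : ℝ, (σ = 1 ∨ σ = -1) → α + 2 * σ ≠ 0 →
      ∃ M : ℝ, ∀ z, dampedCharFun L a α z = 0 → σ * z.re ≤ M := by
    intro σ hσ hK
    obtain ⟨M, hM⟩ := exists_expSum_ne_zero (K := (α + 2 * σ) / 4)
      (c := ![(α - 2 * σ) / 4, -(α / 4), -(α / 4)]) (div_ne_zero hK (by norm_num)) hb
    refine ⟨M, fun z hz => not_lt.1 fun h => hM (σ * z) (by rwa [Complex.re_ofReal_mul]) ?_⟩
    rw [← hzero σ hσ z hz, dampedFactor, expSum, expSum]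
    congr 1
    refine Finset.sum_congr rfl fun i _ => ?_
    congr 3
    push_cast
    ring
  obtain ⟨M₁, h1⟩ := key 1 (Or.inl rfl) fun h => hα' (by push_cast at h; linear_combination h)
  obtain ⟨M₂, h2⟩ := key (-1) (Or.inr rfl) fun h => hα (by push_cast at h; linear_combination h)
  refine ⟨max M₁ M₂, fun z hz => abs_le'.2 ⟨?_, ?_⟩⟩
  · exact le_max_of_le_left (by simpa using h1 z hz)
  · exact le_max_of_le_right (by simpa using h2 z hz)

theorem exists_rayAsymptotics_dampedCharFun (ha : a ∈ Ioo 0 L) {σ : ℝ} (hσ : σ = 1 ∨ σ = -1)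
    (hK : α + 2 * σ ≠ 0) {u : ℂ} (hu : ‖u‖ = 1) (hre : 0 < σ * u.re)
    (hray : ∀ t : ℝ, 0 ≤ t → dampedCharFun L a α (t * u) ≠ 0) :
    ∃ δ, RayAsymptotics (dampedCharFun L a α) (dampedFactor L a α σ) u (σ * L : ℝ)
      ((α + 2 * σ) / 4) δ := by
  have hb : ∀ i, 0 < σ * ![2 * L, 2 * a, 2 * (L - a)] i * u.re := by
    have h1 := ha.1
    have h2 := ha.2
    intro i
    rw [mul_right_comm]
    refine mul_pos hre ?_
    fin_cases i <;> simp <;> linarith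
  obtain ⟨i₀, hi₀⟩ := Finite.exists_min fun i => σ * ![2 * L, 2 * a, 2 * (L - a)] i * u.re
  refine ⟨_, differentiable_dampedCharFun L a α, fun z => (hasDerivAt_expSum _ _ _ z).differentiableAt,
    hu, hray, mul_dampedCharFun_eq_exp_mul ha α hσ, tendsto_expSum (hb i₀) hi₀,
    div_ne_zero hK (by norm_num), hb i₀, ?_, ?_⟩
  · rw [dampedFactor, deriv_expSum]
    exact isBigO_expSum_zero hi₀
  · rw [dampedFactor, deriv_expSum, deriv_expSum]
    exact isBigO_expSum_zero hi₀

/-- The spectral determinant of `H_α` does not depend on `a`: it is `-4 L / (α + 2 σ)`, where `σ` is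
the sign of the real part of the direction of the cut. -/
theorem hasSpectralDet_dampedWaveOp_iff (ha : a ∈ Ioo 0 L) (hα : α ≠ 2) (hα' : α ≠ -2) {σ θ : ℝ}
    (hσ : σ = 1 ∨ σ = -1) (hre : 0 < σ * Real.cos θ)
    (hray : ∀ r : ℝ, 0 < r →
      ¬ IsEigenvalue (dampedWaveOp L a α) (r * Complex.exp (θ * Complex.I))) {D : ℂ} :
    HasSpectralDet (dampedWaveOp L a α) θ D ↔ D = -(L / ((α + 2 * σ) / 4)) := by
  have hG := differentiable_dampedCharFun L a α
  have h0 : dampedCharFun L a α 0 ≠ 0 := by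
    rw [dampedCharFun_zero ha]
    exact_mod_cast (ha.1.trans ha.2).ne'
  have hray' : ∀ t : ℝ, 0 ≤ t → dampedCharFun L a α (t * Complex.exp (θ * Complex.I)) ≠ 0 := by
    intro t ht
    rcases ht.eq_or_lt with rfl | ht
    · simpa using h0
    · exact fun h => hray t ht ((isEigenvalue_dampedWaveOp_iff ha α _).2 h)
  have hK : α + 2 * σ ≠ 0 := by
    rcases hσ with rfl | rfl
    · exact fun h => hα' (by push_cast at h; linear_combination h)
    · exact fun h => hα (by push_cast at h; linear_combination h)
  have hnorm := Complex.norm_exp_ofReal_mul_I θ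
  have hcos := Complex.exp_ofReal_mul_I_re θ
  obtain ⟨M, hM⟩ := exists_abs_re_le_of_dampedCharFun_eq_zero ha hα hα'
  obtain ⟨k, hk0, hk1, hk⟩ := exists_re_div_le_mul_norm hG h0 hM hnorm
    (by rw [hcos]; exact right_ne_zero_of_mul hre.ne') hray'
  obtain ⟨δ, hδ⟩ := exists_rayAsymptotics_dampedCharFun ha hσ hK hnorm (by rwa [hcos]) hray'
  rw [hasSpectralDet_iff (algMultiplicity_dampedWaveOp ha α) hδ (norm_dampedCharFun_le ha α)
    (ha.1.trans ha.2).le hk0 hk1 hk, dampedCharFun_zero ha]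

theorem exists_isCutBelowNegAxis (ha : a ∈ Ioo 0 L) (hα : α ≠ 2) (hα' : α ≠ -2) :
    ∃ ε, IsCutBelowNegAxis (dampedWaveOp L a α) ε := by
  have h0 : dampedCharFun L a α 0 ≠ 0 := by
    rw [dampedCharFun_zero ha]
    exact_mod_cast (ha.1.trans ha.2).ne'
  obtain ⟨M, hM⟩ := exists_abs_re_le_of_dampedCharFun_eq_zero ha hα hα'
  obtain ⟨ε, hε, h⟩ :=
    exists_sector_ne_zero (differentiable_dampedCharFun L a α) h0 hM (Or.inr rfl)
  refine ⟨ε, hε, fun φ hφ r hr hz => ?_⟩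
  rw [isEigenvalue_dampedWaveOp_iff ha] at hz
  refine h (φ - Real.pi) (sub_ne_zero.2 hφ.1.ne') ?_ r hr ?_
  · rw [abs_of_pos (sub_pos.2 hφ.1)]
    linarith [hφ.2]
  · convert hz using 2
    rw [show ((φ - Real.pi : ℝ) : ℂ) * Complex.I = φ * Complex.I - Real.pi * Complex.I by
      push_cast; ring, Complex.exp_sub, Complex.exp_pi_mul_I]
    ring

theorem exists_isCutBelowPosAxis (ha : a ∈ Ioo 0 L) (hα : α ≠ 2) (hα' : α ≠ -2) :
    ∃ ε, IsCutBelowPosAxis (dampedWaveOp L a α) ε := by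
  have h0 : dampedCharFun L a α 0 ≠ 0 := by
    rw [dampedCharFun_zero ha]
    exact_mod_cast (ha.1.trans ha.2).ne'
  obtain ⟨M, hM⟩ := exists_abs_re_le_of_dampedCharFun_eq_zero ha hα hα'
  obtain ⟨ε, hε, h⟩ :=
    exists_sector_ne_zero (differentiable_dampedCharFun L a α) h0 hM (Or.inl rfl)
  refine ⟨ε, hε, fun φ hφ r hr hz => ?_⟩
  rw [isEigenvalue_dampedWaveOp_iff ha] at hz
  refine h φ hφ.2.ne ?_ r hr (by rwa [one_mul])
  rw [abs_of_neg hφ.2]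
  linarith [hφ.1]

theorem hasSpectralDet_of_isCutBelowNegAxis (ha : a ∈ Ioo 0 L) (hα : α ≠ 2) (hα' : α ≠ -2) {ε : ℝ}
    (hε : IsCutBelowNegAxis (dampedWaveOp L a α) ε) {D : ℂ} :
    HasSpectralDet (dampedWaveOp L a α) (Real.pi + ε) D ↔ D = 4 * L / (2 - α) := by
  obtain ⟨⟨h1, h2⟩, h3⟩ := hε
  rw [hasSpectralDet_dampedWaveOp_iff ha hα hα' (σ := -1) (Or.inr rfl) ?_ fun r hr =>
    h3 _ ⟨by linarith, le_rfl⟩ r hr]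
  · have h4 : α - 2 ≠ 0 := sub_ne_zero.2 hα
    have h5 : 2 - α ≠ 0 := sub_ne_zero.2 hα.symm
    have h6 : -((L : ℂ) / ((α + 2 * ((-1 : ℝ) : ℂ)) / 4)) = 4 * L / (2 - α) := by
      rw [show α + 2 * ((-1 : ℝ) : ℂ) = -(2 - α) by push_cast; ring]
      field_simp
    rw [h6]
  · rw [add_comm, Real.cos_add_pi, neg_one_mul, neg_neg]
    exact Real.cos_pos_of_mem_Ioo ⟨by linarith, h2⟩

theorem hasSpectralDet_of_isCutBelowPosAxis (ha : a ∈ Ioo 0 L) (hα : α ≠ 2) (hα' : α ≠ -2) {ε : ℝ}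
    (hε : IsCutBelowPosAxis (dampedWaveOp L a α) ε) {D : ℂ} :
    HasSpectralDet (dampedWaveOp L a α) (2 * Real.pi - ε) D ↔ D = -(4 * L / (2 + α)) := by
  obtain ⟨⟨h1, h2⟩, h3⟩ := hε
  have hexp : Complex.exp ((2 * Real.pi - ε : ℝ) * Complex.I) =
      Complex.exp ((-ε : ℝ) * Complex.I) := by
    rw [show ((2 * Real.pi - ε : ℝ) : ℂ) * Complex.I =
      (-ε : ℝ) * Complex.I + 2 * Real.pi * Complex.I by push_cast; ring, Complex.exp_add,
      Complex.exp_two_pi_mul_I, mul_one]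
  rw [hasSpectralDet_dampedWaveOp_iff ha hα hα' (σ := 1) (Or.inl rfl) ?_ fun r hr => by
    rw [hexp]
    exact h3 _ ⟨le_rfl, by linarith⟩ r hr]
  · have h6 : -((L : ℂ) / ((α + 2 * ((1 : ℝ) : ℂ)) / 4)) = -(4 * L / (2 + α)) := by
      rw [show α + 2 * ((1 : ℝ) : ℂ) = 2 + α by push_cast; ring, div_div_eq_mul_div, mul_comm (L : ℂ)]
    rw [h6]
  · rw [one_mul, Real.cos_two_pi_sub]
    exact Real.cos_pos_of_mem_Ioo ⟨by linarith, h2⟩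

/-- The choice in the definition of `spectralDet` is harmless where the determinant is unique. -/
theorem spectralDet_eq {X : Type*} [AddCommGroup X] [Module ℂ X] {T : X →ₗ.[ℂ] X} {θ : ℝ} {D : ℂ}
    (h : ∀ D', HasSpectralDet T θ D' ↔ D' = D) : spectralDet T θ = D :=
  (h _).1 (Classical.epsilon_spec ⟨D, (h D).2 rfl⟩)

end CharFun

/-! ### Well-definedness and continuity of the determinant -/

/-- For `α ≠ ±2` and `a ∈ (0, L/2]` the spectral determinant of `H_α` is well defined and is a
continuous function of `a`, both for the cut `e^{i(π+ε)} (0, ∞)` and for the cut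
`e^{-iε} (0, ∞) = e^{i(2π-ε)} (0, ∞)` of the logarithm, where `ε` is any admissible number
(which may depend on `a`). -/
theorem mainTheorem3 (L : ℝ) (hL : 0 < L) (α : ℂ) (hα : α ≠ 2) (hα' : α ≠ -2) :
    ((∀ a ∈ Ioc 0 (L / 2), (∃ ε, IsCutBelowNegAxis (dampedWaveOp L a α) ε) ∧
        ∀ ε, IsCutBelowNegAxis (dampedWaveOp L a α) ε →
          ∃! D, HasSpectralDet (dampedWaveOp L a α) (Real.pi + ε) D) ∧
      ∀ ε : ℝ → ℝ, (∀ a ∈ Ioc 0 (L / 2), IsCutBelowNegAxis (dampedWaveOp L a α) (ε a)) →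
        ContinuousOn (fun a => spectralDet (dampedWaveOp L a α) (Real.pi + ε a))
          (Ioc 0 (L / 2))) ∧
    ((∀ a ∈ Ioc 0 (L / 2), (∃ ε, IsCutBelowPosAxis (dampedWaveOp L a α) ε) ∧
        ∀ ε, IsCutBelowPosAxis (dampedWaveOp L a α) ε →
          ∃! D, HasSpectralDet (dampedWaveOp L a α) (2 * Real.pi - ε) D) ∧
      ∀ ε : ℝ → ℝ, (∀ a ∈ Ioc 0 (L / 2), IsCutBelowPosAxis (dampedWaveOp L a α) (ε a)) →
        ContinuousOn (fun a => spectralDet (dampedWaveOp L a α) (2 * Real.pi - ε a))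
          (Ioc 0 (L / 2))) := by
  have hmem : ∀ a ∈ Ioc 0 (L / 2), a ∈ Ioo 0 L := fun a ha => ⟨ha.1, by linarith [ha.2]⟩
  refine ⟨⟨fun a ha => ⟨exists_isCutBelowNegAxis (hmem a ha) hα hα', fun ε hε => ?_⟩,
    fun ε hε => ?_⟩, ⟨fun a ha => ⟨exists_isCutBelowPosAxis (hmem a ha) hα hα', fun ε hε => ?_⟩,
    fun ε hε => ?_⟩⟩
  · have h := fun D => hasSpectralDet_of_isCutBelowNegAxis (hmem a ha) hα hα' hε (D := D)
    exact ⟨_, (h _).2 rfl, fun D hD => (h D).1 hD⟩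
  · refine (continuousOn_const (c := 4 * (L : ℂ) / (2 - α))).congr fun a ha => ?_
    exact spectralDet_eq fun D =>
      hasSpectralDet_of_isCutBelowNegAxis (hmem a ha) hα hα' (hε a ha)
  · have h := fun D => hasSpectralDet_of_isCutBelowPosAxis (hmem a ha) hα hα' hε (D := D)
    exact ⟨_, (h _).2 rfl, fun D hD => (h D).1 hD⟩
  · refine (continuousOn_const (c := -(4 * (L : ℂ) / (2 + α)))).congr fun a ha => ?_
    exact spectralDet_eq fun D =>
      hasSpectralDet_of_isCutBelowPosAxis (hmem a ha) hα hα' (hε a ha)
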